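/- Let $(\Omega,\mathcal F,\mathbf P)$ be a probability space, $\sigma>0$, $H\in(1/2,1)$, $\vartheta\in\mathbb R$, $u>0$, $T>0$. Let $W$ be a standard Brownian motion and $B^H$ an independent fractional Brownian motion with Hurst parameter $H$ (both with almost surely continuous paths), let $\xi_t=\sigma W_t+B^H_t$, let $X_t=u+\vartheta t-\xi_t$, and let $\psi(u,T)=\mathbf P\big(\inf_{t\in[0,T]}X_t<0\big)$ be the finite-time ruin probability. For $a\in\mathbb R$ let $\eta_a(u)=\inf\{t>0:\ \xi_t+at>u\}$, with $\inf\emptyset=\infty$. Then the following hold. (i) There is a unique function $g(s,t)$, $0\le s\le t\le T$, with $g(\cdot,t)$ continuous on $[0,t]$ for every $t$, such that $$\sigma g(s,t)+\frac1\sigma H(2H-1)\int_0^t g(r,t)\,|r-s|^{2H-2}\,dr=1,\qquad 0\le s\le t\le T,$$ and $\int_0^T g^2(s,s)\,ds<\infty$. (ii) The process $t\mapsto\int_0^t g(s,t)\,d\xi_s$, $t\in[0,T]$, of Wiener integrals (for each $t$, the limit in $L^2(\mathbf P)$ of the integrals of step functions that approximate $g(\cdot,t)$ in $L^2([0,t])$,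 where $\mathbf 1_{[0,s]}$ has integral $\xi_s$) has a version with almost surely continuous paths. With any such version, $\int_0^{\eta}g(s,\eta)\,d\xi_s$ denotes its value at the random time $\eta$. (iii) For every $a\in\mathbb R$ the random variable below is integrable, and $$\psi(u,T)=\mathbf E\left[\exp\left(-\frac{a+\vartheta}{\sigma}\int_0^{\eta_a(u)}g(s,\eta_a(u))\,d\xi_s-\frac{(a+\vartheta)^2}{2}\int_0^{\eta_a(u)}g^2(s,s)\,ds\right)\mathbf 1_{\{\eta_a(u)\le T\}}\right].$$ -/

import Mathlib

open MeasureTheory ProbabilityTheory Filter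
open scoped NNReal ENNReal Topology

noncomputable section

/-- `B` is a fractional Brownian motion with Hurst parameter `H`: a centered Gaussian process with
covariance `(t^{2H} + s^{2H} - |t - s|^{2H}) / 2` and almost surely continuous paths. -/
structure IsFractionalBrownian {Ω : Type*} [MeasurableSpace Ω] (H : ℝ) (B : ℝ≥0 → Ω → ℝ)
    (P : Measure Ω) : Prop where
  isGaussianProcess : IsGaussianProcess B P
  integral_eq_zero : ∀ t, ∫ ω, B t ω ∂P = 0
  covariance_eq : ∀ s t : ℝ≥0, cov[B s, B t; P] =
    ((t : ℝ) ^ (2 * H) + (s : ℝ) ^ (2 * H) - |(t : ℝ) - (s : ℝ)| ^ (2 * H)) / 2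
  cont : ∀ᵐ ω ∂P, Continuous (fun t => B t ω)

/-- The mixed process `ξ_t = σ W_t + B_t`. -/
def mixedProcess {Ω : Type*} (σ : ℝ) (W B : ℝ≥0 → Ω → ℝ) (t : ℝ≥0) (ω : Ω) : ℝ :=
  σ * W t ω + B t ω

/-- The surplus `X_t = u + ϑ t - ξ_t`. -/
def surplus {Ω : Type*} (u ϑ : ℝ) (ξ : ℝ≥0 → Ω → ℝ) (t : ℝ≥0) (ω : Ω) : ℝ :=
  u + ϑ * t - ξ t ω

/-- The probability that `X` is ruined by time `T`: `P (inf_{t ∈ [0, T]} X_t < 0)`. -/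
def ruinProbability {Ω : Type*} [MeasurableSpace Ω] (P : Measure Ω) (X : ℝ≥0 → Ω → ℝ)
    (T : ℝ≥0) : ℝ :=
  P.real {ω | sInf ((fun t => X t ω) '' Set.Icc 0 T) < 0}

/-- The first passage time `η_a(v) = inf {t > 0 | ξ_t + a t > v}`, equal to `∞` when the level `v`
is never exceeded. -/
def passageTime {Ω : Type*} (ξ : ℝ≥0 → Ω → ℝ) (a v : ℝ) (ω : Ω) : ℝ≥0∞ :=
  sInf ((fun t : ℝ≥0 => (t : ℝ≥0∞)) '' {t | 0 < t ∧ v < ξ t ω + a * t})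

/-- `g` solves, for every `t ∈ [0, T]`, the weakly singular integral equation
`σ g(s,t) + (1/σ) H(2H-1) ∫_0^t g(r,t) |r-s|^{2H-2} dr = 1` for all `s ∈ [0, t]`, in the class of
functions continuous in the variable `s ∈ [0, t]`. -/
structure IsMixedKernel (σ H : ℝ) (T : ℝ≥0) (g : ℝ → ℝ → ℝ) : Prop where
  continuousOn : ∀ t ∈ Set.Icc (0 : ℝ) T, ContinuousOn (fun s => g s t) (Set.Icc 0 t)
  equation : ∀ t ∈ Set.Icc (0 : ℝ) T, ∀ s ∈ Set.Icc (0 : ℝ) t,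
    σ * g s t + 1 / σ * (H * (2 * H - 1)) * (∫ r in (0 : ℝ)..t, g r t * |r - s| ^ (2 * H - 2)) = 1

/-- The step function `∑ c_i 1_{[0, s_i]}` encoded by a finitely supported `p = ∑ c_i δ_{s_i}`. -/
def stepFun (p : ℝ≥0 →₀ ℝ) (x : ℝ) : ℝ :=
  p.sum fun s c => c * (Set.Icc (0 : ℝ) s).indicator (fun _ => 1) x

/-- The integral `∑ c_i ξ_{s_i}` of the step function `∑ c_i 1_{[0, s_i]}` against `ξ`. -/
def stepIntegral {Ω : Type*} (ξ : ℝ≥0 → Ω → ℝ) (p : ℝ≥0 →₀ ℝ) (ω : Ω) : ℝ :=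
  p.sum fun s c => c * ξ s ω

/-- `Y` is (a version of) the Wiener integral `∫_0^t φ(s) dξ_s`: the limit in `L²(P)` of the
integrals of step functions on `[0, t]` that converge to `φ`. The approximation is in `L²([0, t])`;
for `ξ = σ W + B^H` with `σ ≠ 0` and `1/2 < H < 1` the norm of `L²([0, t])` is equivalent to
`(σ² ∫ φ² + H(2H-1) ∬ φ(x) φ(y) |x-y|^{2H-2})^{1/2}`, the norm that makes the map
`1_{[0,s]} ↦ ξ_s` an isometry into `L²(P)`. -/
def IsWienerIntegral {Ω : Type*} [MeasurableSpace Ω] (P : Measure Ω) (ξ : ℝ≥0 → Ω → ℝ) (t : ℝ≥0)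
    (φ : ℝ → ℝ) (Y : Ω → ℝ) : Prop :=
  MemLp Y 2 P ∧ ∃ p : ℕ → (ℝ≥0 →₀ ℝ), (∀ n, ∀ s ∈ (p n).support, s ≤ t) ∧
    Tendsto (fun n => eLpNorm (fun x => φ x - stepFun (p n) x) 2
      (volume.restrict (Set.Icc (0 : ℝ) t))) atTop (𝓝 0) ∧
    Tendsto (fun n => eLpNorm (fun ω => Y ω - stepIntegral ξ (p n) ω) 2 P) atTop (𝓝 0)

/-- `N` is a version, with continuous paths on `[0, T]`, of the process
`t ↦ ∫_0^t g(s, t) dξ_s`, `t ∈ [0, T]`. Two such versions are indistinguishable on `[0, T]`. -/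
structure IsContinuousIntegralProcess {Ω : Type*} [MeasurableSpace Ω] (P : Measure Ω)
    (ξ : ℝ≥0 → Ω → ℝ) (T : ℝ≥0) (g : ℝ → ℝ → ℝ) (N : ℝ≥0 → Ω → ℝ) : Prop where
  isWienerIntegral : ∀ t ≤ T, IsWienerIntegral P ξ t (fun s => g s t) (N t)
  cont : ∀ᵐ ω ∂P, ContinuousOn (fun t => N t ω) (Set.Icc 0 T)

/-- The random variable
`exp (-((a + ϑ)/σ) N_η - ((a + ϑ)²/2) ∫_0^η g(s, s)² ds) 1_{η ≤ T}`. -/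
def ruinWeight {Ω : Type*} (σ ϑ a : ℝ) (T : ℝ≥0) (g : ℝ → ℝ → ℝ) (N : ℝ≥0 → Ω → ℝ)
    (η : Ω → ℝ≥0∞) : Ω → ℝ :=
  {ω | η ω ≤ T}.indicator fun ω =>
    Real.exp (-((a + ϑ) / σ) * N (η ω).toNNReal ω
      - (a + ϑ) ^ 2 / 2 * ∫ s in (0 : ℝ)..(η ω).toReal, g s s ^ 2)

end

/-!
Write `ξ = σ W + B^H`, `c = a + ϑ`, `g` for the kernel and `N_t = ∫_0^t g(s,t) dξ_s`.

*The kernel.* With `K_t F(s) = H (2H - 1) ∫_0^t F(r) |r - s|^{2H - 2} dr`, the equation reads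
`(σ² + K_t) g(·, t) = σ` on `C([0, t])`. By scaling it is an equation on `C([0, 1])` with a compact
operator, which is positive semidefinite because linear combinations of the values of `B^H` have
nonnegative variances (`IsMixedGaussian.fracPos`). So `σ² + K_t` is injective, hence invertible by
the Fredholm alternative (`isUnit_add_fracOp`). Comparing the equations on `[0, t]` and `[0, t']` as
`t' ↓ t` gives `d/dt ∫_0^t g(s,t) ds = σ g(t,t)²` (`integral_mixedKer_eq`).

*The integrals.* The map `1_{[0,s]} ↦ ξ_s` is an isometry from the step functions on `[0, t]` with
the form `⟨φ, (σ² + K_t) ψ⟩` into `L²(P)`. Because `(σ² + K_t) g(·, t)` is the constant `σ`, one has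
`E[N_t ξ_s] = σ s` for `s ≤ t`, hence `E[N_t N_s] = σ ∫_0^s g(r,s) dr = σ² ∫_0^s g(r,r)² dr`: the
process `N` is Gaussian with the covariance of a time-changed Brownian motion. Its increments are
Gaussian with variance `O(t - s)`, and Kolmogorov's criterion gives a continuous version
(`exists_isContinuousIntegralProcess`).

*The change of measure.* By the Cameron–Martin formula (`InGaussianSpace.lintegral_exp_mul`), under
the density `Z_t = exp (-(c/σ) N_t - (c²/2) ∫_0^t g(s,s)² ds)` the process `(ξ_s)_{s ≤ t}` becomes
`ξ_s - c s`. For `η = η_a(u)` and `r ≤ t` the event `{r ≤ η < t}` depends on `ξ` up to time `t`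
only, so that `E[Z_t 1_{r ≤ η < t}] = P(r ≤ η_{-ϑ}(u) < t)` (`setLIntegral_exp_passageTime`).
Summing over a dyadic partition gives `E[Z_{η_n} 1_{η < T}] = P(η_{-ϑ}(u) < T)` for the dyadic
approximations `η_n` of `η` from above. The same formula with twice the slope bounds
`E[Z_{η_n}² 1_{η < T}]`, so these weights are uniformly integrable and, by continuity of paths, the
formula passes to the limit `η_n → η` (`lintegral_indicator_lt_eq`). Finally `P(η = T) = 0`, because
`ξ_T` has no atoms, and `{η_{-ϑ}(u) < T}` is the event of ruin.
-/

/-! ### The singular kernel -/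

/-- The kernel `k(z) = H (2H - 1) |z|^{2H-2}`, the density of the covariance of a fractional
Brownian motion with `H > 1/2`. -/
noncomputable def fracKernel (H z : ℝ) : ℝ := H * (2 * H - 1) * |z| ^ (2 * H - 2)

/-- The odd primitive of `fracKernel H`. -/
noncomputable def fracPrim (H z : ℝ) : ℝ := ∫ w in (0 : ℝ)..z, fracKernel H w

/-- The convolution `x ↦ ∫_0^t F(y) k(y - x) dy`. -/
noncomputable def fracConv (H t : ℝ) (F : ℝ → ℝ) (x : ℝ) : ℝ :=
  ∫ y in (0 : ℝ)..t, F y * fracKernel H (y - x)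

section Kernel

variable {H : ℝ}

lemma fracKernel_nonneg (hH : 1 / 2 < H) (z : ℝ) : 0 ≤ fracKernel H z := by
  have : 0 ≤ 2 * H - 1 := by linarith
  have : 0 ≤ H := by linarith
  unfold fracKernel
  positivity

lemma fracKernel_neg (z : ℝ) : fracKernel H (-z) = fracKernel H z := by simp [fracKernel]

lemma fracKernel_sub_comm (x y : ℝ) : fracKernel H (x - y) = fracKernel H (y - x) := by
  rw [← fracKernel_neg, neg_sub]

@[fun_prop]
lemma measurable_fracKernel : Measurable (fracKernel H) := by
  unfold fracKernel
  fun_prop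

lemma fracKernel_mul {t : ℝ} (ht : 0 ≤ t) (z : ℝ) :
    fracKernel H (t * z) = t ^ (2 * H - 2) * fracKernel H z := by
  unfold fracKernel
  rw [abs_mul, abs_of_nonneg ht, Real.mul_rpow ht (abs_nonneg z)]
  ring

lemma continuousAt_fracKernel {z : ℝ} (hz : z ≠ 0) : ContinuousAt (fracKernel H) z := by
  unfold fracKernel
  refine ContinuousAt.mul continuousAt_const ?_
  exact ContinuousAt.rpow_const continuous_abs.continuousAt (Or.inl (abs_ne_zero.2 hz))

lemma intervalIntegrable_fracKernel (hH : 1 / 2 < H) (a b : ℝ) :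
    IntervalIntegrable (fracKernel H) volume a b := by
  have pos : ∀ c : ℝ, 0 ≤ c → IntervalIntegrable (fracKernel H) volume 0 c := by
    intro c hc
    have h : IntervalIntegrable (fun x : ℝ => H * (2 * H - 1) * x ^ (2 * H - 2)) volume 0 c :=
      (intervalIntegral.intervalIntegrable_rpow' (by linarith)).const_mul _
    refine h.congr fun x hx => ?_
    rw [Set.uIoc_of_le hc] at hx
    simp [fracKernel, abs_of_pos hx.1]
  have all : ∀ c : ℝ, IntervalIntegrable (fracKernel H) volume 0 c := by
    intro c
    rcases le_total 0 c with hc | hc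
    · exact pos c hc
    · have := (pos (-c) (by linarith)).comp_mul_left (c := -1)
      simpa [fracKernel_neg] using this
  exact (all a).symm.trans (all b)

lemma intervalIntegrable_fracKernel_sub (hH : 1 / 2 < H) (a b x : ℝ) :
    IntervalIntegrable (fun y => fracKernel H (y - x)) volume a b := by
  have := (intervalIntegrable_fracKernel hH (a - x) (b - x)).comp_sub_right x
  simpa using this

lemma continuous_fracPrim (hH : 1 / 2 < H) : Continuous (fracPrim H) :=
  intervalIntegral.continuous_primitive (intervalIntegrable_fracKernel hH) 0

lemma fracPrim_neg (z : ℝ) : fracPrim H (-z) = -fracPrim H z := by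
  unfold fracPrim
  have := intervalIntegral.integral_comp_neg (a := 0) (b := z) (fracKernel H)
  simp only [fracKernel_neg, neg_zero] at this
  rw [intervalIntegral.integral_symm, ← this]

lemma integral_fracKernel_sub (hH : 1 / 2 < H) (a b x : ℝ) :
    ∫ y in a..b, fracKernel H (y - x) = fracPrim H (b - x) - fracPrim H (a - x) := by
  rw [intervalIntegral.integral_comp_sub_right (fracKernel H) x]
  unfold fracPrim
  rw [intervalIntegral.integral_interval_sub_left (intervalIntegrable_fracKernel hH _ _)
    (intervalIntegrable_fracKernel hH _ _)]

lemma fracPrim_eq (hH : 1 / 2 < H) {z : ℝ} (hz : 0 ≤ z) : fracPrim H z = H * z ^ (2 * H - 1) := by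
  unfold fracPrim
  have h : ∫ w in (0 : ℝ)..z, fracKernel H w
      = ∫ w in (0 : ℝ)..z, H * (2 * H - 1) * w ^ (2 * H - 2) := by
    refine intervalIntegral.integral_congr fun x hx => ?_
    rw [Set.uIcc_of_le hz] at hx
    simp [fracKernel, abs_of_nonneg hx.1]
  rw [h, intervalIntegral.integral_const_mul, integral_rpow (Or.inl (by linarith)),
    show 2 * H - 2 + 1 = 2 * H - 1 by ring, Real.zero_rpow (by linarith)]
  have : 2 * H - 1 ≠ 0 := by linarith
  rw [sub_zero, mul_div_assoc', mul_assoc, mul_div_assoc, mul_div_cancel_left₀ _ this]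

lemma integral_fracPrim (hH : 1 / 2 < H) (z : ℝ) :
    ∫ w in (0 : ℝ)..z, fracPrim H w = |z| ^ (2 * H) / 2 := by
  have pos : ∀ c : ℝ, 0 ≤ c → ∫ w in (0 : ℝ)..c, fracPrim H w = |c| ^ (2 * H) / 2 := by
    intro c hc
    have h : ∫ w in (0 : ℝ)..c, fracPrim H w = ∫ w in (0 : ℝ)..c, H * w ^ (2 * H - 1) := by
      refine intervalIntegral.integral_congr fun x hx => ?_
      rw [Set.uIcc_of_le hc] at hx
      exact fracPrim_eq hH hx.1
    rw [h, intervalIntegral.integral_const_mul, integral_rpow (Or.inl (by linarith)),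
      show 2 * H - 1 + 1 = 2 * H by ring, Real.zero_rpow (by linarith), abs_of_nonneg hc]
    field_simp [show H ≠ 0 by linarith]
    simp
  rcases le_total 0 z with hz | hz
  · exact pos z hz
  · have h := intervalIntegral.integral_comp_neg (a := 0) (b := z) (fracPrim H)
    simp only [fracPrim_neg, neg_zero, intervalIntegral.integral_neg] at h
    rw [intervalIntegral.integral_symm 0 (-z), neg_inj] at h
    rw [h, pos (-z) (by linarith), abs_neg]

/-- The double integral of the kernel is the covariance of the fractional Brownian motion. -/
lemma integral_integral_fracKernel (hH : 1 / 2 < H) {r s : ℝ} (hr : 0 ≤ r) (hs : 0 ≤ s) :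
    ∫ x in (0 : ℝ)..r, ∫ y in (0 : ℝ)..s, fracKernel H (y - x)
      = (r ^ (2 * H) + s ^ (2 * H) - |r - s| ^ (2 * H)) / 2 := by
  have hc := continuous_fracPrim hH
  simp_rw [integral_fracKernel_sub hH]
  rw [intervalIntegral.integral_sub (Continuous.intervalIntegrable (by fun_prop) _ _)
    (Continuous.intervalIntegrable (by fun_prop) _ _)]
  rw [intervalIntegral.integral_comp_sub_left (fracPrim H),
    intervalIntegral.integral_comp_sub_left (fracPrim H)]
  have h : ∀ p q, ∫ x in p..q, fracPrim H x = |q| ^ (2 * H) / 2 - |p| ^ (2 * H) / 2 := by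
    intro p q
    rw [← intervalIntegral.integral_interval_sub_left (a := 0) (hc.intervalIntegrable _ _)
      (hc.intervalIntegrable _ _), integral_fracPrim hH, integral_fracPrim hH]
  rw [h, h, abs_sub_comm r s]
  simp [abs_of_nonneg hr, abs_of_nonneg hs, Real.zero_rpow (show 2 * H ≠ 0 by linarith)]
  ring

lemma intervalIntegrable_mul_fracKernel (hH : 1 / 2 < H) {F : ℝ → ℝ} (hF : Measurable F) {A : ℝ}
    (hA : ∀ x, |F x| ≤ A) (a b x : ℝ) :
    IntervalIntegrable (fun y => F y * fracKernel H (y - x)) volume a b := by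
  have h := intervalIntegrable_fracKernel_sub hH a b x
  exact ⟨h.1.bdd_mul (c := A) hF.aestronglyMeasurable (ae_of_all _ fun y => by simpa using hA y),
    h.2.bdd_mul (c := A) hF.aestronglyMeasurable (ae_of_all _ fun y => by simpa using hA y)⟩

lemma abs_integral_mul_fracKernel_le (hH : 1 / 2 < H) {F : ℝ → ℝ} {A a b : ℝ} (hab : a ≤ b)
    (hA : ∀ x ∈ Set.Ioc a b, |F x| ≤ A) (x : ℝ) :
    |∫ y in a..b, F y * fracKernel H (y - x)| ≤ A * (fracPrim H (b - x) - fracPrim H (a - x)) := by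
  rw [← integral_fracKernel_sub hH, ← intervalIntegral.integral_const_mul]
  refine intervalIntegral.norm_integral_le_of_norm_le (E := ℝ) hab
    (ae_of_all _ fun y hy => ?_) ((intervalIntegrable_fracKernel_sub hH a b x).const_mul A)
  rw [norm_mul, Real.norm_eq_abs, Real.norm_eq_abs, abs_of_nonneg (fracKernel_nonneg hH _)]
  exact mul_le_mul_of_nonneg_right (hA y hy) (fracKernel_nonneg hH _)

/-- Scheffé's argument: `|p - q| = p + q - 2 min p q`, the integrals of the kernels converge, and
`min` is dominated. -/
lemma tendsto_integral_abs_fracKernel_sub (hH : 1 / 2 < H) (a b x₀ : ℝ) :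
    Tendsto (fun x => ∫ y in a..b, |fracKernel H (y - x) - fracKernel H (y - x₀)|) (𝓝 x₀)
      (𝓝 0) := by
  have hint := intervalIntegrable_fracKernel_sub hH a b
  have hmin : ∀ x, IntervalIntegrable
      (fun y => min (fracKernel H (y - x)) (fracKernel H (y - x₀))) volume a b := fun x =>
    ⟨(hint x).1.inf (hint x₀).1, (hint x).2.inf (hint x₀).2⟩
  have h1 : ∀ x, ∫ y in a..b, |fracKernel H (y - x) - fracKernel H (y - x₀)|
      = (∫ y in a..b, fracKernel H (y - x)) + (∫ y in a..b, fracKernel H (y - x₀))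
        - 2 * ∫ y in a..b, min (fracKernel H (y - x)) (fracKernel H (y - x₀)) := by
    intro x
    rw [← intervalIntegral.integral_add (hint x) (hint x₀), ← intervalIntegral.integral_const_mul,
      ← intervalIntegral.integral_sub ((hint x).add (hint x₀)) ((hmin x).const_mul 2)]
    refine intervalIntegral.integral_congr fun y _ => ?_
    have := min_add_max (fracKernel H (y - x)) (fracKernel H (y - x₀))
    have h2 := max_sub_min_eq_abs (fracKernel H (y - x)) (fracKernel H (y - x₀))
    rw [abs_sub_comm] at h2
    linarith
  simp_rw [h1]
  have h2 : Tendsto (fun x => ∫ y in a..b, fracKernel H (y - x)) (𝓝 x₀)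
      (𝓝 (∫ y in a..b, fracKernel H (y - x₀))) := by
    simp_rw [integral_fracKernel_sub hH]
    have hc := continuous_fracPrim hH
    exact Continuous.tendsto (f := fun x => fracPrim H (b - x) - fracPrim H (a - x))
      (by fun_prop) x₀
  have h3 : Tendsto (fun x => ∫ y in a..b, min (fracKernel H (y - x)) (fracKernel H (y - x₀)))
      (𝓝 x₀) (𝓝 (∫ y in a..b, fracKernel H (y - x₀))) := by
    refine intervalIntegral.tendsto_integral_filter_of_dominated_convergence
      (fun y => fracKernel H (y - x₀)) (Eventually.of_forall fun x => by
        apply Measurable.aestronglyMeasurable; fun_prop)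
      (Eventually.of_forall fun x => ae_of_all _ fun y _ => ?_) (hint x₀) ?_
    · rw [Real.norm_eq_abs, abs_of_nonneg (le_min (fracKernel_nonneg hH _)
        (fracKernel_nonneg hH _))]
      exact min_le_right _ _
    · have : ∀ᵐ y : ℝ, y ≠ x₀ := by simp [ae_iff]
      filter_upwards [this] with y hy _
      have hc : ContinuousAt (fun x => fracKernel H (y - x)) x₀ :=
        ContinuousAt.comp (g := fracKernel H) (continuousAt_fracKernel (sub_ne_zero.2 hy))
          (by fun_prop)
      simpa using hc.tendsto.min (tendsto_const_nhds (x := fracKernel H (y - x₀)))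
  have := (h2.add (tendsto_const_nhds (x := ∫ y in a..b, fracKernel H (y - x₀)))).sub
    (h3.const_mul 2)
  refine this.trans_eq (congrArg 𝓝 ?_)
  ring

lemma abs_integral_mul_fracKernel_sub_le (hH : 1 / 2 < H) {F : ℝ → ℝ} (hF : Measurable F) {A : ℝ}
    (hA : ∀ x, |F x| ≤ A) {a b : ℝ} (hab : a ≤ b) (x x₀ : ℝ) :
    |(∫ y in a..b, F y * fracKernel H (y - x)) - ∫ y in a..b, F y * fracKernel H (y - x₀)|
      ≤ A * ∫ y in a..b, |fracKernel H (y - x) - fracKernel H (y - x₀)| := by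
  rw [← intervalIntegral.integral_sub (intervalIntegrable_mul_fracKernel hH hF hA _ _ _)
    (intervalIntegrable_mul_fracKernel hH hF hA _ _ _), ← intervalIntegral.integral_const_mul]
  refine intervalIntegral.norm_integral_le_of_norm_le (E := ℝ) hab
    (ae_of_all _ fun y hy => ?_) ?_
  · rw [← mul_sub, norm_mul]
    exact mul_le_mul_of_nonneg_right (hA y) (norm_nonneg _)
  · exact ((intervalIntegrable_fracKernel_sub hH a b x).sub
      (intervalIntegrable_fracKernel_sub hH a b x₀)).abs.const_mul A

lemma continuous_integral_mul_fracKernel (hH : 1 / 2 < H) {F : ℝ → ℝ} (hF : Measurable F) {A : ℝ}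
    (hA : ∀ x, |F x| ≤ A) {a b : ℝ} (hab : a ≤ b) :
    Continuous fun x => ∫ y in a..b, F y * fracKernel H (y - x) := by
  rw [continuous_iff_continuousAt]
  intro x₀
  rw [ContinuousAt, tendsto_iff_dist_tendsto_zero]
  refine squeeze_zero (fun _ => dist_nonneg)
    (fun x => abs_integral_mul_fracKernel_sub_le hH hF hA hab x x₀) ?_
  simpa using (tendsto_integral_abs_fracKernel_sub hH a b x₀).const_mul A

/-- Symmetry of the quadratic form of the kernel, over two intervals. -/
lemma integral_mul_integral_fracKernel_swap (hH : 1 / 2 < H) {F G : ℝ → ℝ} (hF : Measurable F)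
    (hG : Measurable G) {A B : ℝ} (hA : ∀ x, |F x| ≤ A) (hB : ∀ x, |G x| ≤ B) {a b c d : ℝ}
    (hab : a ≤ b) (hcd : c ≤ d) :
    ∫ x in a..b, F x * ∫ y in c..d, G y * fracKernel H (y - x)
      = ∫ y in c..d, G y * ∫ x in a..b, F x * fracKernel H (x - y) := by
  have hA0 : 0 ≤ A := (abs_nonneg _).trans (hA 0)
  have hB0 : 0 ≤ B := (abs_nonneg _).trans (hB 0)
  have hm : Measurable (Function.uncurry fun x y => F x * (G y * fracKernel H (y - x))) := by
    unfold Function.uncurry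
    fun_prop
  have key : ∫ x in a..b, ∫ y in c..d, F x * (G y * fracKernel H (y - x))
      = ∫ y in c..d, ∫ x in a..b, F x * (G y * fracKernel H (y - x)) := by
    refine intervalIntegral_intervalIntegral_swap ?_
    rw [Set.uIoc_of_le hab, Set.uIoc_of_le hcd, IntegrableOn, Measure.volume_eq_prod,
      ← Measure.prod_restrict, integrable_prod_iff hm.aestronglyMeasurable]
    constructor
    · refine ae_of_all _ fun x => ?_
      have := (intervalIntegrable_mul_fracKernel hH hG hB c d x).const_mul (F x)
      rw [intervalIntegrable_iff_integrableOn_Ioc_of_le hcd] at this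
      exact this
    · have hdom : IntegrableOn
          (fun x => A * (B * (fracPrim H (d - x) - fracPrim H (c - x)))) (Set.Ioc a b) := by
        have hc := continuous_fracPrim hH
        exact (Continuous.continuousOn (by fun_prop)).integrableOn_Icc.mono_set
          Set.Ioc_subset_Icc_self
      refine Integrable.mono' hdom ?_ (ae_of_all _ fun x => ?_)
      · exact (hm.norm.stronglyMeasurable.integral_prod_right
          (ν := volume.restrict (Set.Ioc c d))).aestronglyMeasurable
      · rw [Real.norm_eq_abs, abs_of_nonneg (by positivity)]
        have h1 : ∀ y, ‖Function.uncurry (fun x y => F x * (G y * fracKernel H (y - x))) (x, y)‖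
            ≤ A * (B * fracKernel H (y - x)) := by
          intro y
          simp only [Function.uncurry, norm_mul, Real.norm_eq_abs,
            abs_of_nonneg (fracKernel_nonneg hH _)]
          exact mul_le_mul (hA x) (mul_le_mul_of_nonneg_right (hB y) (fracKernel_nonneg hH _))
            (mul_nonneg (abs_nonneg _) (fracKernel_nonneg hH _)) hA0
        have h2 := (intervalIntegrable_fracKernel_sub hH c d x)
        rw [intervalIntegrable_iff_integrableOn_Ioc_of_le hcd] at h2
        rw [← integral_fracKernel_sub hH, intervalIntegral.integral_of_le hcd,
          ← integral_const_mul, ← integral_const_mul]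
        refine integral_mono_of_nonneg (ae_of_all _ fun _ => norm_nonneg _)
          ((h2.const_mul B).const_mul A) (ae_of_all _ h1)
  simp only [intervalIntegral.integral_const_mul] at key
  rw [key]
  refine intervalIntegral.integral_congr fun y _ => ?_
  rw [← intervalIntegral.integral_const_mul]
  refine intervalIntegral.integral_congr fun x _ => ?_
  rw [fracKernel_sub_comm y x]
  ring

end Kernel

/-! ### The integral equation on the unit interval -/

section UnitInterval

open scoped BoundedContinuousFunction

variable {H : ℝ}

/-- The Banach space `C([0, 1])`. -/
abbrev UnitFun : Type := unitInterval →ᵇ ℝ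

/-- Extension of a function on `[0, 1]` to the line, constant outside `[0, 1]`. -/
noncomputable def unitExt (f : UnitFun) : ℝ → ℝ := Set.IccExtend zero_le_one f

@[fun_prop]
lemma continuous_unitExt (f : UnitFun) : Continuous (unitExt f) := f.continuous.Icc_extend'

lemma abs_unitExt_le (f : UnitFun) (x : ℝ) : |unitExt f x| ≤ ‖f‖ := f.norm_coe_le_norm _

lemma unitExt_of_mem (f : UnitFun) {x : ℝ} (hx : x ∈ Set.Icc (0 : ℝ) 1) :
    unitExt f x = f ⟨x, hx⟩ := Set.IccExtend_of_mem _ _ hx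

lemma unitExt_coe (f : UnitFun) (x : unitInterval) : unitExt f x = f x := unitExt_of_mem f x.2

lemma abs_fracConv_one_le (hH : 1 / 2 < H) {F : ℝ → ℝ} {A : ℝ} (hA : ∀ x, |F x| ≤ A)
    {x : ℝ} (hx : x ∈ Set.Icc (0 : ℝ) 1) : |fracConv H 1 F x| ≤ 2 * H * A := by
  have hA0 : 0 ≤ A := (abs_nonneg _).trans (hA 0)
  refine (abs_integral_mul_fracKernel_le hH zero_le_one (fun y _ => hA y) x).trans ?_
  have h : ∀ z ∈ Set.Icc (0 : ℝ) 1, fracPrim H z ≤ H := by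
    intro z hz
    rw [fracPrim_eq hH hz.1]
    exact mul_le_of_le_one_right (by linarith) (Real.rpow_le_one hz.1 hz.2 (by linarith))
  rw [zero_sub, fracPrim_neg]
  have h1 := h (1 - x) ⟨by linarith [hx.2], by linarith [hx.1]⟩
  have h2 := h x hx
  nlinarith

/-- The operator `f ↦ ∫_0^1 f(y) k(y - ·) dy` on `C([0, 1])`. -/
noncomputable def fracOp (hH : 1 / 2 < H) : UnitFun →L[ℝ] UnitFun :=
  LinearMap.mkContinuous
    { toFun := fun f => BoundedContinuousFunction.mkOfCompact
        ⟨fun x : unitInterval => fracConv H 1 (unitExt f) x,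
          (continuous_integral_mul_fracKernel hH (continuous_unitExt f).measurable
            (abs_unitExt_le f) zero_le_one).comp continuous_subtype_val⟩
      map_add' := fun f g => by
        ext x
        have hi := fun f : UnitFun => intervalIntegrable_mul_fracKernel hH
          (continuous_unitExt f).measurable (abs_unitExt_le f) 0 1 x
        simp only [BoundedContinuousFunction.mkOfCompact_apply, ContinuousMap.coe_mk,
          BoundedContinuousFunction.coe_add, Pi.add_apply, fracConv]
        rw [← intervalIntegral.integral_add (hi f) (hi g)]
        exact intervalIntegral.integral_congr fun y _ => add_mul _ _ _
      map_smul' := fun c f => by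
        ext x
        simp only [BoundedContinuousFunction.mkOfCompact_apply, ContinuousMap.coe_mk,
          BoundedContinuousFunction.coe_smul, fracConv, smul_eq_mul, RingHom.id_apply]
        rw [← intervalIntegral.integral_const_mul]
        exact intervalIntegral.integral_congr fun y _ => mul_assoc c _ _ }
    (2 * H) fun f => by
      rw [BoundedContinuousFunction.norm_le (by positivity [show 0 < H by linarith])]
      intro x
      exact abs_fracConv_one_le hH (abs_unitExt_le f) x.2

lemma fracOp_apply (hH : 1 / 2 < H) (f : UnitFun) (x : unitInterval) :
    fracOp hH f x = fracConv H 1 (unitExt f) x := rfl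

/-- Compactness by the Arzelà–Ascoli theorem. -/
lemma isCompactOperator_fracOp (hH : 1 / 2 < H) : IsCompactOperator (fracOp hH) := by
  have h := isCompactOperator_iff_isCompact_closure_image_closedBall
    ((fracOp hH : UnitFun →L[ℝ] UnitFun) : UnitFun →ₗ[ℝ] UnitFun) (r := 1) one_pos
  refine h.2 ?_
  have hb : ∀ f ∈ Metric.closedBall (0 : UnitFun) 1, ∀ x, |unitExt f x| ≤ 1 := fun f hf x =>
    (abs_unitExt_le f x).trans (by simpa using hf)
  refine BoundedContinuousFunction.arzela_ascoli (Metric.closedBall (0 : ℝ) (2 * H))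
    (isCompact_closedBall _ _) _ ?_ ?_
  · rintro _ x ⟨f, hf, rfl⟩
    have := abs_fracConv_one_le hH (hb f hf) x.2
    simpa [fracOp_apply] using this
  · intro x₀
    rw [Metric.equicontinuousAt_iff_right]
    intro ε hε
    have ht : Tendsto (fun x : unitInterval => ∫ y in (0 : ℝ)..1,
        |fracKernel H (y - x) - fracKernel H (y - x₀)|) (𝓝 x₀) (𝓝 0) :=
      (tendsto_integral_abs_fracKernel_sub hH 0 1 x₀).comp
        (continuous_subtype_val.tendsto x₀)
    filter_upwards [ht.eventually (gt_mem_nhds hε)] with x hx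
    rintro ⟨_, ⟨f, hf, rfl⟩⟩
    have := abs_integral_mul_fracKernel_sub_le hH (continuous_unitExt f).measurable (hb f hf)
      zero_le_one x x₀
    rw [dist_comm, Real.dist_eq]
    exact lt_of_le_of_lt this (by simpa using hx)

/-- Positive semidefiniteness of the kernel on `[0, 1]`. -/
def FracPos (H : ℝ) : Prop :=
  ∀ F : ℝ → ℝ, Continuous F → 0 ≤ ∫ x in (0 : ℝ)..1, F x * fracConv H 1 F x

lemma eq_zero_of_add_fracOp_eq_zero (hH : 1 / 2 < H) (hpos : FracPos H) {a c : ℝ} (ha : 0 < a)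
    (hc : 0 ≤ c) {f : UnitFun} (hf : a • f + c • fracOp hH f = 0) : f = 0 := by
  have hcont : Continuous (fracConv H 1 (unitExt f)) := continuous_integral_mul_fracKernel hH
    (continuous_unitExt f).measurable (abs_unitExt_le f) zero_le_one
  have hF := continuous_unitExt f
  have h0 : ∀ x ∈ Set.Icc (0 : ℝ) 1, a * unitExt f x + c * fracConv H 1 (unitExt f) x = 0 := by
    intro x hx
    have := congrArg (fun g : UnitFun => g ⟨x, hx⟩) hf
    simpa [fracOp_apply, unitExt_of_mem f hx] using this
  have h1 : ∫ x in (0 : ℝ)..1, unitExt f x * (a * unitExt f x + c * fracConv H 1 (unitExt f) x)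
      = 0 := by
    rw [intervalIntegral.integral_congr (g := fun _ => (0 : ℝ))]
    · simp
    · intro x hx
      rw [Set.uIcc_of_le zero_le_one] at hx
      simp [h0 x hx]
  have h2 : ∫ x in (0 : ℝ)..1, unitExt f x * (a * unitExt f x + c * fracConv H 1 (unitExt f) x)
      = a * (∫ x in (0 : ℝ)..1, unitExt f x ^ 2)
        + c * ∫ x in (0 : ℝ)..1, unitExt f x * fracConv H 1 (unitExt f) x := by
    rw [← intervalIntegral.integral_const_mul, ← intervalIntegral.integral_const_mul,
      ← intervalIntegral.integral_add (Continuous.intervalIntegrable (by fun_prop) _ _)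
        (Continuous.intervalIntegrable (by fun_prop) _ _)]
    exact intervalIntegral.integral_congr fun x _ => by ring
  have h3 := mul_nonneg hc (hpos _ hF)
  have h4 : ∫ x in (0 : ℝ)..1, unitExt f x ^ 2 ≤ 0 := by nlinarith
  by_contra hne
  obtain ⟨x, hx⟩ : ∃ x, f x ≠ 0 := by
    by_contra! hall
    exact hne (BoundedContinuousFunction.ext hall)
  refine absurd h4 (not_le.2 (intervalIntegral.integral_pos zero_lt_one
    (Continuous.continuousOn (by fun_prop)) (fun y _ => sq_nonneg _) ⟨x, x.2, ?_⟩))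
  rw [unitExt_coe]
  positivity

lemma isUnit_smul_one_add_smul {A : Type*} [Ring A] [Algebra ℝ A] {K : A} {a c : ℝ} (hc : c ≠ 0)
    (h : IsUnit (algebraMap ℝ A (-(a / c)) - K)) : IsUnit (a • 1 + c • K) := by
  have h2 := ((isUnit_iff_ne_zero.2 (neg_ne_zero.2 hc)).map (algebraMap ℝ A)).mul h
  convert h2 using 1
  rw [mul_sub, ← map_mul, Algebra.algebraMap_eq_smul_one, Algebra.algebraMap_eq_smul_one,
    smul_mul_assoc, one_mul, neg_smul c K, sub_neg_eq_add]
  congr 2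
  field_simp

lemma isUnit_smul_one {A : Type*} [Ring A] [Algebra ℝ A] {a : ℝ} (ha : a ≠ 0) :
    IsUnit (a • (1 : A)) := by
  rw [← Algebra.algebraMap_eq_smul_one]
  exact (isUnit_iff_ne_zero.2 ha).map (algebraMap ℝ A)

lemma continuousAt_inverse_smul_one_add_smul {A : Type*} [NormedRing A] [CompleteSpace A]
    [NormedAlgebra ℝ A] {K : A} {a c : ℝ} (h : IsUnit (a • 1 + c • K)) :
    ContinuousAt (fun c : ℝ => Ring.inverse (a • 1 + c • K)) c := by
  obtain ⟨x, hx⟩ := h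
  have h1 := NormedRing.inverse_continuousAt x
  rw [hx] at h1
  exact ContinuousAt.comp (f := fun c : ℝ => a • 1 + c • K) h1 (by fun_prop)

/-- The Fredholm alternative: the operator is injective by positivity, hence invertible. -/
lemma isUnit_add_fracOp (hH : 1 / 2 < H) (hpos : FracPos H) {a c : ℝ} (ha : 0 < a)
    (hc : 0 ≤ c) : IsUnit (a • (1 : UnitFun →L[ℝ] UnitFun) + c • fracOp hH) := by
  rcases hc.eq_or_lt with rfl | hc
  · rw [zero_smul, add_zero]
    exact isUnit_smul_one (A := UnitFun →L[ℝ] UnitFun) ha.ne'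
  · have hμ : -(a / c) ≠ 0 := neg_ne_zero.2 (div_pos ha hc).ne'
    rcases (isCompactOperator_fracOp hH).hasEigenvalue_or_mem_resolventSet hμ with h | h
    · obtain ⟨f, hf⟩ := h.exists_hasEigenvector
      refine absurd (eq_zero_of_add_fracOp_eq_zero hH hpos ha hc.le ?_) hf.2
      have : fracOp hH f = -(a / c) • f := hf.apply_eq_smul
      rw [this, smul_smul, ← add_smul]
      have : a + c * -(a / c) = 0 := by field_simp; ring
      rw [this, zero_smul]
    · exact isUnit_smul_one_add_smul (A := UnitFun →L[ℝ] UnitFun) hc.ne' h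

/-- The solution in `C([0, 1])` of `σ² f + c K f = σ`. `Ring.inverse` is `0` where the operator is
not invertible, which does not happen for `σ > 0`, `c ≥ 0` and a positive semidefinite kernel. -/
noncomputable def unitSol (hH : 1 / 2 < H) (σ c : ℝ) : UnitFun :=
  Ring.inverse (σ ^ 2 • (1 : UnitFun →L[ℝ] UnitFun) + c • fracOp hH)
    (BoundedContinuousFunction.const unitInterval σ)

variable {σ : ℝ}

lemma unitSol_spec (hH : 1 / 2 < H) (hpos : FracPos H) (hσ : 0 < σ) {c : ℝ} (hc : 0 ≤ c) :
    σ ^ 2 • unitSol hH σ c + c • fracOp hH (unitSol hH σ c)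
      = BoundedContinuousFunction.const unitInterval σ := by
  have h := Ring.mul_inverse_cancel _ (isUnit_add_fracOp hH hpos (pow_pos hσ 2) hc)
  have h' := congrArg (fun L : UnitFun →L[ℝ] UnitFun =>
    L (BoundedContinuousFunction.const unitInterval σ)) h
  exact h'

lemma eq_unitSol (hH : 1 / 2 < H) (hpos : FracPos H) (hσ : 0 < σ) {c : ℝ} (hc : 0 ≤ c)
    {f : UnitFun}
    (hf : σ ^ 2 • f + c • fracOp hH f = BoundedContinuousFunction.const unitInterval σ) :
    f = unitSol hH σ c := by
  rw [← sub_eq_zero]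
  refine eq_zero_of_add_fracOp_eq_zero hH hpos (pow_pos hσ 2) hc ?_
  rw [map_sub, smul_sub, smul_sub, sub_add_sub_comm, hf, unitSol_spec hH hpos hσ hc, sub_self]

lemma continuousOn_unitSol (hH : 1 / 2 < H) (hpos : FracPos H) (hσ : 0 < σ) :
    ContinuousOn (unitSol hH σ) (Set.Ici 0) := by
  intro c hc
  have h := continuousAt_inverse_smul_one_add_smul (A := UnitFun →L[ℝ] UnitFun)
    (isUnit_add_fracOp hH hpos (pow_pos hσ 2) hc)
  exact (h.clm_apply continuousAt_const).continuousWithinAt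

end UnitInterval

/-! ### The kernel of the mixed process -/

section MixedKernel

variable {H σ : ℝ}

/-- The solution `g(s, t)` of the integral equation on `[0, t]`, obtained from the equation on
`[0, 1]` by scaling and extended to all `s` by constants. At `t = 0` it is the constant `1 / σ`. -/
noncomputable def mixedKer (hH : 1 / 2 < H) (σ s t : ℝ) : ℝ :=
  unitExt (unitSol hH σ (t ^ (2 * H - 1))) (s / t)

lemma continuous_unitExt_uncurry : Continuous fun p : UnitFun × ℝ => unitExt p.1 p.2 := by
  have h : Continuous fun p : UnitFun × ℝ => p.1 (Set.projIcc 0 1 zero_le_one p.2) :=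
    continuous_eval.comp (continuous_fst.prodMk
      ((continuous_projIcc (h := zero_le_one)).comp continuous_snd))
  exact h

lemma continuous_mixedKer_left (hH : 1 / 2 < H) (t : ℝ) :
    Continuous fun s => mixedKer hH σ s t :=
  (continuous_unitExt _).comp (continuous_id.div_const t)

lemma abs_mixedKer_le (hH : 1 / 2 < H) (s t : ℝ) :
    |mixedKer hH σ s t| ≤ ‖unitSol hH σ (t ^ (2 * H - 1))‖ := abs_unitExt_le _ _

lemma continuousOn_unitSol_rpow (hH : 1 / 2 < H) (hpos : FracPos H) (hσ : 0 < σ) :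
    ContinuousOn (fun t : ℝ => unitSol hH σ (t ^ (2 * H - 1))) (Set.Ici 0) :=
  (continuousOn_unitSol hH hpos hσ).comp
    (Real.continuous_rpow_const (by linarith)).continuousOn
    fun _ ht => Real.rpow_nonneg ht _

lemma exists_forall_abs_mixedKer_le (hH : 1 / 2 < H) (hpos : FracPos H) (hσ : 0 < σ) (T : ℝ) :
    ∃ M, 0 < M ∧ ∀ t ∈ Set.Icc 0 T, ∀ s, |mixedKer hH σ s t| ≤ M := by
  have hc := ((continuousOn_unitSol_rpow hH hpos hσ).mono
    (Set.Icc_subset_Ici_self : Set.Icc 0 T ⊆ _)).norm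
  obtain ⟨M, hM⟩ := (isCompact_Icc.image_of_continuousOn hc).bddAbove
  refine ⟨max M 1, by positivity, fun t ht s => ?_⟩
  exact (abs_mixedKer_le hH s t).trans ((hM ⟨t, ht, rfl⟩).trans (le_max_left _ _))

lemma integral_comp_div_eq {t : ℝ} (ht : t ≠ 0) (F : ℝ → ℝ) :
    ∫ y in (0 : ℝ)..t, F (y / t) = t * ∫ z in (0 : ℝ)..1, F z := by
  rw [intervalIntegral.integral_comp_div F ht, zero_div, div_self ht, smul_eq_mul]

/-- Scaling of the convolution: the kernel is homogeneous of degree `2H - 2`. -/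
lemma fracConv_comp_div {t : ℝ} (ht : 0 < t) (F : ℝ → ℝ) (x : ℝ) :
    fracConv H t (fun y => F (y / t)) (t * x) = t ^ (2 * H - 1) * fracConv H 1 F x := by
  unfold fracConv
  have h := integral_comp_div_eq ht.ne' fun z => F z * fracKernel H (t * (z - x))
  have h2 : ∀ y : ℝ, t * (y / t - x) = y - t * x := fun y => by field_simp
  simp only [h2] at h
  rw [h, ← intervalIntegral.integral_const_mul, ← intervalIntegral.integral_const_mul]
  refine intervalIntegral.integral_congr fun z _ => ?_
  rw [fracKernel_mul ht.le, show 2 * H - 1 = 2 * H - 2 + 1 by ring, Real.rpow_add_one ht.ne']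
  ring

lemma fracConv_congr {t : ℝ} (ht : 0 ≤ t) {F G : ℝ → ℝ} (h : ∀ y ∈ Set.Icc 0 t, F y = G y)
    (x : ℝ) : fracConv H t F x = fracConv H t G x := by
  refine intervalIntegral.integral_congr fun y hy => ?_
  rw [Set.uIcc_of_le ht] at hy
  simp only [h y hy]

lemma unitSol_zero (hH : 1 / 2 < H) (hpos : FracPos H) (hσ : 0 < σ) (x : unitInterval) :
    unitSol hH σ 0 x = 1 / σ := by
  have h := congrArg (fun f : UnitFun => f x) (unitSol_spec hH hpos hσ le_rfl)
  have h' : σ ^ 2 * unitSol hH σ 0 x = σ := by simpa using h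
  field_simp
  nlinarith

lemma mixedKer_equation (hH : 1 / 2 < H) (hpos : FracPos H) (hσ : 0 < σ) {s t : ℝ}
    (hs : s ∈ Set.Icc 0 t) :
    σ ^ 2 * mixedKer hH σ s t + fracConv H t (fun r => mixedKer hH σ r t) s = σ := by
  have ht : 0 ≤ t := hs.1.trans hs.2
  rcases ht.eq_or_lt with rfl | ht
  · have : s = 0 := le_antisymm hs.2 hs.1
    subst this
    simp only [mixedKer, fracConv, intervalIntegral.integral_same, div_zero, add_zero]
    rw [unitExt_of_mem _ ⟨le_rfl, zero_le_one⟩, Real.zero_rpow (by linarith),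
      unitSol_zero hH hpos hσ]
    field_simp
  · have hx : s / t ∈ Set.Icc (0 : ℝ) 1 := ⟨div_nonneg hs.1 ht.le, div_le_one_of_le₀ hs.2 ht.le⟩
    have h := congrArg (fun f : UnitFun => f ⟨s / t, hx⟩)
      (unitSol_spec hH hpos hσ (Real.rpow_nonneg ht.le (2 * H - 1)))
    have h' : σ ^ 2 * unitSol hH σ (t ^ (2 * H - 1)) ⟨s / t, hx⟩ + t ^ (2 * H - 1) *
      fracConv H 1 (unitExt (unitSol hH σ (t ^ (2 * H - 1)))) (s / t) = σ := by
        simpa [fracOp_apply] using h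
    rw [← fracConv_comp_div ht, ← unitExt_of_mem, mul_div_cancel₀ _ ht.ne'] at h'
    exact h'

lemma eq_mixedKer (hH : 1 / 2 < H) (hpos : FracPos H) (hσ : 0 < σ) {t : ℝ} {g : ℝ → ℝ}
    (hg : ContinuousOn g (Set.Icc 0 t))
    (heq : ∀ s ∈ Set.Icc 0 t, σ ^ 2 * g s + fracConv H t g s = σ) {s : ℝ}
    (hs : s ∈ Set.Icc 0 t) : g s = mixedKer hH σ s t := by
  have ht : 0 ≤ t := hs.1.trans hs.2
  rcases ht.eq_or_lt with rfl | ht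
  · have h1 := heq s hs
    have h2 := mixedKer_equation hH hpos hσ hs
    simp only [fracConv, intervalIntegral.integral_same, add_zero] at h1 h2
    exact mul_left_cancel₀ (pow_pos hσ 2).ne' (h1.trans h2.symm)
  · have hmem : ∀ x ∈ Set.Icc (0 : ℝ) 1, t * x ∈ Set.Icc 0 t := fun x hx =>
      ⟨mul_nonneg ht.le hx.1, mul_le_of_le_one_right ht.le hx.2⟩
    let f : UnitFun := BoundedContinuousFunction.mkOfCompact ⟨fun x : unitInterval => g (t * x),
      hg.comp_continuous (by fun_prop) fun x => hmem x x.2⟩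
    have hf : ∀ x : unitInterval, f x = g (t * x) := fun _ => rfl
    have hfe : ∀ y ∈ Set.Icc 0 t, g y = unitExt f (y / t) := by
      intro y hy
      rw [unitExt_of_mem f ⟨div_nonneg hy.1 ht.le, div_le_one_of_le₀ hy.2 ht.le⟩, hf]
      simp only
      rw [mul_div_cancel₀ _ ht.ne']
    have h := eq_unitSol hH hpos hσ (Real.rpow_nonneg ht.le (2 * H - 1)) (f := f) (by
      ext x
      have := heq (t * x) (hmem x x.2)
      rw [fracConv_congr ht.le hfe, fracConv_comp_div ht] at this
      simpa [fracOp_apply, hf] using this)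
    rw [hfe s hs, h]
    rfl

lemma continuousOn_integral_mixedKer (hH : 1 / 2 < H) (hpos : FracPos H) (hσ : 0 < σ) :
    ContinuousOn (fun t => ∫ s in (0 : ℝ)..t, mixedKer hH σ s t) (Set.Ici 0) := by
  have h1 : Continuous fun f : UnitFun => ∫ x in (0 : ℝ)..1, unitExt f x :=
    intervalIntegral.continuous_parametric_intervalIntegral_of_continuous'
      continuous_unitExt_uncurry _ _
  have h2 := continuousOn_id.mul (h1.comp_continuousOn (continuousOn_unitSol_rpow hH hpos hσ))
  refine h2.congr fun t ht => ?_
  rcases (Set.mem_Ici.1 ht).eq_or_lt with rfl | ht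
  · simp
  · exact integral_comp_div_eq ht.ne' _

lemma mixedKer_self (hH : 1 / 2 < H) (hpos : FracPos H) (hσ : 0 < σ) {t : ℝ} (ht : 0 ≤ t) :
    mixedKer hH σ t t = unitSol hH σ (t ^ (2 * H - 1)) 1 := by
  unfold mixedKer
  rcases ht.eq_or_lt with rfl | ht
  · rw [div_zero, unitExt_of_mem _ ⟨le_rfl, zero_le_one⟩, Real.zero_rpow (by linarith),
      unitSol_zero hH hpos hσ, unitSol_zero hH hpos hσ]
  · rw [div_self ht.ne', unitExt_of_mem _ ⟨zero_le_one, le_rfl⟩]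
    rfl

lemma continuousOn_mixedKer_self (hH : 1 / 2 < H) (hpos : FracPos H) (hσ : 0 < σ) :
    ContinuousOn (fun t => mixedKer hH σ t t) (Set.Ici 0) := by
  have h : ContinuousOn (fun t : ℝ => unitSol hH σ (t ^ (2 * H - 1)) 1) (Set.Ici 0) :=
    (continuous_eval_const (1 : unitInterval)).comp_continuousOn
      (continuousOn_unitSol_rpow hH hpos hσ)
  exact h.congr fun t ht => mixedKer_self hH hpos hσ ht

/-- Comparison of the equations on `[0, t]` and on `[0, t']`, tested against `g(·, t)`. -/
lemma integral_mixedKer_sub (hH : 1 / 2 < H) (hpos : FracPos H) (hσ : 0 < σ) {t t' : ℝ}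
    (ht : 0 ≤ t) (htt' : t ≤ t') :
    (∫ s in (0 : ℝ)..t', mixedKer hH σ s t') - ∫ s in (0 : ℝ)..t, mixedKer hH σ s t
      = ∫ r in t..t', mixedKer hH σ r t' *
          (1 - 1 / σ * fracConv H t (fun s => mixedKer hH σ s t) r) := by
  set p : ℝ → ℝ := fun s => mixedKer hH σ s t with hp
  set q : ℝ → ℝ := fun s => mixedKer hH σ s t' with hq
  have hpc : Continuous p := continuous_mixedKer_left hH t
  have hqc : Continuous q := continuous_mixedKer_left hH t'
  have hpb : ∀ x, |p x| ≤ _ := fun x => abs_mixedKer_le hH x t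
  have hqb : ∀ x, |q x| ≤ _ := fun x => abs_mixedKer_le hH x t'
  have hKp : Continuous (fracConv H t p) :=
    continuous_integral_mul_fracKernel hH hpc.measurable hpb ht
  have hKq : Continuous fun x => ∫ y in (0 : ℝ)..t, q y * fracKernel H (y - x) :=
    continuous_integral_mul_fracKernel hH hqc.measurable hqb ht
  have hKq' : Continuous fun x => ∫ y in t..t', q y * fracKernel H (y - x) :=
    continuous_integral_mul_fracKernel hH hqc.measurable hqb htt'
  -- both sides of `⟨q, (σ² + K) p⟩ = ⟨p, (σ² + K) q⟩` over `[0, t]`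
  have h1 : ∫ x in (0 : ℝ)..t, q x * fracConv H t p x
      = ∫ y in (0 : ℝ)..t, p y * ∫ x in (0 : ℝ)..t, q x * fracKernel H (x - y) :=
    integral_mul_integral_fracKernel_swap hH hqc.measurable hpc.measurable hqb hpb ht ht
  have h2 : ∫ x in t..t', q x * fracConv H t p x
      = ∫ y in (0 : ℝ)..t, p y * ∫ x in t..t', q x * fracKernel H (x - y) :=
    integral_mul_integral_fracKernel_swap hH hqc.measurable hpc.measurable hqb hpb htt' ht
  have h3 : σ * ∫ x in (0 : ℝ)..t, q x
      = σ ^ 2 * (∫ x in (0 : ℝ)..t, q x * p x) + ∫ x in (0 : ℝ)..t, q x * fracConv H t p x := by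
    rw [← intervalIntegral.integral_const_mul, ← intervalIntegral.integral_const_mul,
      ← intervalIntegral.integral_add (Continuous.intervalIntegrable (by fun_prop) _ _)
        (Continuous.intervalIntegrable (by fun_prop) _ _)]
    refine intervalIntegral.integral_congr fun x hx => ?_
    rw [Set.uIcc_of_le ht] at hx
    have := mixedKer_equation hH hpos hσ hx
    linear_combination -q x * this
  have h4 : σ * ∫ x in (0 : ℝ)..t, p x
      = σ ^ 2 * (∫ x in (0 : ℝ)..t, q x * p x)
        + ((∫ x in (0 : ℝ)..t, q x * fracConv H t p x) + ∫ x in t..t', q x * fracConv H t p x) := by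
    rw [h1, h2, ← intervalIntegral.integral_const_mul, ← intervalIntegral.integral_const_mul,
      ← intervalIntegral.integral_add (Continuous.intervalIntegrable (by fun_prop) _ _)
        (Continuous.intervalIntegrable (by fun_prop) _ _),
      ← intervalIntegral.integral_add (Continuous.intervalIntegrable (by fun_prop) _ _)
        (Continuous.intervalIntegrable (by fun_prop) _ _)]
    refine intervalIntegral.integral_congr fun x hx => ?_
    rw [Set.uIcc_of_le ht] at hx
    have h5 := mixedKer_equation hH hpos hσ ⟨hx.1, hx.2.trans htt'⟩
    have h6 : fracConv H t' q x = (∫ y in (0 : ℝ)..t, q y * fracKernel H (y - x))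
        + ∫ y in t..t', q y * fracKernel H (y - x) :=
      (intervalIntegral.integral_add_adjacent_intervals
        (intervalIntegrable_mul_fracKernel hH hqc.measurable hqb _ _ _)
        (intervalIntegrable_mul_fracKernel hH hqc.measurable hqb _ _ _)).symm
    rw [← hq, h6] at h5
    linear_combination -p x * h5
  have h7 : ∫ r in t..t', q r * (1 - 1 / σ * fracConv H t p r)
      = (∫ r in t..t', q r) - 1 / σ * ∫ r in t..t', q r * fracConv H t p r := by
    rw [← intervalIntegral.integral_const_mul,
      ← intervalIntegral.integral_sub (Continuous.intervalIntegrable (by fun_prop) _ _)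
        (Continuous.intervalIntegrable (by fun_prop) _ _)]
    exact intervalIntegral.integral_congr fun x _ => by ring
  rw [h7, ← intervalIntegral.integral_add_adjacent_intervals (b := t)
    (hqc.intervalIntegrable _ _) (hqc.intervalIntegrable _ _)]
  field_simp
  linear_combination h3 - h4

/-- The integrand in `integral_mixedKer_sub` tends to `g(t, t) · σ g(t, t)` as `r, t' ↓ t`, by the
equation at the endpoint `s = t`. -/
lemma hasDerivWithinAt_integral_mixedKer (hH : 1 / 2 < H) (hpos : FracPos H) (hσ : 0 < σ) {t : ℝ}
    (ht : 0 < t) :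
    HasDerivWithinAt (fun t => ∫ s in (0 : ℝ)..t, mixedKer hH σ s t)
      (σ * mixedKer hH σ t t ^ 2) (Set.Ioi t) t := by
  set h : ℝ → ℝ := fun r => 1 - 1 / σ * fracConv H t (fun s => mixedKer hH σ s t) r with hh
  have hconv : Continuous (fracConv H t (fun s => mixedKer hH σ s t)) :=
    continuous_integral_mul_fracKernel hH (continuous_mixedKer_left hH t).measurable
      (fun x => abs_mixedKer_le hH x t) ht.le
  have hhc : Continuous h := by fun_prop
  have hht : h t = σ * mixedKer hH σ t t := by
    have := mixedKer_equation hH hpos hσ (s := t) (t := t) ⟨ht.le, le_rfl⟩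
    simp only [hh]
    field_simp
    linear_combination -this
  have hjoint : ContinuousAt (fun p : ℝ × ℝ => mixedKer hH σ p.1 p.2 * h p.1) (t, t) := by
    have h1 : ContinuousAt (fun t : ℝ => unitSol hH σ (t ^ (2 * H - 1))) t :=
      (continuousOn_unitSol_rpow hH hpos hσ).continuousAt (Ici_mem_nhds ht)
    have h2 : ContinuousAt (fun p : ℝ × ℝ => unitSol hH σ (p.2 ^ (2 * H - 1))) (t, t) :=
      ContinuousAt.comp (g := fun t : ℝ => unitSol hH σ (t ^ (2 * H - 1))) h1 continuousAt_snd
    have h3 : ContinuousAt (fun p : ℝ × ℝ => p.1 / p.2) (t, t) :=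
      continuousAt_fst.div continuousAt_snd ht.ne'
    have h4 : ContinuousAt (fun p : ℝ × ℝ => mixedKer hH σ p.1 p.2) (t, t) :=
      continuous_unitExt_uncurry.continuousAt.comp (h2.prodMk h3)
    exact h4.mul (hhc.continuousAt.comp continuousAt_fst)
  rw [hasDerivWithinAt_iff_isLittleO, Asymptotics.isLittleO_iff]
  intro ε hε
  obtain ⟨δ, hδ, hball⟩ := Metric.continuousAt_iff.1 hjoint ε hε
  have hnear : ∀ᶠ t' in 𝓝[>] t, t' < t + δ :=
    mem_nhdsWithin_of_mem_nhds (gt_mem_nhds (by linarith))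
  filter_upwards [hnear, self_mem_nhdsWithin] with t' h1 h2
  have h2' : t < t' := h2
  rw [integral_mixedKer_sub hH hpos hσ ht.le h2'.le]
  have hc : (t' - t) • (σ * mixedKer hH σ t t ^ 2)
      = ∫ _ in t..t', mixedKer hH σ t t * h t := by
    rw [intervalIntegral.integral_const, hht]
    congr 1
    ring
  rw [hc, ← intervalIntegral.integral_sub]
  · refine (intervalIntegral.norm_integral_le_of_norm_le_const (C := ε) fun r hr => ?_).trans_eq ?_
    · rw [Set.uIoc_of_le h2'.le] at hr
      have := hball (x := (r, t')) (by
        rw [Prod.dist_eq, max_lt_iff, Real.dist_eq, Real.dist_eq, abs_of_pos (by linarith [hr.1]),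
          abs_of_pos (by linarith)]
        exact ⟨by linarith [hr.2], by linarith⟩)
      exact this.le
    · rfl
  · exact ((continuous_mixedKer_left hH t').mul hhc).intervalIntegrable _ _
  · exact continuous_const.intervalIntegrable _ _

/-- The variance of `∫ g(s, t) dξ_s` is absolutely continuous, with density `σ² g(t, t)²`. -/
lemma integral_mixedKer_eq (hH : 1 / 2 < H) (hpos : FracPos H) (hσ : 0 < σ) {t : ℝ} (ht : 0 ≤ t) :
    ∫ s in (0 : ℝ)..t, mixedKer hH σ s t = σ * ∫ s in (0 : ℝ)..t, mixedKer hH σ s s ^ 2 := by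
  have h := intervalIntegral.integral_eq_sub_of_hasDeriv_right_of_le ht
    ((continuousOn_integral_mixedKer hH hpos hσ).mono Set.Icc_subset_Ici_self)
    (fun x hx => hasDerivWithinAt_integral_mixedKer hH hpos hσ hx.1)
    (ContinuousOn.intervalIntegrable (by
      rw [Set.uIcc_of_le ht]
      exact (((continuousOn_mixedKer_self hH hpos hσ).mono
        Set.Icc_subset_Ici_self).pow 2).const_mul σ))
  rw [intervalIntegral.integral_same, sub_zero, intervalIntegral.integral_const_mul] at h
  exact h.symm

end MixedKernel

/-! ### Limits in mean square -/

section MeanSquare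

variable {α : Type*} [MeasurableSpace α] {μ : Measure α}

lemma inner_toLp {f g : α → ℝ} (hf : MemLp f 2 μ) (hg : MemLp g 2 μ) :
    inner ℝ (hf.toLp f) (hg.toLp g) = ∫ x, f x * g x ∂μ := by
  rw [L2.inner_def]
  refine integral_congr_ae ?_
  filter_upwards [hf.coeFn_toLp, hg.coeFn_toLp] with x h1 h2
  rw [h1, h2]
  simp [mul_comm]

lemma tendsto_eLpNorm_sub_comm {f : ℕ → α → ℝ} {g : α → ℝ} {q : ℝ≥0∞}
    (h : Tendsto (fun n => eLpNorm (fun x => g x - f n x) q μ) atTop (𝓝 0)) :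
    Tendsto (fun n => eLpNorm (f n - g) q μ) atTop (𝓝 0) := by
  refine h.congr fun n => ?_
  rw [eLpNorm_sub_comm]
  rfl

lemma tendsto_integral_mul_of_tendsto_eLpNorm {f : ℕ → α → ℝ} {g h : α → ℝ}
    (hf : ∀ n, MemLp (f n) 2 μ) (hg : MemLp g 2 μ) (hh : MemLp h 2 μ)
    (hlim : Tendsto (fun n => eLpNorm (fun x => g x - f n x) 2 μ) atTop (𝓝 0)) :
    Tendsto (fun n => ∫ x, f n x * h x ∂μ) atTop (𝓝 (∫ x, g x * h x ∂μ)) := by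
  have h1 := (Lp.tendsto_Lp_iff_tendsto_eLpNorm'' f hf g hg).2 (tendsto_eLpNorm_sub_comm hlim)
  have h2 := h1.inner (𝕜 := ℝ) (tendsto_const_nhds (x := hh.toLp h))
  simpa only [inner_toLp] using h2

lemma tendsto_integral_sq_of_tendsto_eLpNorm {f : ℕ → α → ℝ} {g : α → ℝ}
    (hf : ∀ n, MemLp (f n) 2 μ) (hg : MemLp g 2 μ)
    (hlim : Tendsto (fun n => eLpNorm (fun x => g x - f n x) 2 μ) atTop (𝓝 0)) :
    Tendsto (fun n => ∫ x, f n x * f n x ∂μ) atTop (𝓝 (∫ x, g x * g x ∂μ)) := by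
  have h1 := (Lp.tendsto_Lp_iff_tendsto_eLpNorm'' f hf g hg).2 (tendsto_eLpNorm_sub_comm hlim)
  have h2 := h1.inner (𝕜 := ℝ) h1
  simpa only [inner_toLp] using h2

lemma exists_subseq_ae_tendsto {f : ℕ → α → ℝ} {g : α → ℝ} {q : ℝ≥0∞} (hq : q ≠ 0)
    (hf : ∀ n, AEStronglyMeasurable (f n) μ) (hg : AEStronglyMeasurable g μ)
    (hlim : Tendsto (fun n => eLpNorm (fun x => g x - f n x) q μ) atTop (𝓝 0)) :
    ∃ ns : ℕ → ℕ, StrictMono ns ∧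
      ∀ᵐ x ∂μ, Tendsto (fun i => f (ns i) x) atTop (𝓝 (g x)) :=
  (tendstoInMeasure_of_tendsto_eLpNorm hq hf hg
    (tendsto_eLpNorm_sub_comm hlim)).exists_seq_tendsto_ae

/-- A mean-square limit of centered Gaussian variables is Gaussian, by convergence of the
characteristic functions along a subsequence. -/
lemma hasGaussianLaw_of_tendsto_eLpNorm [IsProbabilityMeasure μ] {f : ℕ → α → ℝ} {g : α → ℝ}
    (hf : ∀ n, HasGaussianLaw (f n) μ) (hf0 : ∀ n, ∫ x, f n x ∂μ = 0) (hg : MemLp g 2 μ)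
    (hlim : Tendsto (fun n => eLpNorm (fun x => g x - f n x) 2 μ) atTop (𝓝 0)) :
    HasGaussianLaw g μ ∧ ∫ x, g x ∂μ = 0 := by
  have hmean : ∫ x, g x ∂μ = 0 := by
    have h := tendsto_integral_mul_of_tendsto_eLpNorm (fun n => (hf n).memLp_two) hg
      (memLp_const (1 : ℝ)) hlim
    simp only [mul_one, hf0] at h
    exact (tendsto_nhds_unique h tendsto_const_nhds)
  refine ⟨?_, hmean⟩
  obtain ⟨ns, hns, hae⟩ := exists_subseq_ae_tendsto two_ne_zero
    (fun n => (hf n).memLp_two.1) hg.1 hlim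
  have hvar : ∀ {h : α → ℝ}, MemLp h 2 μ → ∫ x, h x ∂μ = 0 →
      Var[h; μ] = ∫ x, h x * h x ∂μ := fun hh h0 => by
    rw [variance_of_integral_eq_zero hh.1.aemeasurable h0]
    simp only [sq]
  have hlaw : μ.map g = gaussianReal 0 (Var[g; μ]).toNNReal := by
    have := Measure.isProbabilityMeasure_map hg.1.aemeasurable
    refine Measure.ext_of_charFun (funext fun θ => ?_)
    have hchar : ∀ {h : α → ℝ}, AEMeasurable h μ → charFun (μ.map h) θ
        = ∫ x, Complex.exp (θ * h x * Complex.I) ∂μ := fun hh => by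
      rw [charFun_apply_real, integral_map hh (by fun_prop)]
    have h1 : Tendsto (fun i => charFun (μ.map (f (ns i))) θ) atTop (𝓝 (charFun (μ.map g) θ)) := by
      simp_rw [hchar (hf _).aemeasurable, hchar hg.1.aemeasurable]
      refine tendsto_integral_of_dominated_convergence (fun _ => 1) (fun n => ?_)
        (integrable_const _) (fun n => ae_of_all _ fun x => ?_) ?_
      · have := (hf (ns n)).aemeasurable
        exact AEMeasurable.aestronglyMeasurable (by fun_prop)
      · rw [← Complex.ofReal_mul, Complex.norm_exp_ofReal_mul_I]
      · filter_upwards [hae] with x hx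
        have hc : Continuous fun y : ℝ => Complex.exp (θ * y * Complex.I) := by fun_prop
        exact (hc.tendsto _).comp hx
    have h2 : Tendsto (fun i => charFun (μ.map (f (ns i))) θ) atTop
        (𝓝 (charFun (gaussianReal 0 (Var[g; μ]).toNNReal) θ)) := by
      have h3 : ∀ n, charFun (μ.map (f n)) θ
          = Complex.exp (-((∫ x, f n x * f n x ∂μ : ℝ) : ℂ) * θ ^ 2 / 2) := fun n => by
        rw [(hf n).map_eq_gaussianReal, charFun_gaussianReal, hf0,
          hvar (hf n).memLp_two (hf0 n), Real.coe_toNNReal _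
            (integral_nonneg fun x => mul_self_nonneg _)]
        congr 1
        simp
        ring
      have h4 : charFun (gaussianReal 0 (Var[g; μ]).toNNReal) θ
          = Complex.exp (-((∫ x, g x * g x ∂μ : ℝ) : ℂ) * θ ^ 2 / 2) := by
        rw [charFun_gaussianReal, Real.coe_toNNReal _ (variance_nonneg _ _), hvar hg hmean]
        congr 1
        simp
        ring
      rw [h4]
      simp_rw [h3]
      have hc : Continuous fun v : ℝ => Complex.exp (-(v : ℂ) * θ ^ 2 / 2) := by fun_prop
      exact (hc.tendsto _).comp ((tendsto_integral_sq_of_tendsto_eLpNorm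
        (fun n => (hf n).memLp_two) hg hlim).comp hns.tendsto_atTop)
    exact tendsto_nhds_unique h1 h2
  exact ⟨by rw [hlaw]; infer_instance⟩

end MeanSquare

/-! ### The Gaussian space of a process -/

section GaussianSpace

variable {Ω : Type*} {X : ℝ≥0 → Ω → ℝ}

lemma stepIntegral_eq_sum (p : ℝ≥0 →₀ ℝ) (ω : Ω) :
    stepIntegral X p ω = ∑ s ∈ p.support, p s * X s ω := rfl

lemma stepFun_eq_sum (p : ℝ≥0 →₀ ℝ) (x : ℝ) :
    stepFun p x = ∑ s ∈ p.support, p s * (Set.Icc (0 : ℝ) s).indicator (fun _ => 1) x := rfl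

lemma stepIntegral_add (p q : ℝ≥0 →₀ ℝ) (ω : Ω) :
    stepIntegral X (p + q) ω = stepIntegral X p ω + stepIntegral X q ω :=
  Finsupp.sum_add_index' (by simp) fun _ _ _ => add_mul _ _ _

lemma stepIntegral_smul (c : ℝ) (p : ℝ≥0 →₀ ℝ) (ω : Ω) :
    stepIntegral X (c • p) ω = c * stepIntegral X p ω := by
  unfold stepIntegral
  rw [Finsupp.sum_smul_index (by simp), Finsupp.mul_sum]
  exact Finset.sum_congr rfl fun _ _ => mul_assoc _ _ _

lemma stepIntegral_single (s : ℝ≥0) (c : ℝ) (ω : Ω) :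
    stepIntegral X (Finsupp.single s c) ω = c * X s ω :=
  Finsupp.sum_single_index (by simp)

lemma stepFun_add (p q : ℝ≥0 →₀ ℝ) (x : ℝ) : stepFun (p + q) x = stepFun p x + stepFun q x :=
  Finsupp.sum_add_index' (by simp) fun _ _ _ => add_mul _ _ _

lemma stepFun_smul (c : ℝ) (p : ℝ≥0 →₀ ℝ) (x : ℝ) : stepFun (c • p) x = c * stepFun p x := by
  unfold stepFun
  rw [Finsupp.sum_smul_index (by simp), Finsupp.mul_sum]
  exact Finset.sum_congr rfl fun _ _ => mul_assoc _ _ _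

lemma stepFun_single (s : ℝ≥0) (c : ℝ) (x : ℝ) :
    stepFun (Finsupp.single s c) x = c * (Set.Icc (0 : ℝ) s).indicator (fun _ => 1) x :=
  Finsupp.sum_single_index (by simp)

variable [MeasurableSpace Ω] {P : Measure Ω}

lemma hasGaussianLaw_stepIntegral (hX : IsGaussianProcess X P) (p : ℝ≥0 →₀ ℝ) :
    HasGaussianLaw (stepIntegral X p) P :=
  (hX.smul p).hasGaussianLaw_fun_sum (I := p.support)

lemma integral_stepIntegral (hX : IsGaussianProcess X P) (h0 : ∀ t, ∫ ω, X t ω ∂P = 0)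
    (p : ℝ≥0 →₀ ℝ) : ∫ ω, stepIntegral X p ω ∂P = 0 := by
  simp only [stepIntegral_eq_sum]
  rw [integral_finsetSum _ fun s _ => (hX.hasGaussianLaw_eval s).integrable.const_mul _]
  simp [integral_const_mul, h0]

/-- `Y` is a mean-square limit of linear combinations of the values of the process `X`. -/
def InGaussianSpace (P : Measure Ω) (X : ℝ≥0 → Ω → ℝ) (Y : Ω → ℝ) : Prop :=
  MemLp Y 2 P ∧ ∃ p : ℕ → (ℝ≥0 →₀ ℝ),
    Tendsto (fun n => eLpNorm (fun ω => Y ω - stepIntegral X (p n) ω) 2 P) atTop (𝓝 0)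

lemma IsWienerIntegral.inGaussianSpace {t : ℝ≥0} {φ : ℝ → ℝ} {Y : Ω → ℝ}
    (h : IsWienerIntegral P X t φ Y) : InGaussianSpace P X Y :=
  ⟨h.1, h.2.imp fun _ hp => hp.2.2⟩

namespace InGaussianSpace

lemma eval (hX : IsGaussianProcess X P) (s : ℝ≥0) : InGaussianSpace P X (X s) := by
  refine ⟨(hX.hasGaussianLaw_eval s).memLp_two, fun _ => Finsupp.single s 1, ?_⟩
  simp [stepIntegral_single]

lemma const_mul {Y : Ω → ℝ} (h : InGaussianSpace P X Y) (c : ℝ) :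
    InGaussianSpace P X (fun ω => c * Y ω) := by
  obtain ⟨hY, p, hp⟩ := h
  refine ⟨hY.const_mul c, fun n => c • p n, ?_⟩
  have h1 : ∀ n, eLpNorm (fun ω => c * Y ω - stepIntegral X (c • p n) ω) 2 P
      = ‖c‖ₑ * eLpNorm (fun ω => Y ω - stepIntegral X (p n) ω) 2 P := fun n => by
    rw [← eLpNorm_const_smul]
    congr 1
    ext ω
    simp [stepIntegral_smul, mul_sub]
  simp_rw [h1]
  simpa using ENNReal.Tendsto.const_mul hp (Or.inr enorm_ne_top)

lemma add (hX : IsGaussianProcess X P) {Y Z : Ω → ℝ} (hY : InGaussianSpace P X Y)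
    (hZ : InGaussianSpace P X Z) :
    InGaussianSpace P X (fun ω => Y ω + Z ω) := by
  obtain ⟨hY, p, hp⟩ := hY
  obtain ⟨hZ, q, hq⟩ := hZ
  refine ⟨hY.add hZ, fun n => p n + q n, ?_⟩
  refine tendsto_of_tendsto_of_tendsto_of_le_of_le tendsto_const_nhds
    (by simpa using hp.add hq) (fun _ => zero_le) fun n => ?_
  have h1 : (fun ω => Y ω + Z ω - stepIntegral X (p n + q n) ω)
      = (fun ω => Y ω - stepIntegral X (p n) ω) + fun ω => Z ω - stepIntegral X (q n) ω := by
    ext ω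
    simp only [stepIntegral_add, Pi.add_apply]
    ring
  simp only [h1]
  exact eLpNorm_add_le (hY.1.sub (hasGaussianLaw_stepIntegral hX _).memLp_two.1)
    (hZ.1.sub (hasGaussianLaw_stepIntegral hX _).memLp_two.1) (by norm_num)

lemma sub (hX : IsGaussianProcess X P) {Y Z : Ω → ℝ} (hY : InGaussianSpace P X Y)
    (hZ : InGaussianSpace P X Z) : InGaussianSpace P X (fun ω => Y ω - Z ω) := by
  simpa [sub_eq_add_neg] using hY.add hX (hZ.const_mul (-1))

lemma sum (hX : IsGaussianProcess X P) {ι : Type*} (I : Finset ι) {Y : ι → Ω → ℝ}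
    (hY : ∀ i, InGaussianSpace P X (Y i)) (c : ι → ℝ) :
    InGaussianSpace P X (fun ω => ∑ i ∈ I, c i * Y i ω) := by
  classical
  induction I using Finset.induction_on with
  | empty =>
    refine ⟨by simp, fun _ => 0, ?_⟩
    simp [stepIntegral]
  | insert a s ha ih =>
    simp only [Finset.sum_insert ha]
    exact ((hY a).const_mul _).add hX ih

variable [IsProbabilityMeasure P]

lemma hasGaussianLaw (hX : IsGaussianProcess X P) (h0 : ∀ t, ∫ ω, X t ω ∂P = 0) {Y : Ω → ℝ}
    (hY : InGaussianSpace P X Y) : HasGaussianLaw Y P ∧ ∫ ω, Y ω ∂P = 0 := by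
  obtain ⟨hY, p, hp⟩ := hY
  exact hasGaussianLaw_of_tendsto_eLpNorm (fun n => hasGaussianLaw_stepIntegral hX (p n))
    (fun n => integral_stepIntegral hX h0 (p n)) hY hp

/-- Members of the Gaussian space of `X` are jointly Gaussian. -/
lemma isGaussianProcess (hX : IsGaussianProcess X P) (h0 : ∀ t, ∫ ω, X t ω ∂P = 0) {ι : Type*}
    {Y : ι → Ω → ℝ} (hY : ∀ i, InGaussianSpace P X (Y i)) : IsGaussianProcess Y P where
  hasGaussianLaw I := by
    have hm : AEMeasurable (fun ω => I.restrict fun i => Y i ω) P :=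
      aemeasurable_pi_lambda _ fun i => (hY i).1.1.aemeasurable
    classical
    refine ⟨isGaussian_of_map_eq_gaussianReal fun L => ?_⟩
    have h1 : L ∘ (fun ω => I.restrict fun i => Y i ω)
        = fun ω => ∑ i : I, L (fun j => if i = j then 1 else 0) * Y i ω := by
      ext ω
      rw [Function.comp_apply, ← ContinuousLinearMap.coe_coe, LinearMap.pi_apply_eq_sum_univ]
      refine Finset.sum_congr rfl fun i _ => ?_
      rw [smul_eq_mul, mul_comm]
      rfl
    rw [AEMeasurable.map_map_of_aemeasurable (by fun_prop) hm, h1]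
    exact ⟨_, _, ((sum hX Finset.univ (fun i : I => hY i) _).hasGaussianLaw
      hX h0).1.map_eq_gaussianReal⟩

end InGaussianSpace

end GaussianSpace

/-! ### The covariance form on functions -/

section MixedForm

variable {H σ : ℝ}

/-- `σ² G + ∫_0^t G(y) k(y - ·) dy`: the function whose integral over `[0, r]` is the covariance
of `ξ_r` with the integral of `G`. -/
noncomputable def mixedWeight (H σ t : ℝ) (G : ℝ → ℝ) (x : ℝ) : ℝ := σ ^ 2 * G x + fracConv H t G x

/-- The bilinear form `⟨F, (σ² + K) G⟩` over `[0, t]`, which is the covariance of the integrals of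
`F` and `G`. -/
noncomputable def mixedForm (H σ t : ℝ) (F G : ℝ → ℝ) : ℝ :=
  ∫ x in (0 : ℝ)..t, F x * mixedWeight H σ t G x

/-- Measurable and bounded functions on the line. -/
def MeasBdd (F : ℝ → ℝ) : Prop := Measurable F ∧ ∃ A, ∀ x, |F x| ≤ A

lemma measBdd_indicator (s : ℝ) :
    MeasBdd ((Set.Icc (0 : ℝ) s).indicator fun _ => (1 : ℝ)) := by
  refine ⟨measurable_const.indicator measurableSet_Icc, 1, fun x => ?_⟩
  by_cases hx : x ∈ Set.Icc (0 : ℝ) s <;> simp [hx]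

lemma measBdd_stepFun (p : ℝ≥0 →₀ ℝ) : MeasBdd (stepFun p) := by
  refine ⟨?_, ∑ s ∈ p.support, |p s|, fun x => ?_⟩
  · have : stepFun p = fun x => ∑ s ∈ p.support,
        p s * (Set.Icc (0 : ℝ) s).indicator (fun _ => 1) x := rfl
    rw [this]
    exact Finset.measurable_fun_sum _ fun s _ => (measBdd_indicator s).1.const_mul _
  · rw [stepFun_eq_sum]
    refine (Finset.abs_sum_le_sum_abs _ _).trans (Finset.sum_le_sum fun s _ => ?_)
    rw [abs_mul]
    refine mul_le_of_le_one_right (abs_nonneg _) ?_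
    by_cases hx : x ∈ Set.Icc (0 : ℝ) s <;> simp [hx]

lemma MeasBdd.memLp_two {F : ℝ → ℝ} (hF : MeasBdd F) (t : ℝ) :
    MemLp F 2 (volume.restrict (Set.Icc 0 t)) := by
  obtain ⟨hF, A, hA⟩ := hF
  exact MemLp.of_bound hF.aestronglyMeasurable A (ae_of_all _ hA)

lemma MeasBdd.intervalIntegrable_mul {F w : ℝ → ℝ} (hF : MeasBdd F) {a b : ℝ}
    (hw : IntervalIntegrable w volume a b) :
    IntervalIntegrable (fun x => F x * w x) volume a b := by
  obtain ⟨hF, A, hA⟩ := hF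
  exact ⟨hw.1.bdd_mul (c := A) hF.aestronglyMeasurable (ae_of_all _ hA),
    hw.2.bdd_mul (c := A) hF.aestronglyMeasurable (ae_of_all _ hA)⟩

lemma MeasBdd.intervalIntegrable {F : ℝ → ℝ} (hF : MeasBdd F) (a b : ℝ) :
    IntervalIntegrable F volume a b := by
  simpa using hF.intervalIntegrable_mul (w := fun _ => 1) (by simp)

lemma MeasBdd.continuous_fracConv (hH : 1 / 2 < H) {G : ℝ → ℝ} (hG : MeasBdd G) {t : ℝ}
    (ht : 0 ≤ t) : Continuous (fracConv H t G) := by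
  obtain ⟨hG, B, hB⟩ := hG
  exact continuous_integral_mul_fracKernel hH hG hB ht

lemma MeasBdd.intervalIntegrable_mixedWeight (hH : 1 / 2 < H) {G : ℝ → ℝ} (hG : MeasBdd G) {t : ℝ}
    (ht : 0 ≤ t) (a b : ℝ) : IntervalIntegrable (mixedWeight H σ t G) volume a b :=
  ((hG.intervalIntegrable a b).const_mul _).add
    ((hG.continuous_fracConv hH ht).intervalIntegrable a b)

lemma mixedForm_sub_left (hH : 1 / 2 < H) {F F' G : ℝ → ℝ} (hF : MeasBdd F) (hF' : MeasBdd F')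
    (hG : MeasBdd G) {t : ℝ} (ht : 0 ≤ t) :
    mixedForm H σ t (fun x => F x - F' x) G = mixedForm H σ t F G - mixedForm H σ t F' G := by
  unfold mixedForm
  rw [← intervalIntegral.integral_sub
    (hF.intervalIntegrable_mul (hG.intervalIntegrable_mixedWeight hH ht _ _))
    (hF'.intervalIntegrable_mul (hG.intervalIntegrable_mixedWeight hH ht _ _))]
  exact intervalIntegral.integral_congr fun y _ => sub_mul _ _ _

lemma mixedForm_comm (hH : 1 / 2 < H) {F G : ℝ → ℝ} (hF : MeasBdd F) (hG : MeasBdd G) {t : ℝ}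
    (ht : 0 ≤ t) : mixedForm H σ t F G = mixedForm H σ t G F := by
  have h : ∀ {F G : ℝ → ℝ}, MeasBdd F → MeasBdd G → mixedForm H σ t F G
      = σ ^ 2 * (∫ x in (0 : ℝ)..t, F x * G x) + ∫ x in (0 : ℝ)..t, F x * fracConv H t G x := by
    intro F G hF hG
    rw [← intervalIntegral.integral_const_mul, ← intervalIntegral.integral_add
      ((hF.intervalIntegrable_mul (hG.intervalIntegrable _ _)).const_mul _)
      (hF.intervalIntegrable_mul ((hG.continuous_fracConv hH ht).intervalIntegrable _ _))]
    refine intervalIntegral.integral_congr fun x _ => ?_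
    simp only [mixedWeight]
    ring
  obtain ⟨hFm, A, hA⟩ := id hF
  obtain ⟨hGm, B, hB⟩ := id hG
  rw [h hF hG, h hG hF]
  simp_rw [mul_comm (F _) (G _)]
  congr 1
  exact integral_mul_integral_fracKernel_swap hH hFm hGm hA hB ht ht

/-- The constant in the bound of `mixedForm` by the product of the supremum norms. -/
noncomputable def mixedBound (H σ t : ℝ) : ℝ :=
  ∫ x in (0 : ℝ)..t, (σ ^ 2 + (fracPrim H (t - x) - fracPrim H (0 - x)))

lemma abs_mixedForm_le (hH : 1 / 2 < H) {F G : ℝ → ℝ} {A B t : ℝ} (ht : 0 ≤ t) (hA0 : 0 ≤ A)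
    (hA : ∀ x ∈ Set.Ioc 0 t, |F x| ≤ A) (hB : ∀ x ∈ Set.Ioc 0 t, |G x| ≤ B) :
    |mixedForm H σ t F G| ≤ A * B * mixedBound H σ t := by
  have hc := continuous_fracPrim hH
  unfold mixedForm mixedBound
  rw [← intervalIntegral.integral_const_mul]
  refine intervalIntegral.norm_integral_le_of_norm_le (E := ℝ) ht
    (ae_of_all _ fun x hx => ?_) (Continuous.intervalIntegrable (by fun_prop) _ _)
  rw [norm_mul, mul_assoc]
  refine mul_le_mul (hA x hx) ?_ (norm_nonneg _) hA0
  refine (norm_add_le _ _).trans ?_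
  rw [mul_add]
  refine add_le_add ?_ (abs_integral_mul_fracKernel_le hH ht hB x)
  rw [norm_mul, Real.norm_of_nonneg (sq_nonneg σ), mul_comm]
  exact mul_le_mul_of_nonneg_right (hB x hx) (sq_nonneg σ)

lemma integral_indicator_mul {r t : ℝ} (hr : 0 ≤ r) (hrt : r ≤ t) (w : ℝ → ℝ) :
    ∫ x in (0 : ℝ)..t, (Set.Icc (0 : ℝ) r).indicator (fun _ => 1) x * w x
      = ∫ x in (0 : ℝ)..r, w x := by
  have h1 : ∀ x, (Set.Icc (0 : ℝ) r).indicator (fun _ => (1 : ℝ)) x * w x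
      = (Set.Icc (0 : ℝ) r).indicator w x := fun x => by
    by_cases hx : x ∈ Set.Icc (0 : ℝ) r <;> simp [hx]
  simp_rw [h1]
  rw [intervalIntegral.integral_of_le (hr.trans hrt), intervalIntegral.integral_of_le hr,
    setIntegral_indicator measurableSet_Icc]
  congr 2
  ext x
  simp only [Set.mem_inter_iff, Set.mem_Ioc, Set.mem_Icc]
  exact ⟨fun h => ⟨h.1.1, h.2.2⟩, fun h => ⟨⟨h.1, h.2.trans hrt⟩, h.1.le, h.2⟩⟩

lemma mixedForm_indicator (hH : 1 / 2 < H) {r s t : ℝ} (hr : 0 ≤ r) (hs : 0 ≤ s) (hrt : r ≤ t)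
    (hst : s ≤ t) :
    mixedForm H σ t ((Set.Icc (0 : ℝ) r).indicator fun _ => 1)
        ((Set.Icc (0 : ℝ) s).indicator fun _ => 1)
      = σ ^ 2 * min r s + (r ^ (2 * H) + s ^ (2 * H) - |r - s| ^ (2 * H)) / 2 := by
  have hI := measBdd_indicator s
  unfold mixedForm mixedWeight
  rw [integral_indicator_mul hr hrt, intervalIntegral.integral_add
    ((hI.intervalIntegrable _ _).const_mul _)
    ((hI.continuous_fracConv hH (hr.trans hrt)).intervalIntegrable _ _),
    intervalIntegral.integral_const_mul, ← integral_integral_fracKernel hH hr hs]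
  congr 2
  · rcases le_total s r with h | h
    · have := integral_indicator_mul hs h fun _ => 1
      simp only [mul_one] at this
      rw [this]
      simp [h]
    · rw [intervalIntegral.integral_congr (g := fun _ => (1 : ℝ))]
      · simp [h]
      · intro x hx
        rw [Set.uIcc_of_le hr] at hx
        have : x ∈ Set.Icc (0 : ℝ) s := ⟨hx.1, hx.2.trans h⟩
        simp [this]
  · ext x
    exact integral_indicator_mul hs hst _

lemma mixedForm_stepFun_left (hH : 1 / 2 < H) {t : ℝ≥0} (p : ℝ≥0 →₀ ℝ) {G : ℝ → ℝ}
    (hG : MeasBdd G) :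
    mixedForm H σ t (stepFun p) G = ∑ r ∈ p.support,
      p r * mixedForm H σ t ((Set.Icc (0 : ℝ) r).indicator fun _ => 1) G := by
  have h := fun r : ℝ≥0 => (measBdd_indicator r).intervalIntegrable_mul
    (hG.intervalIntegrable_mixedWeight (σ := σ) hH t.2 0 t)
  unfold mixedForm
  simp_rw [stepFun_eq_sum, Finset.sum_mul, mul_assoc]
  refine (intervalIntegral.integral_finsetSum fun r _ => (h r).const_mul (p r)).trans ?_
  simp_rw [intervalIntegral.integral_const_mul]
  rfl

end MixedForm

/-! ### Approximation by step functions -/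

section StepApprox

/-- A continuous function is uniformly close on `(0, t]` to a step function on a grid. The error is
an average of the errors on the cells, with the weights `1_{(t_j, t_{j+1}]}(x)`. -/
lemma exists_stepFun_close {φ : ℝ → ℝ} (hφ : Continuous φ) (t : ℝ≥0) {ε : ℝ} (hε : 0 < ε) :
    ∃ p : ℝ≥0 →₀ ℝ, (∀ s ∈ p.support, s ≤ t) ∧
      ∀ x ∈ Set.Ioc (0 : ℝ) t, |φ x - stepFun p x| ≤ ε := by
  classical
  have huc := (isCompact_Icc (a := (0 : ℝ)) (b := t)).uniformContinuousOn_of_continuous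
    hφ.continuousOn
  obtain ⟨δ, hδ, hδε⟩ := Metric.uniformContinuousOn_iff.1 huc ε hε
  obtain ⟨n, hn⟩ := exists_nat_gt ((t : ℝ) / δ)
  have hn0 : (0 : ℝ) < n := lt_of_le_of_lt (div_nonneg t.2 hδ.le) hn
  let τ : ℕ → ℝ≥0 := fun j => j * t / n
  have hτ : ∀ j, ((τ j : ℝ≥0) : ℝ) = j * t / n := fun j => by simp [τ]
  have hτn : ∀ j ≤ n, τ j ≤ t := fun j hj => by
    rw [← NNReal.coe_le_coe, hτ, div_le_iff₀ hn0, mul_comm]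
    exact mul_le_mul_of_nonneg_left (by exact_mod_cast hj) t.2
  have hstep : ∀ j, (τ (j + 1) : ℝ) - τ j < δ := fun j => by
    rw [hτ, hτ, ← sub_div, ← sub_mul]
    push_cast
    rw [add_sub_cancel_left, one_mul, div_lt_comm₀ hn0 hδ]
    exact hn
  have hmono : ∀ j, τ j ≤ τ (j + 1) := fun j => by
    rw [← NNReal.coe_le_coe, hτ, hτ]
    push_cast
    gcongr
    linarith
  refine ⟨∑ j ∈ Finset.range n, φ (τ (j + 1)) •
    (Finsupp.single (τ (j + 1)) 1 - Finsupp.single (τ j) 1), ?_, ?_⟩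
  · intro s hs
    obtain ⟨j, hj, hjs⟩ := Finset.mem_biUnion.1 (Finsupp.support_finsetSum hs)
    have hj' := Finset.mem_range.1 hj
    have h1 := Finsupp.support_sub (Finsupp.support_smul hjs)
    rcases Finset.mem_union.1 h1 with h | h
    · rw [Finset.mem_singleton.1 (Finsupp.support_single_subset h)]
      exact hτn _ hj'
    · rw [Finset.mem_singleton.1 (Finsupp.support_single_subset h)]
      exact hτn _ hj'.le
  · intro x hx
    let ι : ℕ → ℝ := fun j => (Set.Icc (0 : ℝ) (τ j)).indicator (fun _ => 1) x
    have hι : ∀ j, ι j = if x ≤ τ j then 1 else 0 := fun j => by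
      simp [ι, Set.indicator_apply, hx.1.le]
    have hsum : ∀ m, stepFun (∑ j ∈ Finset.range m, φ (τ (j + 1)) •
        (Finsupp.single (τ (j + 1)) (1 : ℝ) - Finsupp.single (τ j) 1)) x
        = ∑ j ∈ Finset.range m, φ (τ (j + 1)) * (ι (j + 1) - ι j) := by
      intro m
      induction m with
      | zero => simp [stepFun]
      | succ m ih =>
        rw [Finset.sum_range_succ, Finset.sum_range_succ, stepFun_add, ih, stepFun_smul,
          sub_eq_add_neg, ← Finsupp.single_neg, stepFun_add, stepFun_single, stepFun_single]
        simp only [ι]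
        ring
    have htel : ∑ j ∈ Finset.range n, (ι (j + 1) - ι j) = 1 := by
      rw [Finset.sum_range_sub, hι, hι, if_pos, if_neg]
      · simp
      · rw [hτ]
        simp [hx.1]
      · rw [hτ, mul_div_cancel_left₀ _ hn0.ne']
        exact hx.2
    rw [hsum, ← mul_one (φ x), ← htel, Finset.mul_sum, ← Finset.sum_sub_distrib]
    calc |∑ j ∈ Finset.range n, (φ x * (ι (j + 1) - ι j) - φ (τ (j + 1)) * (ι (j + 1) - ι j))|
        ≤ ∑ j ∈ Finset.range n, |φ x * (ι (j + 1) - ι j) - φ (τ (j + 1)) * (ι (j + 1) - ι j)| :=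
          Finset.abs_sum_le_sum_abs _ _
      _ ≤ ∑ j ∈ Finset.range n, ε * (ι (j + 1) - ι j) := by
          refine Finset.sum_le_sum fun j hj => ?_
          have hj' := Finset.mem_range.1 hj
          rw [← sub_mul, abs_mul]
          by_cases h1 : x ≤ τ j
          · have h2 : x ≤ τ (j + 1) := h1.trans (NNReal.coe_le_coe.2 (hmono j))
            simp [hι, h1, h2]
          by_cases h2 : x ≤ τ (j + 1)
          · have h3 := hδε x ⟨hx.1.le, hx.2⟩ (τ (j + 1))
              ⟨(τ (j + 1)).2, NNReal.coe_le_coe.2 (hτn _ hj')⟩ (by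
                rw [Real.dist_eq, abs_sub_comm, abs_of_nonneg (by linarith)]
                linarith [hstep j])
            simp only [hι, h1, h2, if_true, if_false]
            simpa [Real.dist_eq] using h3.le
          · simp [hι, h1, h2]
      _ = ε := by rw [← Finset.mul_sum, htel, mul_one]

lemma exists_stepFun_seq {φ : ℝ → ℝ} (hφ : Continuous φ) (t : ℝ≥0) :
    ∃ p : ℕ → (ℝ≥0 →₀ ℝ), (∀ n, ∀ s ∈ (p n).support, s ≤ t) ∧
      ∀ n : ℕ, ∀ x ∈ Set.Ioc (0 : ℝ) t, |φ x - stepFun (p n) x| ≤ 1 / ((n : ℝ) + 1) := by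
  choose p hp using fun n : ℕ => exists_stepFun_close hφ t (ε := 1 / ((n : ℝ) + 1)) (by positivity)
  exact ⟨p, fun n => (hp n).1, fun n => (hp n).2⟩

end StepApprox

/-! ### The isometry and the Wiener integrals -/

section Isometry

variable {Ω : Type*} [MeasurableSpace Ω] {P : Measure Ω} {X : ℝ≥0 → Ω → ℝ} {H σ : ℝ}

/-- `X` is a centered Gaussian process with the covariance of `σ W + B^H`. The degenerate case
`σ = 0` is allowed, so that the fractional Brownian motion itself is covered. -/
structure IsMixedGaussian (H σ : ℝ) (X : ℝ≥0 → Ω → ℝ) (P : Measure Ω) : Prop where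
  isGaussianProcess : IsGaussianProcess X P
  integral_eq_zero : ∀ t, ∫ ω, X t ω ∂P = 0
  integral_mul : ∀ s t : ℝ≥0, ∫ ω, X s ω * X t ω ∂P = σ ^ 2 * min (s : ℝ) t
    + ((s : ℝ) ^ (2 * H) + (t : ℝ) ^ (2 * H) - |(s : ℝ) - t| ^ (2 * H)) / 2

namespace IsMixedGaussian

lemma memLp_two (hX : IsMixedGaussian H σ X P) (t : ℝ≥0) : MemLp (X t) 2 P :=
  (hX.isGaussianProcess.hasGaussianLaw_eval t).memLp_two

lemma memLp_two_stepIntegral (hX : IsMixedGaussian H σ X P) (p : ℝ≥0 →₀ ℝ) :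
    MemLp (stepIntegral X p) 2 P :=
  (hasGaussianLaw_stepIntegral hX.isGaussianProcess p).memLp_two

lemma integral_stepIntegral_mul (hX : IsMixedGaussian H σ X P) (p : ℝ≥0 →₀ ℝ) {Y : Ω → ℝ}
    (hY : MemLp Y 2 P) :
    ∫ ω, stepIntegral X p ω * Y ω ∂P = ∑ r ∈ p.support, p r * ∫ ω, X r ω * Y ω ∂P := by
  simp_rw [stepIntegral_eq_sum, Finset.sum_mul, mul_assoc]
  refine (integral_finsetSum _ fun r _ =>
    ((hX.memLp_two r).integrable_mul hY).const_mul (p r)).trans ?_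
  exact Finset.sum_congr rfl fun r _ => integral_const_mul _ _

lemma integral_stepIntegral_mul_eval (hX : IsMixedGaussian H σ X P) (hH : 1 / 2 < H)
    {p : ℝ≥0 →₀ ℝ} {s t : ℝ≥0} (hp : ∀ r ∈ p.support, r ≤ t) (hst : s ≤ t) :
    ∫ ω, stepIntegral X p ω * X s ω ∂P
      = mixedForm H σ t (stepFun p) ((Set.Icc (0 : ℝ) s).indicator fun _ => 1) := by
  rw [hX.integral_stepIntegral_mul p (hX.memLp_two s),
    mixedForm_stepFun_left hH p (measBdd_indicator s)]
  refine Finset.sum_congr rfl fun r hr => ?_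
  rw [hX.integral_mul, mixedForm_indicator hH r.coe_nonneg s.coe_nonneg
    (NNReal.coe_le_coe.2 (hp r hr)) (NNReal.coe_le_coe.2 hst)]

lemma integral_stepIntegral_mul_stepIntegral (hX : IsMixedGaussian H σ X P) (hH : 1 / 2 < H)
    {p q : ℝ≥0 →₀ ℝ} {t : ℝ≥0} (hp : ∀ r ∈ p.support, r ≤ t) (hq : ∀ r ∈ q.support, r ≤ t) :
    ∫ ω, stepIntegral X p ω * stepIntegral X q ω ∂P
      = mixedForm H σ t (stepFun p) (stepFun q) := by
  rw [hX.integral_stepIntegral_mul p (hX.memLp_two_stepIntegral q),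
    mixedForm_stepFun_left hH p (measBdd_stepFun q)]
  refine Finset.sum_congr rfl fun r hr => ?_
  simp_rw [mul_comm (X r _)]
  rw [hX.integral_stepIntegral_mul_eval hH hq (hp r hr),
    mixedForm_comm hH (measBdd_stepFun q) (measBdd_indicator r) t.coe_nonneg]

/-- The kernel is positive semidefinite, because the variances of the linear combinations of the
values of a fractional Brownian motion are nonnegative. -/
lemma fracPos (hX : IsMixedGaussian H 0 X P) (hH : 1 / 2 < H) : FracPos H := by
  intro F hF
  obtain ⟨p, hp, hpF⟩ := exists_stepFun_seq hF 1
  obtain ⟨A, hA⟩ := isCompact_Icc.exists_bound_of_continuousOn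
    (hF.continuousOn (s := Set.Icc (0 : ℝ) 1))
  -- replace `F` by a function that is bounded on the whole line
  set G : ℝ → ℝ := Set.IccExtend zero_le_one (Set.domRestrict (Set.Icc (0 : ℝ) 1) F) with hG
  have hGF : ∀ x ∈ Set.Icc (0 : ℝ) 1, G x = F x := fun x hx => by
    rw [hG, Set.IccExtend_of_mem _ _ hx]
    rfl
  have hGb : MeasBdd G := ⟨(hF.continuousOn.domRestrict.Icc_extend').measurable, A, fun x =>
    hA _ (Set.projIcc 0 1 zero_le_one x).2⟩
  have hGA : ∀ x ∈ Set.Ioc (0 : ℝ) 1, |G x| ≤ A := fun x hx => by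
    rw [hGF x (Set.Ioc_subset_Icc_self hx)]
    exact hA x (Set.Ioc_subset_Icc_self hx)
  have hA0 : 0 ≤ A := (norm_nonneg _).trans (hA 0 ⟨le_rfl, zero_le_one⟩)
  have hgoal : ∫ x in (0 : ℝ)..1, F x * fracConv H 1 F x = mixedForm H 0 1 G G := by
    unfold mixedForm mixedWeight
    refine intervalIntegral.integral_congr fun x hx => ?_
    rw [Set.uIcc_of_le zero_le_one] at hx
    simp only [hGF x hx, fracConv_congr zero_le_one hGF x]
    ring
  rw [hgoal]
  have hclose : ∀ n : ℕ, ∀ x ∈ Set.Ioc (0 : ℝ) 1,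
      |G x - stepFun (p n) x| ≤ 1 / ((n : ℝ) + 1) := fun n x hx => by
    rw [hGF x (Set.Ioc_subset_Icc_self hx)]
    exact hpF n x (by simpa using hx)
  set C := mixedBound H 0 1
  have hpb : ∀ n, ∀ x ∈ Set.Ioc (0 : ℝ) 1, |stepFun (p n) x| ≤ A + 1 := fun n x hx => by
    have h1 := hclose n x hx
    have h2 := hGA x hx
    have h3 : 1 / ((n : ℝ) + 1) ≤ 1 := by
      rw [div_le_one (by positivity)]
      linarith [n.cast_nonneg (α := ℝ)]
    rw [abs_le] at *
    constructor <;> linarith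
  have hbound : ∀ n : ℕ, |mixedForm H 0 1 G G - mixedForm H 0 1 (stepFun (p n)) (stepFun (p n))|
      ≤ 1 / ((n : ℝ) + 1) * (A * C + (A + 1) * C) := by
    intro n
    have hs := measBdd_stepFun (p n)
    have h1 := abs_mixedForm_le (σ := 0) hH zero_le_one (by positivity) (hclose n) hGA
    have h2 := abs_mixedForm_le (σ := 0) hH zero_le_one (by positivity) (hclose n) (hpb n)
    rw [mixedForm_sub_left hH hGb hs hGb zero_le_one] at h1
    rw [mixedForm_sub_left hH hGb hs hs zero_le_one,
      mixedForm_comm hH hGb hs zero_le_one] at h2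
    have h3 := abs_add_le (mixedForm H 0 1 G G - mixedForm H 0 1 (stepFun (p n)) G)
      (mixedForm H 0 1 (stepFun (p n)) G - mixedForm H 0 1 (stepFun (p n)) (stepFun (p n)))
    rw [sub_add_sub_cancel] at h3
    refine h3.trans ((add_le_add h1 h2).trans_eq ?_)
    ring
  have hpn : ∀ n, 0 ≤ mixedForm H 0 1 (stepFun (p n)) (stepFun (p n)) := fun n => by
    have := hX.integral_stepIntegral_mul_stepIntegral hH (hp n) (hp n)
    simp only [NNReal.coe_one] at this
    rw [← this]
    exact integral_nonneg fun ω => mul_self_nonneg _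
  have hlim : Tendsto (fun n : ℕ => 1 / ((n : ℝ) + 1) * (A * C + (A + 1) * C)) atTop (𝓝 0) := by
    simpa using tendsto_one_div_add_atTop_nhds_zero_nat.mul_const (A * C + (A + 1) * C)
  refine ge_of_tendsto (a := mixedForm H 0 1 G G) (b := 0) (f := fun n : ℕ => mixedForm H 0 1 G G
    + 1 / ((n : ℝ) + 1) * (A * C + (A + 1) * C)) (x := atTop)
    (by simpa using hlim.const_add (mixedForm H 0 1 G G)) (Eventually.of_forall fun n => ?_)
  have := (abs_le.1 (hbound n)).1
  linarith [hpn n]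

/-- The Wiener integral of a continuous function exists, by completeness of `L²(P)`. -/
lemma exists_isWienerIntegral (hX : IsMixedGaussian H σ X P) (hH : 1 / 2 < H) {φ : ℝ → ℝ}
    (hφ : Continuous φ) (t : ℝ≥0) : ∃ Y, IsWienerIntegral P X t φ Y := by
  obtain ⟨p, hp, hpφ⟩ := exists_stepFun_seq hφ t
  let f : ℕ → Lp ℝ 2 P := fun n => (hX.memLp_two_stepIntegral (p n)).toLp
  set C := mixedBound H σ t
  have hdist : ∀ n m, dist (f n) (f m) ^ 2
      ≤ (1 / ((n : ℝ) + 1) + 1 / ((m : ℝ) + 1)) ^ 2 * C := by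
    intro n m
    set q := p n + (-1 : ℝ) • p m with hq
    have hqs : ∀ r ∈ q.support, r ≤ t := fun r hr => by
      classical
      rcases Finset.mem_union.1 (Finsupp.support_add hr) with h | h
      · exact hp n r h
      · exact hp m r (Finsupp.support_smul h)
    have hqi : stepIntegral X q = stepIntegral X (p n) - stepIntegral X (p m) := by
      ext ω
      rw [hq, stepIntegral_add, stepIntegral_smul, Pi.sub_apply]
      ring
    have h1 : f n - f m = (hX.memLp_two_stepIntegral q).toLp := by
      simp only [f, ← MemLp.toLp_sub, hqi]
    have h2 : ∀ x ∈ Set.Ioc (0 : ℝ) t, |stepFun q x| ≤ 1 / ((n : ℝ) + 1) + 1 / ((m : ℝ) + 1) := by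
      intro x hx
      have h3 := hpφ n x hx
      have h4 := hpφ m x hx
      rw [hq, stepFun_add, stepFun_smul]
      rw [abs_le] at *
      constructor <;> linarith
    rw [dist_eq_norm, h1, ← real_inner_self_eq_norm_sq, inner_toLp,
      hX.integral_stepIntegral_mul_stepIntegral hH hqs hqs]
    refine (le_abs_self _).trans
      ((abs_mixedForm_le hH t.coe_nonneg (by positivity) h2 h2).trans_eq ?_)
    rw [sq]
  have hCauchy : CauchySeq f := by
    rw [Metric.cauchySeq_iff']
    intro ε hε
    have hlim : Tendsto (fun n : ℕ => (1 / ((n : ℝ) + 1) + 1 / ((n : ℝ) + 1)) ^ 2 * |C|) atTop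
        (𝓝 0) := by
      have h := tendsto_one_div_add_atTop_nhds_zero_nat (𝕜 := ℝ)
      simpa using ((h.add h).pow 2).mul_const |C|
    obtain ⟨N, hN⟩ := (hlim.eventually (gt_mem_nhds (pow_pos hε 2))).exists
    refine ⟨N, fun n hn => ?_⟩
    refine lt_of_pow_lt_pow_left₀ 2 hε.le (lt_of_le_of_lt (hdist n N) (lt_of_le_of_lt ?_ hN))
    have h1 : 1 / ((n : ℝ) + 1) ≤ 1 / ((N : ℝ) + 1) := by
      have : (N : ℝ) ≤ n := by exact_mod_cast hn
      gcongr
    exact mul_le_mul (by gcongr) (le_abs_self C) (by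
      have h := (sq_nonneg (dist (f n) (f N))).trans (hdist n N)
      have h' : 0 < (1 / ((n : ℝ) + 1) + 1 / ((N : ℝ) + 1)) ^ 2 := by positivity
      exact nonneg_of_mul_nonneg_right h h') (by positivity)
  obtain ⟨Y, hY⟩ := cauchySeq_tendsto_of_complete hCauchy
  refine ⟨Y, Lp.memLp Y, p, hp, ?_, ?_⟩
  · have hb : ∀ n : ℕ, eLpNorm (fun x => φ x - stepFun (p n) x) 2
        (volume.restrict (Set.Icc (0 : ℝ) t))
        ≤ volume (Set.Icc (0 : ℝ) t) ^ (2 : ℝ≥0∞).toReal⁻¹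
          * ENNReal.ofReal (1 / ((n : ℝ) + 1)) := fun n => by
      rw [← Measure.restrict_congr_set Ioc_ae_eq_Icc, ← measure_congr Ioc_ae_eq_Icc]
      refine (eLpNorm_le_of_ae_bound (C := 1 / ((n : ℝ) + 1)) ?_).trans_eq (by simp)
      filter_upwards [ae_restrict_mem measurableSet_Ioc] with x hx using hpφ n x hx
    refine tendsto_of_tendsto_of_tendsto_of_le_of_le tendsto_const_nhds ?_ (fun _ => zero_le) hb
    have h := (ENNReal.continuous_ofReal.tendsto _).comp
      (tendsto_one_div_add_atTop_nhds_zero_nat (𝕜 := ℝ))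
    rw [ENNReal.ofReal_zero] at h
    have h' := ENNReal.Tendsto.const_mul (a := volume (Set.Icc (0 : ℝ) t) ^ (2 : ℝ≥0∞).toReal⁻¹) h
      (Or.inr (by simp))
    simpa using h'
  · rw [Lp.tendsto_Lp_iff_tendsto_eLpNorm'] at hY
    refine hY.congr fun n => ?_
    rw [eLpNorm_sub_comm]
    refine eLpNorm_congr_ae ?_
    filter_upwards [(hX.memLp_two_stepIntegral (p n)).coeFn_toLp] with ω hω
    simp [f, hω]

end IsMixedGaussian

lemma IsWienerIntegral.congr_ae {t : ℝ≥0} {φ : ℝ → ℝ} {Y Z : Ω → ℝ}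
    (h : IsWienerIntegral P X t φ Y) (hYZ : Y =ᵐ[P] Z) : IsWienerIntegral P X t φ Z := by
  obtain ⟨h1, p, h2, h3, h4⟩ := h
  refine ⟨h1.ae_eq hYZ, p, h2, h3, h4.congr fun n => eLpNorm_congr_ae ?_⟩
  filter_upwards [hYZ] with ω hω
  rw [hω]

lemma IsWienerIntegral.congr_fun {t : ℝ≥0} {φ φ' : ℝ → ℝ} {Y : Ω → ℝ}
    (h : IsWienerIntegral P X t φ Y) (hφ : ∀ s ∈ Set.Icc (0 : ℝ) t, φ s = φ' s) :
    IsWienerIntegral P X t φ' Y := by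
  obtain ⟨h1, p, h2, h3, h4⟩ := h
  refine ⟨h1, p, h2, h3.congr fun n => eLpNorm_congr_ae ?_, h4⟩
  filter_upwards [ae_restrict_mem measurableSet_Icc] with x hx
  rw [hφ x hx]

/-! ### Covariances of the Wiener integrals of the kernel -/

/-- The isometry, extended from step functions to their limits in `L²([0, t])`. -/
lemma IsWienerIntegral.integral_mul_eval [IsProbabilityMeasure P] (hX : IsMixedGaussian H σ X P)
    (hH : 1 / 2 < H) {s t : ℝ≥0} (hst : s ≤ t) {φ : ℝ → ℝ} (hφ : MeasBdd φ) {Y : Ω → ℝ}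
    (h : IsWienerIntegral P X t φ Y) :
    ∫ ω, Y ω * X s ω ∂P
      = mixedForm H σ t φ ((Set.Icc (0 : ℝ) s).indicator fun _ => 1) := by
  obtain ⟨hY, p, hp, hpφ, hpY⟩ := h
  have hI := measBdd_indicator s
  have h1 := tendsto_integral_mul_of_tendsto_eLpNorm
    (fun n => hX.memLp_two_stepIntegral (p n)) hY (hX.memLp_two s) hpY
  have hw : MemLp (mixedWeight H σ t ((Set.Icc (0 : ℝ) s).indicator fun _ => 1)) 2
      (volume.restrict (Set.Icc (0 : ℝ) t)) := by
    refine ((hI.memLp_two t).const_mul _).add ?_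
    obtain ⟨A, hA⟩ := isCompact_Icc.exists_bound_of_continuousOn
      ((hI.continuous_fracConv hH t.coe_nonneg).continuousOn (s := Set.Icc (0 : ℝ) t))
    refine MemLp.of_bound (hI.continuous_fracConv hH t.coe_nonneg).aestronglyMeasurable A ?_
    filter_upwards [ae_restrict_mem measurableSet_Icc] with x hx using hA x hx
  have h2 := tendsto_integral_mul_of_tendsto_eLpNorm
    (fun n => (measBdd_stepFun (p n)).memLp_two t) (hφ.memLp_two t) hw hpφ
  have h3 : ∀ F : ℝ → ℝ, ∫ x in Set.Icc (0 : ℝ) t, F x * mixedWeight H σ t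
      ((Set.Icc (0 : ℝ) s).indicator fun _ => 1) x
      = mixedForm H σ t F ((Set.Icc (0 : ℝ) s).indicator fun _ => 1) := fun F => by
    rw [mixedForm, intervalIntegral.integral_of_le t.coe_nonneg, integral_Icc_eq_integral_Ioc]
  simp_rw [h3] at h2
  simp_rw [fun n => hX.integral_stepIntegral_mul_eval hH (hp n) hst] at h1
  exact tendsto_nhds_unique h1 h2

section Kernel

variable [IsProbabilityMeasure P] (hX : IsMixedGaussian H σ X P) (hH : 1 / 2 < H)
  (hpos : FracPos H) (hσ : 0 < σ)

include hX hpos hσ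

/-- The kernel is chosen so that `(σ² + K_t) g(·, t)` is the constant `σ`; hence the covariance of
the integral with `X_s` is linear in `s`. -/
lemma IsWienerIntegral.integral_mul_eval_mixedKer {s t : ℝ≥0} (hst : s ≤ t) {Y : Ω → ℝ}
    (h : IsWienerIntegral P X t (fun r => mixedKer hH σ r t) Y) :
    ∫ ω, Y ω * X s ω ∂P = σ * s := by
  have hφ : MeasBdd fun r => mixedKer hH σ r t :=
    ⟨(continuous_mixedKer_left hH t).measurable, _, fun r => abs_mixedKer_le hH r t⟩
  rw [h.integral_mul_eval hX hH hst hφ, mixedForm_comm hH hφ (measBdd_indicator s) t.coe_nonneg,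
    mixedForm, integral_indicator_mul s.coe_nonneg (NNReal.coe_le_coe.2 hst),
    intervalIntegral.integral_congr (g := fun _ => σ)]
  · simp [mul_comm]
  · intro x hx
    rw [Set.uIcc_of_le s.coe_nonneg] at hx
    exact mixedKer_equation hH hpos hσ ⟨hx.1, hx.2.trans hst⟩

/-- Since `Y` has covariance `σ r` with `X_r`, it has covariance `σ ∫_0^s g(r, s) dr` with the
integral `Z` of `g(·, s)`, which does not depend on `t`. -/
lemma IsWienerIntegral.integral_mul_mixedKer {s t : ℝ≥0} (hst : s ≤ t) {Y Z : Ω → ℝ}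
    (hY : IsWienerIntegral P X t (fun r => mixedKer hH σ r t) Y)
    (hZ : IsWienerIntegral P X s (fun r => mixedKer hH σ r s) Z) :
    ∫ ω, Y ω * Z ω ∂P = σ ^ 2 * ∫ r in (0 : ℝ)..s, mixedKer hH σ r r ^ 2 := by
  have hφ : MeasBdd fun r => mixedKer hH σ r s :=
    ⟨(continuous_mixedKer_left hH s).measurable, _, fun r => abs_mixedKer_le hH r s⟩
  obtain ⟨hZ2, p, hp, hpφ, hpZ⟩ := hZ
  have h1 := tendsto_integral_mul_of_tendsto_eLpNorm
    (fun n => hX.memLp_two_stepIntegral (p n)) hZ2 hY.1 hpZ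
  have h2 := (tendsto_integral_mul_of_tendsto_eLpNorm
    (fun n => (measBdd_stepFun (p n)).memLp_two s) (hφ.memLp_two s) (memLp_const σ) hpφ)
  have h3 : ∀ n, ∫ ω, stepIntegral X (p n) ω * Y ω ∂P
      = ∫ x in Set.Icc (0 : ℝ) s, stepFun (p n) x * σ := fun n => by
    rw [hX.integral_stepIntegral_mul _ hY.1, integral_Icc_eq_integral_Ioc,
      ← intervalIntegral.integral_of_le s.coe_nonneg]
    simp_rw [stepFun_eq_sum, Finset.sum_mul, mul_assoc]
    refine Eq.symm ((intervalIntegral.integral_finsetSum fun (r : ℝ≥0) _ =>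
      ((measBdd_indicator r).intervalIntegrable_mul (w := fun _ => σ) (by simp)).const_mul
        (p n r)).trans ?_)
    refine Finset.sum_congr rfl fun r hr => ?_
    rw [intervalIntegral.integral_const_mul,
      integral_indicator_mul r.coe_nonneg (NNReal.coe_le_coe.2 (hp n r hr))]
    simp_rw [mul_comm (X r _)]
    rw [hY.integral_mul_eval_mixedKer hX hH hpos hσ ((hp n r hr).trans hst)]
    simp [mul_comm]
  simp_rw [h3] at h1
  have h4 := tendsto_nhds_unique h1 h2
  simp_rw [mul_comm (Y _)]
  rw [h4, integral_Icc_eq_integral_Ioc, ← intervalIntegral.integral_of_le s.coe_nonneg,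
    intervalIntegral.integral_mul_const, integral_mixedKer_eq hH hpos hσ s.coe_nonneg]
  ring

end Kernel

end Isometry

/-! ### Continuous modifications -/

section Chaining

/-- Dyadic chaining: if the increments at level `n` are bounded by a summable sequence `M n`, the
values at the dyadic points below `t` converge to a continuous function of `t ∈ [0, 1]`. -/
lemma exists_continuousOn_of_dyadic {x : ℕ → ℕ → ℝ} {M : ℕ → ℝ}
    (hx : ∀ n k, x (n + 1) (2 * k) = x n k)
    (hM : ∀ n, ∀ k < 2 ^ n, |x n (k + 1) - x n k| ≤ M n) (hsum : Summable M) :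
    ∃ y : ℝ → ℝ, ContinuousOn y (Set.Icc 0 1) ∧
      ∀ t ∈ Set.Icc (0 : ℝ) 1, Tendsto (fun n => x n ⌊2 ^ n * t⌋₊) atTop (𝓝 (y t)) := by
  have hM0 : ∀ n, 0 ≤ M n := fun n => (abs_nonneg _).trans (hM n 0 (by positivity))
  have hfl : ∀ n : ℕ, ∀ t ∈ Set.Icc (0 : ℝ) 1, ⌊2 ^ n * t⌋₊ ≤ 2 ^ n := fun n t ht => by
    have h : (2 : ℝ) ^ n * t ≤ ((2 ^ n : ℕ) : ℝ) := by
      push_cast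
      exact mul_le_of_le_one_right (by positivity) ht.2
    exact (Nat.floor_le_floor h).trans_eq (Nat.floor_natCast _)
  -- two indices at the same level that differ by at most one
  have hadj : ∀ n j k, j ≤ k → k ≤ j + 1 → k ≤ 2 ^ n → |x n k - x n j| ≤ M n := by
    intro n j k h1 h2 h3
    rcases h1.eq_or_lt with rfl | h
    · simpa using hM0 n
    · obtain rfl : k = j + 1 := by omega
      exact hM n j (by omega)
  have hstep : ∀ t ∈ Set.Icc (0 : ℝ) 1, ∀ n,
      dist (x n ⌊2 ^ n * t⌋₊) (x (n + 1) ⌊2 ^ (n + 1) * t⌋₊) ≤ M (n + 1) := by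
    intro t ht n
    rw [← hx, dist_comm, Real.dist_eq]
    have hnn : 0 ≤ 2 ^ n * t := mul_nonneg (by positivity) ht.1
    have h1 := Nat.floor_le hnn
    have h2 := Nat.lt_floor_add_one (2 ^ n * t)
    refine hadj _ _ _ ?_ ?_ (hfl _ t ht)
    · refine Nat.le_floor ?_
      push_cast
      rw [pow_succ]
      linarith
    · rw [← Nat.lt_add_one_iff, Nat.floor_lt (mul_nonneg (by positivity) ht.1)]
      push_cast
      rw [pow_succ]
      linarith
  have hsum1 : Summable fun n => M (n + 1) := (summable_nat_add_iff 1).2 hsum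
  have hlim : ∀ t ∈ Set.Icc (0 : ℝ) 1, ∃ l, Tendsto (fun n => x n ⌊2 ^ n * t⌋₊) atTop (𝓝 l) :=
    fun t ht => cauchySeq_tendsto_of_complete
      (cauchySeq_of_dist_le_of_summable _ (hstep t ht) hsum1)
  choose! y hy using hlim
  refine ⟨y, ?_, hy⟩
  have hR : ∀ t ∈ Set.Icc (0 : ℝ) 1, ∀ n,
      dist (x n ⌊2 ^ n * t⌋₊) (y t) ≤ ∑' m, M (n + m + 1) := fun t ht n =>
    dist_le_tsum_of_dist_le_of_tendsto _ (hstep t ht) hsum1 (hy t ht) n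
  have hR0 : Tendsto (fun n => 2 * (∑' m, M (n + m + 1)) + M n) atTop (𝓝 0) := by
    have h1 := tendsto_sum_nat_add fun n => M (n + 1)
    have h2 : Tendsto (fun n => ∑' m, M (n + m + 1)) atTop (𝓝 0) := by
      refine h1.congr fun n => tsum_congr fun m => ?_
      rw [add_comm m n]
    simpa using (h2.const_mul 2).add hsum.tendsto_atTop_zero
  refine UniformContinuousOn.continuousOn ?_
  rw [Metric.uniformContinuousOn_iff]
  intro ε hε
  obtain ⟨n, hn⟩ := (hR0.eventually (gt_mem_nhds hε)).exists
  refine ⟨1 / 2 ^ n, by positivity, ?_⟩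
  have key : ∀ s ∈ Set.Icc (0 : ℝ) 1, ∀ t ∈ Set.Icc (0 : ℝ) 1, s ≤ t → dist s t < 1 / 2 ^ n →
      dist (y s) (y t) < ε := by
    intro s hs t ht hst hd
    rw [Real.dist_eq, abs_sub_comm, abs_of_nonneg (by linarith), lt_div_iff₀ (by positivity)] at hd
    have h1 : dist (x n ⌊2 ^ n * s⌋₊) (x n ⌊2 ^ n * t⌋₊) ≤ M n := by
      rw [dist_comm, Real.dist_eq]
      refine hadj _ _ _ (Nat.floor_le_floor (by gcongr)) ?_ (hfl n t ht)
      rw [← Nat.lt_add_one_iff, Nat.floor_lt (mul_nonneg (by positivity) ht.1)]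
      have := Nat.lt_floor_add_one (2 ^ n * s)
      push_cast
      linarith
    have h2 := dist_triangle4 (y s) (x n ⌊2 ^ n * s⌋₊) (x n ⌊2 ^ n * t⌋₊) (y t)
    have h3 := hR s hs n
    rw [dist_comm] at h3
    linarith [hR t ht n]
  intro s hs t ht hd
  rcases le_total s t with h | h
  · exact key s hs t ht h hd
  · rw [dist_comm] at hd ⊢
    exact key t ht s hs h hd

variable {Ω : Type*} [MeasurableSpace Ω] {P : Measure Ω}

lemma ae_tsum_lt_top {f : ℕ → Ω → ℝ≥0∞} {c : ℕ → ℝ} (hf : ∀ n, AEMeasurable (f n) P)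
    (hc0 : ∀ n, 0 ≤ c n) (hc : Summable c) (h : ∀ n, ∫⁻ ω, f n ω ∂P ≤ ENNReal.ofReal (c n)) :
    ∀ᵐ ω ∂P, ∑' n, f n ω < ∞ := by
  refine ae_lt_top' (AEMeasurable.tsum hf) ?_
  rw [lintegral_tsum hf]
  refine ne_top_of_le_ne_top ?_ (ENNReal.tsum_le_tsum h)
  rw [← ENNReal.ofReal_tsum_of_nonneg hc0 hc]
  exact ENNReal.ofReal_ne_top

/-- **Kolmogorov's criterion** with fourth moments. -/
lemma exists_continuousOn_modification {N : ℝ≥0 → Ω → ℝ} {T : ℝ≥0} (hT : 0 < T) {C : ℝ}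
    (hC : 0 ≤ C) (hm : ∀ t ≤ T, AEMeasurable (N t) P)
    (h : ∀ s t : ℝ≥0, s ≤ t → t ≤ T → ∫⁻ ω, ENNReal.ofReal ((N t ω - N s ω) ^ 4) ∂P
      ≤ ENNReal.ofReal (C * ((t : ℝ) - s) ^ 2)) :
    ∃ Y : ℝ≥0 → Ω → ℝ, (∀ t ≤ T, N t =ᵐ[P] Y t) ∧
      ∀ᵐ ω ∂P, ContinuousOn (fun t => Y t ω) (Set.Icc 0 T) := by
  have hT' : (0 : ℝ) < T := NNReal.coe_pos.2 hT
  -- the dyadic points of `[0, T]`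
  let d : ℕ → ℕ → ℝ≥0 := fun n k => k * T / 2 ^ n
  have hd : ∀ n k, ((d n k : ℝ≥0) : ℝ) = k * T / 2 ^ n := fun n k => by simp [d]
  have hdT : ∀ n k, k ≤ 2 ^ n → d n k ≤ T := fun n k hk => by
    have hk' : (k : ℝ) ≤ 2 ^ n := by exact_mod_cast hk
    rw [← NNReal.coe_le_coe, hd, div_le_iff₀ (by positivity), mul_comm]
    gcongr
  have hdmono : ∀ n k, d n k ≤ d n (k + 1) := fun n k => by
    rw [← NNReal.coe_le_coe, hd, hd]
    push_cast
    gcongr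
    linarith
  -- the fourth powers of the increments of level `n` have expected sum at most `C T² 2⁻ⁿ`, so the
  -- factor `(3/2)ⁿ` keeps the series summable and bounds these increments by `O((2/3)^(n/4))`
  let f : ℕ → Ω → ℝ≥0∞ := fun n ω => ENNReal.ofReal ((3 / 2) ^ n) *
    ∑ k ∈ Finset.range (2 ^ n), ENNReal.ofReal ((N (d n (k + 1)) ω - N (d n k) ω) ^ 4)
  have hfk : ∀ n, ∀ k ∈ Finset.range (2 ^ n), AEMeasurable
      (fun ω => ENNReal.ofReal ((N (d n (k + 1)) ω - N (d n k) ω) ^ 4)) P := fun n k hk => by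
    have hk' := Finset.mem_range.1 hk
    exact (((hm _ (hdT n (k + 1) hk')).sub (hm _ (hdT n k hk'.le))).pow_const 4).ennreal_ofReal
  have hfm : ∀ n, AEMeasurable (f n) P := fun n =>
    (Finset.aemeasurable_fun_sum _ (hfk n)).const_mul _
  have hS : ∀ᵐ ω ∂P, ∑' n, f n ω < ∞ := by
    refine ae_tsum_lt_top (c := fun n => C * T ^ 2 * (3 / 4) ^ n) hfm (fun n => by positivity)
      ((summable_geometric_of_lt_one (by norm_num) (by norm_num)).mul_left _) fun n => ?_
    rw [lintegral_const_mul'' _ (Finset.aemeasurable_fun_sum _ (hfk n)),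
      lintegral_finsetSum' _ (hfk n)]
    have h1 : ∑ k ∈ Finset.range (2 ^ n),
        ∫⁻ ω, ENNReal.ofReal ((N (d n (k + 1)) ω - N (d n k) ω) ^ 4) ∂P
        ≤ ∑ k ∈ Finset.range (2 ^ n), ENNReal.ofReal (C * (T / 2 ^ n) ^ 2) := by
      refine Finset.sum_le_sum fun k hk => ?_
      refine (h _ _ (hdmono n k) (hdT n _ (Finset.mem_range.1 hk))).trans_eq ?_
      rw [hd, hd]
      push_cast
      ring_nf
    refine (mul_le_mul_right h1 _).trans_eq ?_
    rw [Finset.sum_const, Finset.card_range, nsmul_eq_mul, ← ENNReal.ofReal_natCast,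
      ← ENNReal.ofReal_mul (by positivity), ← ENNReal.ofReal_mul (by positivity)]
    congr 1
    push_cast
    have h2 : (3 / 4 : ℝ) ^ n = (3 / 2) ^ n * 2 ^ n * (1 / 2 ^ n) ^ 2 := by
      rw [show (3 / 4 : ℝ) = 3 / 2 * 2 * (1 / 2) ^ 2 by norm_num, mul_pow, mul_pow, ← pow_mul,
        mul_comm 2 n, pow_mul, one_div_pow]
    rw [h2]
    ring
  have hpath : ∀ᵐ ω ∂P, ∃ y : ℝ → ℝ, ContinuousOn y (Set.Icc 0 1) ∧
      ∀ t ∈ Set.Icc (0 : ℝ) 1, Tendsto (fun n => N (d n ⌊2 ^ n * t⌋₊) ω) atTop (𝓝 (y t)) := by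
    filter_upwards [hS] with ω hω
    set S := (∑' n, f n ω).toReal
    have hbound : ∀ n, ∀ k < 2 ^ n, (3 / 2) ^ n * (N (d n (k + 1)) ω - N (d n k) ω) ^ 4 ≤ S := by
      intro n k hk
      have h1 : ENNReal.ofReal ((3 / 2) ^ n * (N (d n (k + 1)) ω - N (d n k) ω) ^ 4)
          ≤ ∑' n, f n ω := by
        rw [ENNReal.ofReal_mul (by positivity)]
        refine le_trans ?_ (ENNReal.le_tsum n)
        exact mul_le_mul_right (Finset.single_le_sum
          (f := fun k => ENNReal.ofReal ((N (d n (k + 1)) ω - N (d n k) ω) ^ 4))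
          (fun _ _ => zero_le) (Finset.mem_range.2 hk)) _
      exact (ENNReal.ofReal_le_iff_le_toReal hω.ne).1 h1
    have hS0 : 0 ≤ S := ENNReal.toReal_nonneg
    have hroot : ∀ a : ℝ, 0 ≤ a → (a ^ (1 / 4 : ℝ)) ^ 4 = a := fun a ha => by
      rw [← Real.rpow_natCast, ← Real.rpow_mul ha]
      norm_num
    refine exists_continuousOn_of_dyadic (x := fun n k => N (d n k) ω)
      (M := fun n => S ^ (1 / 4 : ℝ) * ((2 / 3 : ℝ) ^ (1 / 4 : ℝ)) ^ n) ?_ ?_ ?_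
    · intro n k
      have : d (n + 1) (2 * k) = d n k := by
        ext
        rw [hd, hd, pow_succ]
        push_cast
        field_simp
      simp only [this]
    · intro n k hk
      rw [← pow_le_pow_iff_left₀ (abs_nonneg _) (by positivity) (n := 4) (by norm_num), mul_pow,
        hroot _ hS0, ← pow_mul, mul_comm n 4, pow_mul, hroot _ (by norm_num),
        (show Even 4 by decide).pow_abs]
      have h1 := hbound n k hk
      have h2 : (2 / 3 : ℝ) ^ n * (3 / 2) ^ n = 1 := by
        rw [← mul_pow]
        norm_num
      calc (N (d n (k + 1)) ω - N (d n k) ω) ^ 4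
          = (2 / 3 : ℝ) ^ n * ((3 / 2) ^ n * (N (d n (k + 1)) ω - N (d n k) ω) ^ 4) := by
            rw [← mul_assoc, h2, one_mul]
        _ ≤ (2 / 3 : ℝ) ^ n * S := by gcongr
        _ = S * (2 / 3 : ℝ) ^ n := mul_comm _ _
    · exact (summable_geometric_of_lt_one (by positivity)
        (Real.rpow_lt_one (by norm_num) (by norm_num) (by norm_num))).mul_left _
  refine ⟨fun t ω => limUnder atTop fun n => N (d n ⌊2 ^ n * ((t : ℝ) / T)⌋₊) ω, ?_, ?_⟩
  · intro t ht
    have htT : (t : ℝ) / T ∈ Set.Icc (0 : ℝ) 1 :=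
      ⟨by positivity, div_le_one_of_le₀ (NNReal.coe_le_coe.2 ht) hT'.le⟩
    set δ : ℕ → ℝ≥0 := fun n => d n ⌊2 ^ n * ((t : ℝ) / T)⌋₊ with hδ
    have hδt : ∀ n, δ n ≤ t := fun n => by
      have h1 := (Nat.floor_le (a := 2 ^ n * ((t : ℝ) / T)) (by positivity)).trans_eq
        (mul_div_assoc' _ _ _)
      rw [← NNReal.coe_le_coe, hδ, hd, div_le_iff₀ (by positivity)]
      rw [le_div_iff₀ hT'] at h1
      linarith
    have hδt' : ∀ n, (t : ℝ) - δ n ≤ T * (1 / 2 ^ n) := fun n => by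
      have h1 := (mul_div_assoc' _ _ _).symm.trans_lt
        (Nat.lt_floor_add_one (2 ^ n * ((t : ℝ) / T)))
      rw [hδ, hd, mul_one_div, sub_le_iff_le_add, ← add_div, le_div_iff₀ (by positivity)]
      rw [div_lt_iff₀ hT'] at h1
      linarith
    have hconv : ∀ᵐ ω ∂P, ∑' n, ENNReal.ofReal ((N t ω - N (δ n) ω) ^ 4) < ∞ := by
      refine ae_tsum_lt_top (c := fun n => C * T ^ 2 * (1 / 4) ^ n)
        (fun n => (((hm t ht).sub (hm _ ((hδt n).trans ht))).pow_const 4).ennreal_ofReal)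
        (fun n => by positivity)
        ((summable_geometric_of_lt_one (by norm_num) (by norm_num)).mul_left _) fun n => ?_
      refine (h _ _ (hδt n) ht).trans (ENNReal.ofReal_le_ofReal ?_)
      have h2 : (1 / 4 : ℝ) ^ n = (1 / 2 ^ n) ^ 2 := by
        rw [← one_div_pow, ← pow_mul, mul_comm n 2, pow_mul]
        norm_num
      rw [h2, mul_assoc, ← mul_pow]
      have h3 : (0 : ℝ) ≤ t - δ n := sub_nonneg.2 (NNReal.coe_le_coe.2 (hδt n))
      gcongr
      exact hδt' n
    filter_upwards [hpath, hconv] with ω ⟨y, _, hy⟩ hω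
    have h1 := ENNReal.tendsto_atTop_zero_of_tsum_ne_top hω.ne
    have h2 : Tendsto (fun n => (N t ω - N (δ n) ω) ^ 4) atTop (𝓝 0) := by
      have h3 := (ENNReal.tendsto_toReal ENNReal.zero_ne_top).comp h1
      refine h3.congr fun n => ?_
      rw [Function.comp_apply, ENNReal.toReal_ofReal (by positivity)]
    have h4 := (((hy _ htT).const_sub (N t ω)).pow 4)
    have h5 := tendsto_nhds_unique h4 h2
    rw [(hy _ htT).limUnder_eq]
    exact sub_eq_zero.1 (pow_eq_zero_iff (by norm_num) |>.1 h5)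
  · filter_upwards [hpath] with ω ⟨y, hyc, hy⟩
    have hmem : ∀ t ∈ Set.Icc (0 : ℝ≥0) T, (t : ℝ) / T ∈ Set.Icc (0 : ℝ) 1 := fun t ht =>
      ⟨by positivity, div_le_one_of_le₀ (NNReal.coe_le_coe.2 ht.2) hT'.le⟩
    refine (hyc.comp (Continuous.continuousOn (by fun_prop)) hmem).congr fun t ht => ?_
    exact (hy _ (hmem t ht)).limUnder_eq

lemma lintegral_pow_four_gaussianReal (v : ℝ≥0) :
    ∫⁻ x, ENNReal.ofReal (x ^ 4) ∂(gaussianReal 0 v)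
      = ENNReal.ofReal ((v : ℝ) ^ 2 * ∫ x, x ^ 4 ∂(gaussianReal 0 1)) := by
  have hsc : (gaussianReal 0 1).map (fun x => √(v : ℝ) * x) = gaussianReal 0 v := by
    rw [gaussianReal_map_const_mul]
    congr 1
    · simp
    · ext
      simp
  have hint : Integrable (fun x : ℝ => x ^ 4) (gaussianReal 0 1) := by
    have h := (memLp_id_gaussianReal (μ := 0) (v := 1) 4).integrable_norm_pow (by norm_num)
    refine h.congr (ae_of_all _ fun x => ?_)
    simp [(show Even 4 by decide).pow_abs]
  have hsq : √(v : ℝ) ^ 4 = (v : ℝ) ^ 2 := by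
    rw [show 4 = 2 * 2 by norm_num, pow_mul, Real.sq_sqrt v.coe_nonneg]
  rw [← hsc, lintegral_map (by fun_prop) (by fun_prop)]
  simp_rw [mul_pow, hsq]
  rw [← ofReal_integral_eq_lintegral_ofReal (hint.const_mul _)
    (ae_of_all _ fun x => by positivity), integral_const_mul]

end Chaining

/-! ### The mixed process -/

section Mixed

variable {Ω : Type*} [MeasurableSpace Ω] {P : Measure Ω} {W B : ℝ≥0 → Ω → ℝ} {H σ : ℝ}

lemma integral_mul_eq_covariance [IsProbabilityMeasure P] {X Y : Ω → ℝ} (hX : MemLp X 2 P)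
    (hY : MemLp Y 2 P) (h0 : ∫ ω, X ω ∂P = 0) : ∫ ω, X ω * Y ω ∂P = cov[X, Y; P] := by
  rw [covariance_eq_sub hX hY, h0, zero_mul, sub_zero]
  rfl

lemma IsFractionalBrownian.isMixedGaussian [IsProbabilityMeasure P]
    (hB : IsFractionalBrownian H B P) : IsMixedGaussian H 0 B P where
  isGaussianProcess := hB.isGaussianProcess
  integral_eq_zero := hB.integral_eq_zero
  integral_mul s t := by
    rw [integral_mul_eq_covariance (hB.isGaussianProcess.hasGaussianLaw_eval s).memLp_two
      (hB.isGaussianProcess.hasGaussianLaw_eval t).memLp_two (hB.integral_eq_zero s),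
      hB.covariance_eq, abs_sub_comm]
    ring

lemma isGaussianProcess_mixedProcess (hW : IsGaussianProcess W P) (hB : IsGaussianProcess B P)
    (hWB : IndepFun (fun ω t => W t ω) (fun ω t => B t ω) P) :
    IsGaussianProcess (mixedProcess σ W B) P where
  hasGaussianLaw I := by
    have hm : Measurable fun x : ℝ≥0 → ℝ => I.restrict x :=
      measurable_pi_lambda _ fun i => measurable_pi_apply _
    have h := (hWB.comp hm hm).hasGaussianLaw (hW.hasGaussianLaw I) (hB.hasGaussianLaw I)
    exact h.map (σ • ContinuousLinearMap.fst ℝ (I → ℝ) (I → ℝ)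
      + ContinuousLinearMap.snd ℝ (I → ℝ) (I → ℝ))

lemma isMixedGaussian_mixedProcess [IsProbabilityMeasure P] (hW : IsBrownianReal W P)
    (hB : IsFractionalBrownian H B P)
    (hWB : IndepFun (fun ω t => W t ω) (fun ω t => B t ω) P) :
    IsMixedGaussian H σ (mixedProcess σ W B) P := by
  have hWG := hW.toIsPreBrownianReal.isGaussianProcess
  have hW2 : ∀ t, MemLp (W t) 2 P := fun t => (hWG.hasGaussianLaw_eval t).memLp_two
  have hB2 := hB.isMixedGaussian.memLp_two
  have hW0 : ∀ t, ∫ ω, W t ω ∂P = 0 := hW.toIsPreBrownianReal.integral_eval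
  refine ⟨isGaussianProcess_mixedProcess hWG hB.isGaussianProcess hWB, fun t => ?_,
    fun s t => ?_⟩
  · refine (integral_add (((hW2 t).integrable one_le_two).const_mul σ)
      ((hB2 t).integrable one_le_two)).trans ?_
    rw [integral_const_mul, hW0, hB.integral_eq_zero, mul_zero, add_zero]
  · have hcross : ∀ s t, ∫ ω, W s ω * B t ω ∂P = 0 := fun s t => by
      have h : IndepFun (W s) (B t) P :=
        hWB.comp (measurable_pi_apply s) (measurable_pi_apply t)
      rw [integral_mul_eq_covariance (hW2 s) (hB2 t) (hW0 s),
        h.covariance_eq_zero (hW2 s) (hB2 t)]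
    have hWW : ∫ ω, W s ω * W t ω ∂P = min (s : ℝ) t := by
      rw [integral_mul_eq_covariance (hW2 s) (hW2 t) (hW0 s),
        hW.toIsPreBrownianReal.covariance_eval, NNReal.coe_min]
    have hexp : ∀ ω, mixedProcess σ W B s ω * mixedProcess σ W B t ω
        = (σ ^ 2 * (W s ω * W t ω) + σ * (W s ω * B t ω))
          + (σ * (W t ω * B s ω) + B s ω * B t ω) := fun ω => by
      unfold mixedProcess
      ring
    have i1 := ((hW2 s).integrable_mul (hW2 t)).const_mul (σ ^ 2)
    have i2 := ((hW2 s).integrable_mul (hB2 t)).const_mul σ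
    have i3 := ((hW2 t).integrable_mul (hB2 s)).const_mul σ
    have i4 := (hB2 s).integrable_mul (hB2 t)
    simp_rw [hexp]
    refine (integral_add (i1.add i2) (i3.add i4)).trans ?_
    refine (congrArg₂ (· + ·) (integral_add i1 i2) (integral_add i3 i4)).trans ?_
    simp only [Pi.mul_apply, integral_const_mul]
    rw [hcross s t, hcross t s, hWW, hB.isMixedGaussian.integral_mul]
    ring

end Mixed

/-! ### The continuous version of the integral process -/

section ContinuousVersion

variable {Ω : Type*} [MeasurableSpace Ω] {P : Measure Ω} [IsProbabilityMeasure P]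
  {X : ℝ≥0 → Ω → ℝ} {H σ : ℝ}

lemma InGaussianSpace.lintegral_pow_four (hX : IsMixedGaussian H σ X P) {Y : Ω → ℝ}
    (hY : InGaussianSpace P X Y) : ∫⁻ ω, ENNReal.ofReal (Y ω ^ 4) ∂P
      = ENNReal.ofReal ((∫ ω, Y ω * Y ω ∂P) ^ 2 * ∫ x, x ^ 4 ∂(gaussianReal 0 1)) := by
  obtain ⟨hG, h0⟩ := hY.hasGaussianLaw hX.isGaussianProcess hX.integral_eq_zero
  have h := lintegral_pow_four_gaussianReal Var[Y; P].toNNReal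
  have h1 : P.map Y = gaussianReal 0 Var[Y; P].toNNReal := by
    rw [hG.map_eq_gaussianReal, h0]
  rw [← h1, lintegral_map' (by fun_prop) hY.1.1.aemeasurable,
    Real.coe_toNNReal _ (variance_nonneg _ _)] at h
  rw [h, ← covariance_self hY.1.1.aemeasurable, integral_mul_eq_covariance hY.1 hY.1 h0]

lemma intervalIntegrable_mixedKer_self (hH : 1 / 2 < H) (hpos : FracPos H) (hσ : 0 < σ)
    {s t : ℝ} (hs : 0 ≤ s) (ht : 0 ≤ t) :
    IntervalIntegrable (fun r => mixedKer hH σ r r ^ 2) volume s t := by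
  refine ContinuousOn.intervalIntegrable fun x hx => ?_
  have h : (0 : ℝ) ≤ x := (le_min hs ht).trans hx.1
  exact (((continuousOn_mixedKer_self hH hpos hσ).pow 2) x h).mono fun y hy =>
    (le_min hs ht).trans hy.1

lemma integral_mixedKer_self_sub_le (hH : 1 / 2 < H) (hpos : FracPos H) (hσ : 0 < σ) {T M : ℝ}
    (hM : ∀ t ∈ Set.Icc 0 T, ∀ s, |mixedKer hH σ s t| ≤ M) {s t : ℝ} (hs : 0 ≤ s) (hst : s ≤ t)
    (ht : t ≤ T) :
    (∫ r in (0 : ℝ)..t, mixedKer hH σ r r ^ 2) - ∫ r in (0 : ℝ)..s, mixedKer hH σ r r ^ 2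
      ≤ M ^ 2 * (t - s) := by
  rw [intervalIntegral.integral_interval_sub_left
    (intervalIntegrable_mixedKer_self hH hpos hσ le_rfl (hs.trans hst))
    (intervalIntegrable_mixedKer_self hH hpos hσ le_rfl hs)]
  refine (intervalIntegral.integral_mono_on hst
    (intervalIntegrable_mixedKer_self hH hpos hσ hs (hs.trans hst)) intervalIntegrable_const
    (g := fun _ => M ^ 2) fun r hr => ?_).trans_eq (by simp [mul_comm])
  exact sq_le_sq' (abs_le.1 (hM r ⟨hs.trans hr.1, hr.2.trans ht⟩ r)).1
    (abs_le.1 (hM r ⟨hs.trans hr.1, hr.2.trans ht⟩ r)).2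

/-- The increments of the integral process have the variance of the increments of the time-changed
Brownian motion `σ W` at the clock `∫_0^t g(s, s)² ds`. -/
lemma integral_sq_sub_mixedKer (hX : IsMixedGaussian H σ X P) (hH : 1 / 2 < H) (hpos : FracPos H)
    (hσ : 0 < σ) {s t : ℝ≥0} (hst : s ≤ t) {Y Z : Ω → ℝ}
    (hY : IsWienerIntegral P X t (fun r => mixedKer hH σ r t) Y)
    (hZ : IsWienerIntegral P X s (fun r => mixedKer hH σ r s) Z) :
    ∫ ω, (Y ω - Z ω) * (Y ω - Z ω) ∂P = σ ^ 2 * ((∫ r in (0 : ℝ)..t, mixedKer hH σ r r ^ 2)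
      - ∫ r in (0 : ℝ)..s, mixedKer hH σ r r ^ 2) := by
  have hexp : ∀ ω, (Y ω - Z ω) * (Y ω - Z ω) = Y ω * Y ω - 2 * (Y ω * Z ω) + Z ω * Z ω :=
    fun ω => by ring
  have i1 := hY.1.integrable_mul hY.1
  have i2 := (hY.1.integrable_mul hZ.1).const_mul 2
  have i3 := hZ.1.integrable_mul hZ.1
  simp_rw [hexp]
  refine (integral_add (i1.sub i2) i3).trans ?_
  refine (congrArg (· + _) (integral_sub i1 i2)).trans ?_
  simp only [Pi.mul_apply, integral_const_mul]
  rw [hY.integral_mul_mixedKer hX hH hpos hσ le_rfl hY,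
    hY.integral_mul_mixedKer hX hH hpos hσ hst hZ,
    hZ.integral_mul_mixedKer hX hH hpos hσ le_rfl hZ]
  ring

lemma exists_isContinuousIntegralProcess (hX : IsMixedGaussian H σ X P) (hH : 1 / 2 < H)
    (hpos : FracPos H) (hσ : 0 < σ) {T : ℝ≥0} (hT : 0 < T) :
    ∃ N, IsContinuousIntegralProcess P X T (mixedKer hH σ) N := by
  have hex : ∀ t : ℝ≥0, ∃ Y, IsWienerIntegral P X t (fun r => mixedKer hH σ r t) Y := fun t =>
    hX.exists_isWienerIntegral hH (continuous_mixedKer_left hH t) t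
  choose N hN using hex
  obtain ⟨M, -, hM⟩ := exists_forall_abs_mixedKer_le hH hpos hσ (T : ℝ)
  set m := ∫ x, x ^ 4 ∂(gaussianReal 0 1) with hm
  have hm0 : 0 ≤ m := integral_nonneg fun x => by positivity
  obtain ⟨Y, hY, hc⟩ := exists_continuousOn_modification (P := P) (N := N) hT
    (C := (σ ^ 2 * M ^ 2) ^ 2 * m) (by positivity) (fun t _ => (hN t).1.1.aemeasurable)
    fun s t hst htT => by
      rw [((hN t).inGaussianSpace.sub hX.isGaussianProcess
        (hN s).inGaussianSpace).lintegral_pow_four hX,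
        integral_sq_sub_mixedKer hX hH hpos hσ hst (hN t) (hN s)]
      refine ENNReal.ofReal_le_ofReal ?_
      have h1 := integral_mixedKer_self_sub_le hH hpos hσ hM s.coe_nonneg
        (NNReal.coe_le_coe.2 hst) (NNReal.coe_le_coe.2 htT)
      have h0 : 0 ≤ (∫ r in (0 : ℝ)..t, mixedKer hH σ r r ^ 2)
          - ∫ r in (0 : ℝ)..s, mixedKer hH σ r r ^ 2 := by
        rw [intervalIntegral.integral_interval_sub_left
          (intervalIntegrable_mixedKer_self hH hpos hσ le_rfl t.coe_nonneg)
          (intervalIntegrable_mixedKer_self hH hpos hσ le_rfl s.coe_nonneg)]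
        exact intervalIntegral.integral_nonneg (NNReal.coe_le_coe.2 hst) fun _ _ => sq_nonneg _
      calc _ ≤ (σ ^ 2 * (M ^ 2 * ((t : ℝ) - s))) ^ 2 * m := by gcongr
        _ = _ := by ring
  exact ⟨Y, fun t ht => (hN t).congr_ae (hY t ht), hc⟩

end ContinuousVersion

/-! ### The Cameron–Martin shift -/

/-- The exponential density shifts a centered Gaussian law on the line. -/
lemma lintegral_exp_mul_gaussianReal {v : ℝ≥0} (hv : v ≠ 0) (β : ℝ) {f : ℝ → ℝ≥0∞}
    (hf : Measurable f) :
    ∫⁻ x, ENNReal.ofReal (Real.exp (β * x - β ^ 2 * v / 2)) * f x ∂(gaussianReal 0 v)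
      = ∫⁻ x, f (x + β * v) ∂(gaussianReal 0 v) := by
  have hv' : (v : ℝ) ≠ 0 := NNReal.coe_ne_zero.2 hv
  have h1 : ∫⁻ x, f (x + β * v) ∂(gaussianReal 0 v) = ∫⁻ x, f x ∂(gaussianReal (β * v) v) := by
    have h := gaussianReal_map_add_const (μ := 0) (v := v) (β * v)
    rw [zero_add] at h
    rw [← h, lintegral_map hf (by fun_prop)]
  have hm : Measurable fun x : ℝ => ENNReal.ofReal (Real.exp (β * x - β ^ 2 * v / 2)) := by
    fun_prop
  rw [h1, gaussianReal_of_var_ne_zero _ hv, gaussianReal_of_var_ne_zero _ hv,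
    lintegral_withDensity_eq_lintegral_mul _ (measurable_gaussianPDF _ _)
      (f := _) (g := fun x => ENNReal.ofReal (Real.exp (β * x - β ^ 2 * v / 2)) * f x) (hm.mul hf),
    lintegral_withDensity_eq_lintegral_mul _ (measurable_gaussianPDF _ _) hf]
  refine lintegral_congr fun x => ?_
  simp only [Pi.mul_apply]
  rw [← mul_assoc]
  congr 1
  rw [gaussianPDF, gaussianPDF, ← ENNReal.ofReal_mul (gaussianPDFReal_nonneg _ _ _)]
  congr 1
  rw [gaussianPDFReal, gaussianPDFReal, mul_assoc, ← Real.exp_add]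
  congr 2
  field_simp
  ring

section CameronMartin

variable {Ω : Type*} [MeasurableSpace Ω] {P : Measure Ω} [IsProbabilityMeasure P]
  {X : ℝ≥0 → Ω → ℝ}

/-- **Cameron–Martin formula.** With the density `exp (β N - β² E[N²] / 2)`, where `N` belongs to
the Gaussian space of `X`, the process `X` is translated by `β E[N X]`. -/
lemma InGaussianSpace.lintegral_exp_mul (hX : IsGaussianProcess X P)
    (h0 : ∀ t, ∫ ω, X t ω ∂P = 0) {N : Ω → ℝ} (hN : InGaussianSpace P X N) {ι : Type*}
    [Countable ι] (t : ι → ℝ≥0) (β : ℝ) {h : (ι → ℝ) → ℝ≥0∞} (hh : Measurable h) :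
    ∫⁻ ω, ENNReal.ofReal (Real.exp (β * N ω - β ^ 2 * (∫ ω, N ω * N ω ∂P) / 2))
        * h (fun i => X (t i) ω) ∂P
      = ∫⁻ ω, h (fun i => X (t i) ω + β * ∫ ω, N ω * X (t i) ω ∂P) ∂P := by
  obtain ⟨hNG, hN0⟩ := hN.hasGaussianLaw hX h0
  have hX2 : ∀ s, MemLp (X s) 2 P := fun s => (hX.hasGaussianLaw_eval s).memLp_two
  set v : ℝ := ∫ ω, N ω * N ω ∂P with hv
  have hv0 : 0 ≤ v := integral_nonneg fun ω => mul_self_nonneg _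
  rcases hv0.eq_or_lt with hv1 | hv1
  · -- a degenerate `N` vanishes
    have hN1 : N =ᵐ[P] 0 := by
      have h1 := (integral_eq_zero_iff_of_nonneg (fun ω => mul_self_nonneg (N ω))
        (hN.1.integrable_mul hN.1)).1 hv1.symm
      filter_upwards [h1] with ω hω using mul_self_eq_zero.1 hω
    have hc : ∀ s, ∫ ω, N ω * X s ω ∂P = 0 := fun s => by
      rw [integral_congr_ae (g := fun _ => 0), integral_zero]
      filter_upwards [hN1] with ω hω
      rw [hω, Pi.zero_apply, zero_mul]
    refine lintegral_congr_ae ?_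
    filter_upwards [hN1] with ω hω
    simp [hω, hc, ← hv1]
  -- decompose `X` into its projection on `N` and a part independent of `N`
  let k : ι → ℝ := fun i => (∫ ω, N ω * X (t i) ω ∂P) / v
  let R : ι → Ω → ℝ := fun i ω => X (t i) ω - k i * N ω
  have hR : ∀ i, InGaussianSpace P X (R i) := fun i =>
    (InGaussianSpace.eval hX (t i)).sub hX (hN.const_mul (k i))
  have hRm : ∀ i, AEMeasurable (R i) P := fun i => (hR i).1.1.aemeasurable
  have hNm : AEMeasurable N P := hN.1.1.aemeasurable
  have hind : IndepFun (fun ω (_ : Unit) => N ω) (fun ω i => R i ω) P := by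
    refine IsGaussianProcess.indepFun_of_covariance_eq_zero (X := fun _ : Unit => N)
      (InGaussianSpace.isGaussianProcess hX h0 ?_) (fun _ => hNm) hRm fun _ i => ?_
    · rintro (_ | i)
      exacts [hN, hR i]
    · rw [← integral_mul_eq_covariance hN.1 (hR i).1 hN0]
      have hexp : ∀ ω, N ω * R i ω = N ω * X (t i) ω - k i * (N ω * N ω) := fun ω => by
        simp only [R]
        ring
      simp_rw [hexp]
      refine (integral_sub (hN.1.integrable_mul (hX2 _))
        ((hN.1.integrable_mul hN.1).const_mul _)).trans ?_
      rw [integral_const_mul]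
      change ∫ ω, N ω * X (t i) ω ∂P - k i * v = 0
      simp only [k]
      field_simp
      simp
  have hRm' : AEMeasurable (fun ω i => R i ω) P := aemeasurable_pi_lambda _ hRm
  have hprod := (hind.comp (φ := fun x : Unit → ℝ => x ()) (ψ := id) (measurable_pi_apply _)
    measurable_id).map_prod_eq_prod_map_map hNm hRm'
  have hlaw : P.map N = gaussianReal 0 ⟨v, hv0⟩ := by
    rw [hNG.map_eq_gaussianReal, hN0, ← covariance_self hNm,
      ← integral_mul_eq_covariance hN.1 hN.1 hN0, Real.toNNReal_of_nonneg hv0]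
    rfl
  have hvne : (⟨v, hv0⟩ : ℝ≥0) ≠ 0 := fun h => hv1.ne' (congrArg NNReal.toReal h)
  have hjoint : ∀ F : ℝ × (ι → ℝ) → ℝ≥0∞, Measurable F → ∫⁻ ω, F (N ω, fun i => R i ω) ∂P
      = ∫⁻ r, ∫⁻ x, F (x, r) ∂(gaussianReal 0 ⟨v, hv0⟩) ∂(P.map fun ω i => R i ω) := by
    intro F hF
    have : IsProbabilityMeasure (P.map fun ω i => R i ω) :=
      Measure.isProbabilityMeasure_map hRm'
    rw [← lintegral_map' (f := F) (g := fun ω => (N ω, fun i => R i ω)) hF.aemeasurable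
      (hNm.prodMk hRm')]
    refine Eq.trans (congrArg (fun μ => ∫⁻ z, F z ∂μ) hprod) ?_
    refine Eq.trans (lintegral_prod_symm' _ hF) ?_
    rw [← hlaw]
  have hdec : ∀ i ω, X (t i) ω = R i ω + k i * N ω := fun i ω => by simp [R]
  have hshift : ∀ i ω, X (t i) ω + β * ∫ ω, N ω * X (t i) ω ∂P
      = R i ω + k i * (N ω + β * v) := fun i ω => by
    simp only [R, k]
    field_simp
    ring
  simp_rw [hshift]
  have h1 := hjoint (fun z => ENNReal.ofReal (Real.exp (β * z.1 - β ^ 2 * v / 2))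
    * h (fun i => z.2 i + k i * z.1)) (by fun_prop)
  have h2 := hjoint (fun z => h (fun i => z.2 i + k i * (z.1 + β * v))) (by fun_prop)
  calc _ = _ := lintegral_congr fun ω => by simp_rw [hdec]
    _ = _ := h1
    _ = _ := lintegral_congr fun r => lintegral_exp_mul_gaussianReal hvne β
        (f := fun x => h (fun i => r i + k i * x)) (by fun_prop)
    _ = _ := h2.symm

end CameronMartin

/-! ### Weights evaluated at a random time -/

section RandomTime

variable {Ω : Type*} [MeasurableSpace Ω] {P : Measure Ω} {η : Ω → ℝ≥0∞}

/-- The `k`-th point of the dyadic partition of order `n` of `[0, T]`. -/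
noncomputable def dyadicTime (T : ℝ≥0) (n k : ℕ) : ℝ≥0 := k * T / 2 ^ n

/-- The index of the dyadic interval of order `n` that contains `x ∈ [0, T]`. -/
noncomputable def dyadicIndex (T : ℝ≥0) (n : ℕ) (x : ℝ≥0∞) : ℕ := ⌊2 ^ n * x.toNNReal / T⌋₊

/-- The first point after `x` of the dyadic partition of order `n` of `[0, T]`. -/
noncomputable def dyadicCeil (T : ℝ≥0) (n : ℕ) (x : ℝ≥0∞) : ℝ≥0 :=
  dyadicTime T n (dyadicIndex T n x + 1)

lemma dyadicTime_le {T : ℝ≥0} {n k : ℕ} (hk : k ≤ 2 ^ n) : dyadicTime T n k ≤ T := by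
  unfold dyadicTime
  rw [div_le_iff₀ (by positivity), mul_comm]
  gcongr
  exact_mod_cast hk

lemma dyadicTime_mono (T : ℝ≥0) (n : ℕ) : Monotone (dyadicTime T n) := fun k l h => by
  unfold dyadicTime
  gcongr

lemma dyadicIndex_eq_iff {T : ℝ≥0} (hT : 0 < T) {n k : ℕ} {x : ℝ≥0∞} (hx : x ≠ ∞) :
    dyadicIndex T n x = k ↔ (dyadicTime T n k : ℝ≥0∞) ≤ x ∧ x < dyadicTime T n (k + 1) := by
  lift x to ℝ≥0 using hx
  rw [ENNReal.coe_le_coe, ENNReal.coe_lt_coe, dyadicIndex, Nat.floor_eq_iff zero_le,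
    ENNReal.toNNReal_coe, le_div_iff₀ hT, div_lt_iff₀ hT, dyadicTime, dyadicTime,
    div_le_iff₀ (by positivity), lt_div_iff₀ (by positivity), mul_comm x]
  push_cast
  rfl

lemma dyadicIndex_lt {T : ℝ≥0} (hT : 0 < T) (n : ℕ) {x : ℝ≥0∞} (hx : x < T) :
    dyadicIndex T n x < 2 ^ n := by
  by_contra! h
  have h1 : (T : ℝ≥0∞) ≤ dyadicTime T n (dyadicIndex T n x) := by
    refine (ENNReal.coe_le_coe.2 ?_).trans (ENNReal.coe_le_coe.2 (dyadicTime_mono T n h))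
    unfold dyadicTime
    push_cast
    rw [mul_div_cancel_left₀ _ (by positivity)]
  exact (h1.trans ((dyadicIndex_eq_iff hT hx.ne_top).1 rfl).1).not_gt hx

omit [MeasurableSpace Ω] in
lemma indicator_dyadicCeil {T : ℝ≥0} (hT : 0 < T) (n : ℕ) (ψ : ℝ≥0 → Ω → ℝ≥0∞) (ω : Ω) :
    {ω | η ω < T}.indicator (fun ω => ψ (dyadicCeil T n (η ω)) ω) ω
      = ∑ k ∈ Finset.range (2 ^ n),
        {ω | (dyadicTime T n k : ℝ≥0∞) ≤ η ω ∧ η ω < dyadicTime T n (k + 1)}.indicator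
          (ψ (dyadicTime T n (k + 1))) ω := by
  by_cases hω : η ω < T
  · have hfin : η ω ≠ ∞ := hω.ne_top
    have hk := (dyadicIndex_eq_iff hT (n := n) hfin).1 rfl
    have hlt := dyadicIndex_lt hT n hω
    rw [Finset.sum_eq_single (dyadicIndex T n (η ω)),
      Set.indicator_of_mem (show ω ∈ {ω | η ω < T} from hω), Set.indicator_of_mem]
    · rfl
    · exact hk
    · intro l _ hl
      refine Set.indicator_of_notMem (fun h => hl ?_) _
      exact ((dyadicIndex_eq_iff hT hfin).2 h).symm
    · exact fun h => absurd (Finset.mem_range.2 hlt) h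
  · rw [Set.indicator_of_notMem (show ω ∉ {ω | η ω < T} from hω)]
    refine (Finset.sum_eq_zero fun k hk => Set.indicator_of_notMem (fun h => hω ?_) _).symm
    exact h.2.trans_le (ENNReal.coe_le_coe.2 (dyadicTime_le (Finset.mem_range.1 hk)))

lemma nullMeasurableSet_between (hη : ∀ t : ℝ≥0, NullMeasurableSet {ω | η ω < t} P) (r t : ℝ≥0) :
    NullMeasurableSet {ω | (r : ℝ≥0∞) ≤ η ω ∧ η ω < t} P := by
  have h : {ω | (r : ℝ≥0∞) ≤ η ω ∧ η ω < t} = {ω | η ω < r}ᶜ ∩ {ω | η ω < t} := by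
    ext ω
    simp
  rw [h]
  exact (hη r).compl.inter (hη t)

lemma aemeasurable_indicator_dyadicCeil {T : ℝ≥0} (hT : 0 < T)
    (hη : ∀ t : ℝ≥0, NullMeasurableSet {ω | η ω < t} P) (n : ℕ) {ψ : ℝ≥0 → Ω → ℝ≥0∞}
    (hψ : ∀ t ≤ T, AEMeasurable (ψ t) P) :
    AEMeasurable ({ω | η ω < T}.indicator fun ω => ψ (dyadicCeil T n (η ω)) ω) P := by
  rw [funext (indicator_dyadicCeil hT n ψ)]
  exact Finset.aemeasurable_fun_sum _ fun k hk => (hψ _ (dyadicTime_le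
    (Finset.mem_range.1 hk))).indicator₀ (nullMeasurableSet_between hη _ _)

lemma lintegral_dyadicCeil {T : ℝ≥0} (hT : 0 < T)
    (hη : ∀ t : ℝ≥0, NullMeasurableSet {ω | η ω < t} P) (n : ℕ) {ψ : ℝ≥0 → Ω → ℝ≥0∞}
    (hψ : ∀ t ≤ T, AEMeasurable (ψ t) P) :
    ∫⁻ ω, {ω | η ω < T}.indicator (fun ω => ψ (dyadicCeil T n (η ω)) ω) ω ∂P
      = ∑ k ∈ Finset.range (2 ^ n),
        ∫⁻ ω in {ω | (dyadicTime T n k : ℝ≥0∞) ≤ η ω ∧ η ω < dyadicTime T n (k + 1)},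
          ψ (dyadicTime T n (k + 1)) ω ∂P := by
  simp_rw [indicator_dyadicCeil hT n ψ]
  rw [lintegral_finsetSum' _ fun k hk => (hψ _ (dyadicTime_le
    (Finset.mem_range.1 hk))).indicator₀ (nullMeasurableSet_between hη _ _)]
  exact Finset.sum_congr rfl fun k _ => lintegral_indicator₀ (nullMeasurableSet_between hη _ _) _

lemma sum_measure_dyadicTime {T : ℝ≥0} (hT : 0 < T)
    (hη : ∀ t : ℝ≥0, NullMeasurableSet {ω | η ω < t} P) (n : ℕ) :
    ∑ k ∈ Finset.range (2 ^ n),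
      P {ω | (dyadicTime T n k : ℝ≥0∞) ≤ η ω ∧ η ω < dyadicTime T n (k + 1)}
      = P {ω | η ω < T} := by
  have h := lintegral_dyadicCeil hT hη n (ψ := fun _ _ => 1) fun _ _ => aemeasurable_const
  rw [lintegral_indicator₀ (hη T)] at h
  simpa using h.symm

lemma tendsto_dyadicCeil {T : ℝ≥0} (hT : 0 < T) {x : ℝ≥0} (hx : x < T) :
    Tendsto (fun n => dyadicCeil T n x) atTop (𝓝[Set.Icc 0 T] x) := by
  have hxT : (x : ℝ≥0∞) < T := ENNReal.coe_lt_coe.2 hx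
  refine tendsto_nhdsWithin_iff.2 ⟨?_, Eventually.of_forall fun n =>
    ⟨zero_le, dyadicTime_le (dyadicIndex_lt hT n hxT)⟩⟩
  have h1 : ∀ n, x ≤ dyadicCeil T n x ∧ dyadicCeil T n x ≤ x + T / 2 ^ n := fun n => by
    obtain ⟨h1, h2⟩ := (dyadicIndex_eq_iff hT (n := n) ENNReal.coe_ne_top).1
      (rfl : dyadicIndex T n x = _)
    rw [ENNReal.coe_le_coe] at h1
    rw [ENNReal.coe_lt_coe] at h2
    refine ⟨h2.le, ?_⟩
    have h3 : dyadicCeil T n x = dyadicTime T n (dyadicIndex T n x) + T / 2 ^ n := by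
      unfold dyadicCeil dyadicTime
      push_cast
      ring
    rw [h3]
    gcongr
  have h2 : Tendsto (fun n : ℕ => x + T / 2 ^ n) atTop (𝓝 (x + 0)) := by
    refine tendsto_const_nhds.add ?_
    have h := (tendsto_pow_atTop_nhds_zero_of_lt_one (r := (2⁻¹ : ℝ≥0)) zero_le
      (by norm_num)).const_mul T
    simpa [div_eq_mul_inv] using h
  rw [add_zero] at h2
  exact tendsto_of_tendsto_of_tendsto_of_le_of_le tendsto_const_nhds h2
    (fun n => (h1 n).1) fun n => (h1 n).2

/-- A weight with the reproducing property `E[z_t 1_{r ≤ η < t}] = P(r ≤ η' < t)` at deterministic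
times keeps it at the random time `η`. The bound on the second moments, with the partition induced
by a third random time, makes the dyadic approximations uniformly integrable. -/
lemma lintegral_indicator_lt_eq {η' η'' : Ω → ℝ≥0∞} [IsProbabilityMeasure P] {T : ℝ≥0}
    (hT : 0 < T)
    (hη : ∀ t : ℝ≥0, NullMeasurableSet {ω | η ω < t} P)
    (hη' : ∀ t : ℝ≥0, NullMeasurableSet {ω | η' ω < t} P)
    (hη'' : ∀ t : ℝ≥0, NullMeasurableSet {ω | η'' ω < t} P) {z : ℝ≥0 → Ω → ℝ≥0∞} {C : ℝ≥0∞}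
    (hC : C ≠ ∞) (hz : ∀ t ≤ T, AEMeasurable (z t) P)
    (hzc : ∀ᵐ ω ∂P, ContinuousOn (fun t => z t ω) (Set.Icc 0 T))
    (h1 : ∀ r t : ℝ≥0, r ≤ t → t ≤ T → ∫⁻ ω in {ω | (r : ℝ≥0∞) ≤ η ω ∧ η ω < t}, z t ω ∂P
      = P {ω | (r : ℝ≥0∞) ≤ η' ω ∧ η' ω < t})
    (h2 : ∀ r t : ℝ≥0, r ≤ t → t ≤ T → ∫⁻ ω in {ω | (r : ℝ≥0∞) ≤ η ω ∧ η ω < t}, z t ω * z t ω ∂P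
      ≤ C * P {ω | (r : ℝ≥0∞) ≤ η'' ω ∧ η'' ω < t}) :
    AEMeasurable ({ω | η ω < T}.indicator fun ω => z (η ω).toNNReal ω) P ∧
      ∫⁻ ω, {ω | η ω < T}.indicator (fun ω => z (η ω).toNNReal ω) ω ∂P = P {ω | η' ω < T} := by
  set G : ℕ → Ω → ℝ≥0∞ := fun n => {ω | η ω < T}.indicator fun ω => z (dyadicCeil T n (η ω)) ω
    with hG
  set F : Ω → ℝ≥0∞ := {ω | η ω < T}.indicator fun ω => z (η ω).toNNReal ω with hF
  have hle : ∀ n, ∀ k ∈ Finset.range (2 ^ n), dyadicTime T n (k + 1) ≤ T := fun n k hk =>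
    dyadicTime_le (Finset.mem_range.1 hk)
  have hGm : ∀ n, AEMeasurable (G n) P := fun n => aemeasurable_indicator_dyadicCeil hT hη n hz
  have hG1 : ∀ n, ∫⁻ ω, G n ω ∂P = P {ω | η' ω < T} := fun n => by
    rw [hG, lintegral_dyadicCeil hT hη n hz, ← sum_measure_dyadicTime hT hη' n]
    exact Finset.sum_congr rfl fun k hk => h1 _ _ (dyadicTime_mono T n k.le_succ) (hle n k hk)
  have hG2 : ∀ n, ∫⁻ ω, G n ω * G n ω ∂P ≤ C := fun n => by
    have h : ∀ ω, G n ω * G n ω = {ω | η ω < T}.indicator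
        (fun ω => (fun t ω => z t ω * z t ω) (dyadicCeil T n (η ω)) ω) ω := fun ω => by
      simp only [hG, Set.indicator]
      split_ifs <;> simp
    simp_rw [h]
    rw [lintegral_dyadicCeil hT hη n (ψ := fun t ω => z t ω * z t ω)
      fun t ht => (hz t ht).mul (hz t ht)]
    refine (Finset.sum_le_sum fun k hk => h2 _ _ (dyadicTime_mono T n k.le_succ)
      (hle n k hk)).trans ?_
    rw [← Finset.mul_sum, sum_measure_dyadicTime hT hη'' n]
    exact mul_le_of_le_one_right' prob_le_one
  have hGF : ∀ᵐ ω ∂P, Tendsto (fun n => G n ω) atTop (𝓝 (F ω)) := by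
    filter_upwards [hzc] with ω hω
    by_cases h : η ω < T
    · simp only [hG, hF, Set.indicator_of_mem (show ω ∈ {ω | η ω < T} from h)]
      obtain ⟨x, hx⟩ : ∃ x : ℝ≥0, (x : ℝ≥0∞) = η ω := ⟨_, ENNReal.coe_toNNReal h.ne_top⟩
      rw [← hx] at h ⊢
      rw [ENNReal.toNNReal_coe]
      have hxT := ENNReal.coe_lt_coe.1 h
      exact Tendsto.comp (hω x ⟨zero_le, hxT.le⟩) (tendsto_dyadicCeil hT hxT)
    · simp only [hG, hF, Set.indicator_of_notMem (show ω ∉ {ω | η ω < T} from h)]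
      exact tendsto_const_nhds
  refine ⟨aemeasurable_of_tendsto_metrizable_ae atTop hGm hGF, le_antisymm ?_ ?_⟩
  · refine (lintegral_mono_ae ?_).trans ((lintegral_liminf_le' hGm).trans_eq
      ((congrArg (liminf · atTop) (funext hG1)).trans (liminf_const _)))
    filter_upwards [hGF] with ω hω
    exact hω.liminf_eq.ge
  · -- truncate at the height `K` and let `K → ∞`
    have hK : ∀ K : ℕ, K ≠ 0 → P {ω | η' ω < T} ≤ ∫⁻ ω, F ω ∂P + C / K := fun K hK => by
      have hK0 : (K : ℝ≥0∞) ≠ 0 := by exact_mod_cast hK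
      have hKt : (K : ℝ≥0∞) ≠ ∞ := ENNReal.natCast_ne_top K
      have hmin : ∀ x : ℝ≥0∞, x ≤ min x K + x * x / K := fun x => by
        rcases le_total x K with h | h
        · rw [min_eq_left h]
          exact le_self_add
        · refine le_trans ?_ le_add_self
          rw [ENNReal.le_div_iff_mul_le (.inl hK0) (.inl hKt)]
          gcongr
      have hlim : Tendsto (fun n => ∫⁻ ω, min (G n ω) K ∂P) atTop
          (𝓝 (∫⁻ ω, min (F ω) K ∂P)) := by
        refine tendsto_lintegral_of_dominated_convergence' (fun _ => (K : ℝ≥0∞))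
          (fun n => (hGm n).min aemeasurable_const)
          (fun n => Eventually.of_forall fun ω => min_le_right _ _) (by simp [hKt]) ?_
        filter_upwards [hGF] with ω hω using hω.min tendsto_const_nhds
      have hn : ∀ n, P {ω | η' ω < T} ≤ ∫⁻ ω, min (G n ω) K ∂P + C / K := fun n => by
        rw [← hG1 n]
        refine (lintegral_mono fun ω => hmin (G n ω)).trans ?_
        rw [lintegral_add_left' ((hGm n).min aemeasurable_const)]
        gcongr
        simp_rw [div_eq_mul_inv]
        rw [lintegral_mul_const'' (f := fun ω => G n ω * G n ω) _ ((hGm n).mul (hGm n))]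
        gcongr
        exact hG2 n
      refine (ge_of_tendsto' (hlim.add_const (C / K)) hn).trans ?_
      gcongr
      exact min_le_left _ _
    have hlim : Tendsto (fun K : ℕ => ∫⁻ ω, F ω ∂P + C / K) atTop (𝓝 (∫⁻ ω, F ω ∂P + 0)) := by
      refine tendsto_const_nhds.add ?_
      have h := ENNReal.Tendsto.const_div ENNReal.tendsto_nat_nhds_top (.inr hC)
      rwa [ENNReal.div_top] at h
    rw [add_zero] at hlim
    refine ge_of_tendsto hlim ?_
    filter_upwards [eventually_ne_atTop 0] with K h using hK K h

end RandomTime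

/-! ### The first passage time -/

section Passage

variable {Ω : Type*} {X : ℝ≥0 → Ω → ℝ} {u : ℝ}

/-- The paths indexed by `D` that exceed the level `u - b s` at a time `s ∈ D`, `0 < s < t`. -/
def crossingSet (D : Set ℝ≥0) (u b : ℝ) (t : ℝ≥0) : Set (D → ℝ) :=
  {x | ∃ s : D, (0 < (s : ℝ≥0) ∧ (s : ℝ≥0) < t) ∧ u < x s + b * (s : ℝ≥0)}

lemma measurableSet_crossingSet {D : Set ℝ≥0} (hD : D.Countable) (u b : ℝ) (t : ℝ≥0) :
    MeasurableSet (crossingSet D u b t) := by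
  have : Countable D := hD.to_subtype
  simp only [crossingSet, Set.ofPred_exists]
  refine MeasurableSet.iUnion fun s => (MeasurableSet.const _).inter ?_
  exact measurableSet_lt measurable_const ((measurable_pi_apply s).add_const _)

lemma add_mem_crossingSet {D : Set ℝ≥0} {b m : ℝ} {t r : ℝ≥0} (htr : t ≤ r) {x y : D → ℝ}
    (hy : ∀ s : D, (s : ℝ≥0) ≤ r → y s = m * (s : ℝ≥0)) :
    (fun s => x s + y s) ∈ crossingSet D u b t ↔ x ∈ crossingSet D u (b + m) t := by
  refine exists_congr fun s => and_congr_right fun hs => ?_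
  have h : x s + y s + b * (s : ℝ≥0) = x s + (b + m) * (s : ℝ≥0) := by
    rw [hy s (hs.2.le.trans htr)]
    ring
  exact iff_of_eq (congrArg (u < ·) h)

lemma passageTime_lt_iff {b : ℝ} {ω : Ω} {x : ℝ≥0∞} :
    passageTime X b u ω < x ↔ ∃ s : ℝ≥0, (0 < s ∧ (s : ℝ≥0∞) < x) ∧ u < X s ω + b * s := by
  unfold passageTime
  rw [sInf_lt_iff]
  constructor
  · rintro ⟨_, ⟨s, hs, rfl⟩, h⟩
    exact ⟨s, ⟨hs.1, h⟩, hs.2⟩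
  · rintro ⟨s, hs, h⟩
    exact ⟨s, ⟨s, ⟨hs.1, h⟩, rfl⟩, hs.2⟩

lemma passageTime_lt_iff_mem_crossingSet {D : Set ℝ≥0} (hD : Dense D) {b : ℝ} {ω : Ω}
    (hω : Continuous fun t => X t ω) {t : ℝ≥0} :
    passageTime X b u ω < t ↔ (fun s : D => X s ω) ∈ crossingSet D u b t := by
  rw [passageTime_lt_iff]
  constructor
  · rintro ⟨s, ⟨hs0, hst⟩, hs⟩
    have ho : IsOpen {s : ℝ≥0 | (0 < s ∧ s < t) ∧ u < X s ω + b * s} :=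
      isOpen_Ioo.inter (isOpen_lt continuous_const
        (hω.add (continuous_const.mul NNReal.continuous_coe)))
    obtain ⟨r, hr, hrD⟩ := hD.inter_open_nonempty _ ho ⟨s, ⟨hs0, ENNReal.coe_lt_coe.1 hst⟩, hs⟩
    exact ⟨⟨r, hrD⟩, hr⟩
  · rintro ⟨s, hs, h⟩
    exact ⟨s, ⟨hs.1, ENNReal.coe_lt_coe.2 hs.2⟩, h⟩

/-- At a finite first passage time a continuous path is exactly at its level. -/
lemma eval_of_passageTime_eq {b : ℝ} {ω : Ω} (hω : Continuous fun t => X t ω) {t : ℝ≥0}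
    (ht : 0 < t) (h : passageTime X b u ω = t) : X t ω + b * t = u := by
  have hc : Continuous fun s : ℝ≥0 => X s ω + b * s := by fun_prop
  refine le_antisymm ?_ ?_
  · by_contra! hlt
    have hev : ∀ᶠ s in 𝓝[<] t, u < X s ω + b * s :=
      (hc.continuousAt.eventually_const_lt hlt).filter_mono nhdsWithin_le_nhds
    have : (𝓝[<] t).NeBot := nhdsLT_neBot_of_exists_lt ⟨0, ht⟩
    obtain ⟨s, hs, hs1⟩ := (hev.and (Ioo_mem_nhdsLT ht)).exists
    have h1 : passageTime X b u ω < t :=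
      passageTime_lt_iff.2 ⟨s, ⟨hs1.1, ENNReal.coe_lt_coe.2 hs1.2⟩, hs⟩
    exact h1.ne h
  · by_contra! hlt
    obtain ⟨r, hr, hrs⟩ := (nhdsGE_basis t).mem_iff.1
      (mem_nhdsWithin_of_mem_nhds (hc.continuousAt.eventually_lt_const hlt))
    have h1 : passageTime X b u ω < r := h ▸ ENNReal.coe_lt_coe.2 hr
    obtain ⟨s, hs, hs1⟩ := passageTime_lt_iff.1 h1
    have h2 : t ≤ s := by
      by_contra! hst
      have h3 : passageTime X b u ω < t :=
        passageTime_lt_iff.2 ⟨s, ⟨hs.1, ENNReal.coe_lt_coe.2 hst⟩, hs1⟩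
      exact h3.ne h
    exact hs1.not_gt (hrs ⟨h2, ENNReal.coe_lt_coe.1 hs.2⟩)

lemma sInf_surplus_neg_iff {ϑ : ℝ} {ω : Ω} (hω : Continuous fun t => X t ω) {T : ℝ≥0}
    (hT : 0 < T) : sInf ((fun t => surplus u ϑ X t ω) '' Set.Icc 0 T) < 0
      ↔ passageTime X (-ϑ) u ω < T := by
  have hc : Continuous fun t => surplus u ϑ X t ω := by
    unfold surplus
    fun_prop
  rw [csInf_lt_iff (isCompact_Icc.image hc).bddBelow
    ((Set.nonempty_Icc.2 hT.le).image _), passageTime_lt_iff]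
  constructor
  · rintro ⟨_, ⟨t, ht, rfl⟩, h⟩
    -- a negative value on `[0, T]` is also taken, by continuity, on `(0, T)`
    have hcl : t ∈ closure (Set.Ioo 0 T) := by rwa [closure_Ioo hT.ne]
    obtain ⟨s, hs, hs1⟩ := mem_closure_iff.1 hcl _ (isOpen_lt hc continuous_const) h
    have hs' : surplus u ϑ X s ω < 0 := hs
    refine ⟨s, ⟨hs1.1, ENNReal.coe_lt_coe.2 hs1.2⟩, ?_⟩
    unfold surplus at hs'
    linarith
  · rintro ⟨s, hs, h⟩
    refine ⟨_, ⟨s, ⟨zero_le, (ENNReal.coe_lt_coe.1 hs.2).le⟩, rfl⟩, ?_⟩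
    simp only [surplus]
    linarith

variable [MeasurableSpace Ω] {P : Measure Ω}

lemma nullMeasurableSet_passageTime_lt (hX : ∀ t, AEMeasurable (X t) P)
    (hc : ∀ᵐ ω ∂P, Continuous fun t => X t ω) (u b : ℝ) (t : ℝ≥0) :
    NullMeasurableSet {ω | passageTime X b u ω < t} P := by
  obtain ⟨D, hD, hDd⟩ := TopologicalSpace.exists_countable_dense ℝ≥0
  have : Countable D := hD.to_subtype
  have hm : AEMeasurable (fun ω (s : D) => X s ω) P := aemeasurable_pi_lambda _ fun s => hX s
  refine (hm.nullMeasurable (measurableSet_crossingSet hD u b t)).congr ?_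
  filter_upwards [hc] with ω hω
  exact propext (passageTime_lt_iff_mem_crossingSet hDd hω).symm

end Passage

section Weight

variable {Ω : Type*} [MeasurableSpace Ω] {P : Measure Ω} [IsProbabilityMeasure P]
  {X : ℝ≥0 → Ω → ℝ} {H σ : ℝ}

/-- Under the exponential weight of slope `β` the process acquires the drift `β σ`, so the passage
time over the line `u - b s` behaves like the one over `u - (b + β σ) s`. -/
lemma setLIntegral_exp_passageTime (hX : IsMixedGaussian H σ X P) (hH : 1 / 2 < H)
    (hpos : FracPos H) (hσ : 0 < σ) (hc : ∀ᵐ ω ∂P, Continuous fun t => X t ω) {N : Ω → ℝ}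
    {t : ℝ≥0} (hN : IsWienerIntegral P X t (fun s => mixedKer hH σ s t) N) (u b β : ℝ) {r : ℝ≥0}
    (hr : r ≤ t) :
    ∫⁻ ω in {ω | (r : ℝ≥0∞) ≤ passageTime X b u ω ∧ passageTime X b u ω < t},
      ENNReal.ofReal (Real.exp (β * N ω
        - β ^ 2 * (σ ^ 2 * ∫ s in (0 : ℝ)..t, mixedKer hH σ s s ^ 2) / 2)) ∂P
      = P {ω | (r : ℝ≥0∞) ≤ passageTime X (b + β * σ) u ω
        ∧ passageTime X (b + β * σ) u ω < t} := by
  obtain ⟨D, hD, hDd⟩ := TopologicalSpace.exists_countable_dense ℝ≥0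
  have : Countable D := hD.to_subtype
  have hXm : ∀ t, AEMeasurable (X t) P := hX.isGaussianProcess.aemeasurable
  have hnull := fun b => nullMeasurableSet_between
    (nullMeasurableSet_passageTime_lt hXm hc u b) r t
  have hiff : ∀ b, ∀ᵐ ω ∂P, ((r : ℝ≥0∞) ≤ passageTime X b u ω ∧ passageTime X b u ω < t ↔
      (fun s : D => X s ω) ∈ crossingSet D u b t \ crossingSet D u b r) := fun b => by
    filter_upwards [hc] with ω hω
    rw [← not_lt, passageTime_lt_iff_mem_crossingSet hDd hω,
      passageTime_lt_iff_mem_crossingSet hDd hω]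
    exact and_comm
  have hA : MeasurableSet (crossingSet D u b t \ crossingSet D u b r) :=
    (measurableSet_crossingSet hD u b t).diff (measurableSet_crossingSet hD u b r)
  have hCM := hN.inGaussianSpace.lintegral_exp_mul hX.isGaussianProcess hX.integral_eq_zero
    (fun s : D => (s : ℝ≥0)) β (h := (crossingSet D u b t \ crossingSet D u b r).indicator 1)
    (measurable_one.indicator hA)
  rw [hN.integral_mul_mixedKer hX hH hpos hσ le_rfl hN] at hCM
  have hdrift : ∀ s : D, (s : ℝ≥0) ≤ t → β * ∫ ω, N ω * X s ω ∂P = β * σ * (s : ℝ≥0) :=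
    fun s hs => by rw [hN.integral_mul_eval_mixedKer hX hH hpos hσ hs, mul_assoc]
  rw [← lintegral_indicator₀ (hnull b), ← lintegral_indicator_one₀ (hnull (b + β * σ))]
  refine Eq.trans (lintegral_congr_ae ?_) (hCM.trans (lintegral_congr_ae ?_))
  · filter_upwards [hiff b] with ω hω
    by_cases h : (fun s : D => X s ω) ∈ crossingSet D u b t \ crossingSet D u b r
    · rw [Set.indicator_of_mem (by exact hω.2 h), Set.indicator_of_mem h, Pi.one_apply, mul_one]
    · rw [Set.indicator_of_notMem (by exact fun h' => h (hω.1 h')),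
        Set.indicator_of_notMem h, mul_zero]
  · filter_upwards [hiff (b + β * σ)] with ω hω
    have h1 : (fun s : D => X s ω + β * ∫ ω, N ω * X s ω ∂P)
        ∈ crossingSet D u b t \ crossingSet D u b r
        ↔ (r : ℝ≥0∞) ≤ passageTime X (b + β * σ) u ω
          ∧ passageTime X (b + β * σ) u ω < t := by
      rw [hω, Set.mem_sdiff, Set.mem_sdiff, add_mem_crossingSet le_rfl hdrift,
        add_mem_crossingSet hr hdrift]
    by_cases h : (r : ℝ≥0∞) ≤ passageTime X (b + β * σ) u ω ∧ passageTime X (b + β * σ) u ω < t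
    · rw [Set.indicator_of_mem (h1.2 h), Set.indicator_of_mem (by exact h)]
      rfl
    · rw [Set.indicator_of_notMem (fun h' => h (h1.1 h')), Set.indicator_of_notMem (by exact h)]

end Weight

/-! ### The ruin probability -/

section Ruin

variable {Ω : Type*} [MeasurableSpace Ω] {P : Measure Ω} [IsProbabilityMeasure P]
  {X : ℝ≥0 → Ω → ℝ} {H σ : ℝ}

lemma ae_passageTime_ne (hX : IsMixedGaussian H σ X P) (hH : 0 < H) (hσ : 0 < σ)
    (hc : ∀ᵐ ω ∂P, Continuous fun t => X t ω) (b u : ℝ) {T : ℝ≥0} (hT : 0 < T) :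
    ∀ᵐ ω ∂P, passageTime X b u ω ≠ T := by
  have hG := hX.isGaussianProcess.hasGaussianLaw_eval T
  have hvar : Var[X T; P].toNNReal ≠ 0 := by
    have hH : 2 * H ≠ 0 := by positivity
    have h : Var[X T; P] = σ ^ 2 * T + (T : ℝ) ^ (2 * H) := by
      rw [← covariance_self (hX.isGaussianProcess.aemeasurable T),
        ← integral_mul_eq_covariance (hX.memLp_two T) (hX.memLp_two T) (hX.integral_eq_zero T),
        hX.integral_mul, min_self, sub_self, abs_zero,
        Real.zero_rpow hH]
      ring
    have hT' : (0 : ℝ) < T := NNReal.coe_pos.2 hT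
    rw [h, Ne, Real.toNNReal_eq_zero, not_le]
    positivity
  have : NullSingletonClass (gaussianReal (∫ ω, X T ω ∂P) Var[X T; P].toNNReal) :=
    nullSingletonClass_gaussianReal hvar
  have h0 : P (X T ⁻¹' {u - b * T}) = 0 := by
    rw [← Measure.map_apply_of_aemeasurable hG.aemeasurable (measurableSet_singleton _),
      hG.map_eq_gaussianReal, measure_singleton]
  filter_upwards [hc, measure_eq_zero_iff_ae_notMem.1 h0] with ω hω h1 h2
  exact h1 (eq_sub_of_add_eq (eval_of_passageTime_eq hω hT h2))

lemma continuousOn_integral_mixedKer_self (hH : 1 / 2 < H) (hpos : FracPos H) (hσ : 0 < σ)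
    (T : ℝ≥0) : ContinuousOn (fun t : ℝ≥0 => ∫ s in (0 : ℝ)..t, mixedKer hH σ s s ^ 2)
      (Set.Icc 0 T) := by
  have h := intervalIntegral.continuousOn_primitive_interval (μ := volume)
    (f := fun s => mixedKer hH σ s s ^ 2) (a := 0) (b := (T : ℝ)) (by
      rw [Set.uIcc_of_le T.coe_nonneg, ← intervalIntegrable_iff_integrableOn_Icc_of_le T.coe_nonneg]
      exact intervalIntegrable_mixedKer_self hH hpos hσ le_rfl T.coe_nonneg)
  rw [Set.uIcc_of_le T.coe_nonneg] at h
  exact h.comp NNReal.continuous_coe.continuousOn fun t ht =>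
    ⟨t.coe_nonneg, NNReal.coe_le_coe.2 ht.2⟩

/-- Let `β = -(a + ϑ) / σ`. The passage time with parameter `a` has, under the weight, the law that
the one with parameter `a + βσ = -ϑ` has under `P`, and under the normalized square of the weight
the law of the one with parameter `a + 2βσ`. -/
lemma integrable_ruinWeight_and_ruinProbability_eq (hX : IsMixedGaussian H σ X P) (hH : 1 / 2 < H)
    (hpos : FracPos H) (hσ : 0 < σ) (hc : ∀ᵐ ω ∂P, Continuous fun t => X t ω) {T : ℝ≥0}
    (hT : 0 < T) {N : ℝ≥0 → Ω → ℝ} (hN : IsContinuousIntegralProcess P X T (mixedKer hH σ) N)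
    (ϑ u a : ℝ) :
    Integrable (ruinWeight σ ϑ a T (mixedKer hH σ) N (passageTime X a u)) P ∧
      ruinProbability P (surplus u ϑ X) T
        = ∫ ω, ruinWeight σ ϑ a T (mixedKer hH σ) N (passageTime X a u) ω ∂P := by
  set V : ℝ≥0 → ℝ := fun t => ∫ s in (0 : ℝ)..t, mixedKer hH σ s s ^ 2 with hV
  set β : ℝ := -((a + ϑ) / σ) with hβ
  have hβσ : β * σ = -(a + ϑ) := by
    rw [hβ]
    field_simp
  have hβσ2 : β ^ 2 * σ ^ 2 = (a + ϑ) ^ 2 := by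
    rw [← mul_pow, hβσ, neg_sq]
  let z : ℝ≥0 → Ω → ℝ := fun t ω => Real.exp (β * N t ω - (a + ϑ) ^ 2 / 2 * V t)
  have hz0 : ∀ t ω, 0 ≤ z t ω := fun t ω => (Real.exp_pos _).le
  have hXm : ∀ t, AEMeasurable (X t) P := hX.isGaussianProcess.aemeasurable
  have hnull := nullMeasurableSet_passageTime_lt hXm hc u
  have hVT : ∀ t ≤ T, V t ≤ V T := fun t ht => by
    refine sub_nonneg.1 ?_
    rw [hV, intervalIntegral.integral_interval_sub_left
      (intervalIntegrable_mixedKer_self hH hpos hσ le_rfl T.coe_nonneg)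
      (intervalIntegrable_mixedKer_self hH hpos hσ le_rfl t.coe_nonneg)]
    exact intervalIntegral.integral_nonneg (NNReal.coe_le_coe.2 ht) fun _ _ => sq_nonneg _
  -- the exponent of the square of the weight is twice that of the weight of slope `2 β`,
  -- up to the bounded term `(a + ϑ)² V`
  have hsq : ∀ t ω, ENNReal.ofReal (z t ω) * ENNReal.ofReal (z t ω)
      = ENNReal.ofReal (Real.exp ((a + ϑ) ^ 2 * V t))
        * ENNReal.ofReal (Real.exp (2 * β * N t ω - (2 * β) ^ 2 * (σ ^ 2 * V t) / 2)) :=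
    fun t ω => by
      rw [← ENNReal.ofReal_mul (hz0 t ω), ← ENNReal.ofReal_mul (Real.exp_pos _).le,
        ← Real.exp_add, ← Real.exp_add]
      congr 2
      linear_combination (2 * V t) * hβσ2
  obtain ⟨hm, hint⟩ := lintegral_indicator_lt_eq (P := P) hT (hnull a) (hnull (a + β * σ))
    (hnull (a + 2 * β * σ)) (z := fun t ω => ENNReal.ofReal (z t ω))
    (C := ENNReal.ofReal (Real.exp ((a + ϑ) ^ 2 * V T))) ENNReal.ofReal_ne_top
    (fun t ht => ENNReal.measurable_ofReal.comp_aemeasurable (Real.measurable_exp.comp_aemeasurable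
      (((hN.isWienerIntegral t ht).1.1.aemeasurable.const_mul β).sub_const _)))
    (by
      filter_upwards [hN.cont] with ω hω
      exact ENNReal.continuous_ofReal.comp_continuousOn (Real.continuous_exp.comp_continuousOn
        ((continuousOn_const.mul hω).sub
          (continuousOn_const.mul (continuousOn_integral_mixedKer_self hH hpos hσ T)))))
    (fun r t hr ht => by
      rw [← setLIntegral_exp_passageTime hX hH hpos hσ hc (hN.isWienerIntegral t ht) u a β hr]
      refine lintegral_congr fun ω => ?_
      simp only [z]
      congr 3
      linear_combination (-V t / 2) * hβσ2)
    (fun r t hr ht => by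
      simp_rw [hsq]
      rw [lintegral_const_mul' _ _ ENNReal.ofReal_ne_top,
        setLIntegral_exp_passageTime hX hH hpos hσ hc (hN.isWienerIntegral t ht) u a (2 * β) hr]
      gcongr
      exact hVT t ht)
  -- the event `η = T` is negligible
  have hae : ruinWeight σ ϑ a T (mixedKer hH σ) N (passageTime X a u)
      =ᵐ[P] fun ω => ({ω | passageTime X a u ω < T}.indicator
        (fun ω => ENNReal.ofReal (z (passageTime X a u ω).toNNReal ω)) ω).toReal := by
    filter_upwards [ae_passageTime_ne hX (by linarith) hσ hc a u hT] with ω hω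
    by_cases h : passageTime X a u ω < T
    · rw [Set.indicator_of_mem (by exact h), ENNReal.toReal_ofReal (hz0 _ _), ruinWeight,
        Set.indicator_of_mem (by exact h.le)]
      rfl
    · rw [Set.indicator_of_notMem (by exact h), ruinWeight,
        Set.indicator_of_notMem (by exact fun h' => h (lt_of_le_of_ne h' hω)), ENNReal.toReal_zero]
  have hfin := hint ▸ measure_ne_top P {ω | passageTime X (a + β * σ) u ω < T}
  refine ⟨(integrable_congr hae).2 (integrable_toReal_of_lintegral_ne_top hm hfin), ?_⟩
  rw [integral_congr_ae hae, integral_toReal hm (ae_lt_top' hm hfin), hint, ruinProbability,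
    hβσ, show a + -(a + ϑ) = -ϑ by ring]
  refine congrArg ENNReal.toReal (measure_congr ?_)
  filter_upwards [hc] with ω hω
  exact propext (sInf_surplus_neg_iff hω hT)

end Ruin

section Kernel

variable {H σ : ℝ} {T : ℝ≥0}

lemma fracConv_eq (H t : ℝ) (F : ℝ → ℝ) (s : ℝ) :
    fracConv H t F s = H * (2 * H - 1) * ∫ r in (0 : ℝ)..t, F r * |r - s| ^ (2 * H - 2) := by
  unfold fracConv fracKernel
  rw [← intervalIntegral.integral_const_mul]
  refine intervalIntegral.integral_congr fun r _ => ?_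
  ring

lemma isMixedKernel_equation_iff (hσ : 0 < σ) {F : ℝ → ℝ} {s t : ℝ} :
    σ * F s + 1 / σ * (H * (2 * H - 1)) * (∫ r in (0 : ℝ)..t, F r * |r - s| ^ (2 * H - 2)) = 1
      ↔ σ ^ 2 * F s + fracConv H t F s = σ := by
  rw [fracConv_eq]
  field_simp

lemma isMixedKernel_mixedKer (hH : 1 / 2 < H) (hpos : FracPos H) (hσ : 0 < σ) :
    IsMixedKernel σ H T (mixedKer hH σ) where
  continuousOn t _ := (continuous_mixedKer_left hH t).continuousOn
  equation _ _ _ hs := (isMixedKernel_equation_iff (F := fun s => mixedKer hH σ s _) hσ).2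
    (mixedKer_equation hH hpos hσ hs)

lemma IsMixedKernel.eq_mixedKer {g : ℝ → ℝ → ℝ} (hg : IsMixedKernel σ H T g) (hH : 1 / 2 < H)
    (hpos : FracPos H) (hσ : 0 < σ) {s t : ℝ} (ht : t ∈ Set.Icc (0 : ℝ) T)
    (hs : s ∈ Set.Icc (0 : ℝ) t) : g s t = mixedKer hH σ s t :=
  _root_.eq_mixedKer hH hpos hσ (hg.continuousOn t ht) (fun r hr =>
    (isMixedKernel_equation_iff (F := fun s => g s t) hσ).1 (hg.equation t ht r hr)) hs

/-- The weight depends on the kernel only through its values on `0 ≤ s ≤ t ≤ T`. -/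
lemma ruinWeight_congr {Ω : Type*} {ϑ a : ℝ} {g g' : ℝ → ℝ → ℝ} {N : ℝ≥0 → Ω → ℝ}
    {η : Ω → ℝ≥0∞} (h : ∀ s ∈ Set.Icc (0 : ℝ) T, g s s = g' s s) :
    ruinWeight σ ϑ a T g N η = ruinWeight σ ϑ a T g' N η := by
  ext ω
  unfold ruinWeight
  by_cases hω : η ω ≤ T
  · rw [Set.indicator_of_mem (by exact hω), Set.indicator_of_mem (by exact hω)]
    congr 3
    refine intervalIntegral.integral_congr fun s hs => ?_
    rw [Set.uIcc_of_le ENNReal.toReal_nonneg] at hs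
    have h1 : (η ω).toReal ≤ T := ENNReal.toReal_le_coe_of_le_coe hω
    simp only [h s ⟨hs.1, hs.2.trans h1⟩]
  · rw [Set.indicator_of_notMem (by exact hω), Set.indicator_of_notMem (by exact hω)]

end Kernel

theorem mainTheorem3 {Ω : Type*} [MeasurableSpace Ω] (P : Measure Ω) [IsProbabilityMeasure P]
    (W B : ℝ≥0 → Ω → ℝ) (σ H ϑ u : ℝ) (T : ℝ≥0)
    (hσ : 0 < σ) (hH : 1 / 2 < H) (hH1 : H < 1) (hu : 0 < u) (hT : 0 < T)
    (hW : IsBrownianReal W P) (hB : IsFractionalBrownian H B P)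
    (hWB : IndepFun (fun ω t => W t ω) (fun ω t => B t ω) P) :
    -- the kernel exists and is unique on `0 ≤ s ≤ t ≤ T`
    (∃ g : ℝ → ℝ → ℝ, IsMixedKernel σ H T g ∧ ∀ g' : ℝ → ℝ → ℝ, IsMixedKernel σ H T g' →
      ∀ t ∈ Set.Icc (0 : ℝ) T, ∀ s ∈ Set.Icc (0 : ℝ) t, g' s t = g s t) ∧
    ∀ g : ℝ → ℝ → ℝ, IsMixedKernel σ H T g →
      IntervalIntegrable (fun s => g s s ^ 2) volume 0 T ∧
      -- `t ↦ ∫_0^t g(s, t) dξ_s` has a continuous version, and the formula holds for each of them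
      (∃ N : ℝ≥0 → Ω → ℝ, IsContinuousIntegralProcess P (mixedProcess σ W B) T g N) ∧
      ∀ N : ℝ≥0 → Ω → ℝ, IsContinuousIntegralProcess P (mixedProcess σ W B) T g N →
        ∀ a : ℝ,
          Integrable (ruinWeight σ ϑ a T g N (passageTime (mixedProcess σ W B) a u)) P ∧
          ruinProbability P (surplus u ϑ (mixedProcess σ W B)) T =
            ∫ ω, ruinWeight σ ϑ a T g N (passageTime (mixedProcess σ W B) a u) ω ∂P := by
  have hX := isMixedGaussian_mixedProcess (σ := σ) hW hB hWB
  have hpos : FracPos H := hB.isMixedGaussian.fracPos hH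
  have hc : ∀ᵐ ω ∂P, Continuous fun t => mixedProcess σ W B t ω := by
    filter_upwards [hW.cont, hB.cont] with ω h1 h2 using (continuous_const.mul h1).add h2
  refine ⟨⟨mixedKer hH σ, isMixedKernel_mixedKer hH hpos hσ,
    fun g hg t ht s hs => hg.eq_mixedKer hH hpos hσ ht hs⟩, fun g hg => ?_⟩
  have hgk : ∀ t ∈ Set.Icc (0 : ℝ) T, ∀ s ∈ Set.Icc (0 : ℝ) t, g s t = mixedKer hH σ s t :=
    fun t ht s hs => hg.eq_mixedKer hH hpos hσ ht hs
  refine ⟨?_, ?_, fun N hN a => ?_⟩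
  · refine (intervalIntegrable_mixedKer_self hH hpos hσ le_rfl T.coe_nonneg).congr fun s hs => ?_
    rw [Set.uIoc_of_le T.coe_nonneg] at hs
    simp only [hgk s ⟨hs.1.le, hs.2⟩ s ⟨hs.1.le, le_rfl⟩]
  · obtain ⟨N, hN⟩ := exists_isContinuousIntegralProcess hX hH hpos hσ hT
    exact ⟨N, fun t ht => (hN.isWienerIntegral t ht).congr_fun fun s hs =>
      (hgk t ⟨t.coe_nonneg, NNReal.coe_le_coe.2 ht⟩ s hs).symm, hN.cont⟩
  · have hN' : IsContinuousIntegralProcess P (mixedProcess σ W B) T (mixedKer hH σ) N :=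
      ⟨fun t ht => (hN.isWienerIntegral t ht).congr_fun
        (hgk t ⟨t.coe_nonneg, NNReal.coe_le_coe.2 ht⟩), hN.cont⟩
    rw [ruinWeight_congr fun s hs => hgk s hs s ⟨hs.1, le_rfl⟩]
    exact integrable_ruinWeight_and_ruinProbability_eq hX hH hpos hσ hc hT hN' ϑ u a
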